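/- Let $M$ be a smooth surface with a smooth Lorentzian metric $\boldsymbol g$. For a local orthonormal coframe $(\eta^1,\eta^2)$ of $M$, so that $\boldsymbol g=(\eta^1)^2-(\eta^2)^2$, define the connection form $\eta^1_2=\eta^2_1$ and the Gauss curvature $K$ by $$d\eta^1=-\eta^1_2\wedge\eta^2,\qquad d\eta^2=-\eta^2_1\wedge\eta^1,\qquad d\eta^1_2=-K\,\eta^1\wedge\eta^2 .$$ Suppose that $K$ is strictly positive ($\varepsilon=1$) or strictly negative ($\varepsilon=-1$) on $M$, put $q=|K|^{-3/4}$, and define its covariant derivatives $q_i$, $q_{ij}$ by $dq=q_i\eta^i$, $dq_i=q_j\eta^j_i+q_{ij}\eta^j$ (with $\eta^1_1=\eta^2_2=0$). Let $\mathbb R^{1,2}$ be Minkowski space with the inner product of signature $(1,2)$, and let $\mathcal F$ be its bundle of oriented orthonormal frames $(\mathsf e_1,\mathsf e_2,\mathsf e_3)$, with $\langle \mathsf e_1,\mathsf e_1\rangle=1$, $\langle \mathsf e_2,\mathsf e_2\rangle=\langle \mathsf e_3,\mathsf e_3\rangle=-1$, base point $\rho$, and canonical and connection forms given by $d\rho=\mathsf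 e_i\omega^i$, $d\mathsf e_j=\mathsf e_i\omega^i_j$. The isometric embedding system $\mathcal I$ of $\boldsymbol g$ is the exterior differential system on the 8-manifold $M\times\mathcal F$ (locally on $M$, for any choice of $(\eta^1,\eta^2)$) generated differentially by the 1-forms $$\omega^3,\quad \omega^1-\eta^1,\quad \omega^2-\eta^2,\quad \omega^1_2-\eta^1_2 .$$ An exterior differential system is called Darboux integrable if about each point there are a coframe $(\theta^i,\hat\sigma^a,\check\sigma^\alpha)$, with at least two $\hat\sigma$'s and at least two $\check\sigma$'s, and non-empty families of 2-forms $\hat\Omega^b$, quadratic in the $\hat\sigma$'s, and $\check\Omega^\beta$, quadratic in the $\check\sigma$'s, such that the system is algebraically generated by $\theta^i,\hat\Omega^b,\check\Omega^\beta$, the two singular systems algebraically generated by $\{\theta^i,\hat\sigma^a,\check\Omega^\beta\}$ and by $\{\theta^i,\check\sigma^\alpha,\hat\Omega^b\}$ are Pfaffian (differentially generated by their 1-forms), and the bundles $\hat V=\{\theta^i,\hat\sigma^a\}$, $\check V=\{\theta^i,\check\sigma^\alpha\}$ form a Darboux pair: $\hat V+\check V^\infty=T^*$, $\check V+\hat V^\infty=T^*$,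 $\hat V^\infty\cap\check V^\infty=0$, and $d\omega\in\Omega^2(\hat V)+\Omega^2(\check V)$ for all sections $\omega$ of $\hat V\cap\check V$. Here $V^\infty$ is the final element of the derived flag of $V$. All forms are real in the hyperbolic case $\varepsilon=-1$; in the elliptic case $\varepsilon=1$ coframes, bundles and forms are complex-valued, on the complexified cotangent bundle. Then $\mathcal I$ is Darboux integrable if and only if, for all local orthonormal coframes of $M$, $$q_{11}=-q_{22}=3\varepsilon q^{-1/3},\qquad q_{12}=q_{21}=0 .$$ -/

import Mathlib

open scoped Manifold ContDiff

noncomputable section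

/-! ### Differential forms of degree one and two on a real normed space

Coefficients are taken in `𝕜 = ℝ` (ordinary forms) or `𝕜 = ℂ` (sections of the complexified
exterior powers of the cotangent bundle). Differentiation is always real. -/

section Forms

variable (𝕜 : Type*) [RCLike 𝕜] (E : Type*) [NormedAddCommGroup E] [NormedSpace ℝ E]

/-- `𝕜`-valued covectors on `E`. -/
abbrev Covector := E →L[ℝ] 𝕜

/-- `𝕜`-valued bilinear forms on `E`; an alternating one is a 2-covector. -/
abbrev Bicovector := E →L[ℝ] E →L[ℝ] 𝕜

end Forms

section Pfaffian

variable {𝕜 : Type*} [RCLike 𝕜] {E : Type*} [NormedAddCommGroup E] [NormedSpace ℝ E]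

/-- The wedge product `α ∧ β` of two covectors: `(α ∧ β)(v, w) = α v * β w - β v * α w`. -/
def wedge (α β : Covector 𝕜 E) : Bicovector 𝕜 E :=
  α.smulRight β - β.smulRight α

/-- The exterior derivative of a 1-form: `dφ(v, w) = D_v (φ w) - D_w (φ v)` for constant
vectors `v`, `w`. -/
def extD (φ : E → Covector 𝕜 E) (x : E) : Bicovector 𝕜 E :=
  fderiv ℝ φ x - (fderiv ℝ φ x).flip

theorem wedge_apply (α β : Covector 𝕜 E) (v w : E) :
    wedge α β v w = α v * β w - β v * α w := by
  simp [wedge]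

theorem extD_apply (φ : E → Covector 𝕜 E) (x v w : E) :
    extD φ x v w = fderiv ℝ φ x v w - fderiv ℝ φ x w v := by
  simp [extD]

/-- `extD` agrees with the exterior derivative of Mathlib on 1-forms. -/
theorem extD_eq_extDeriv (φ : E → Covector 𝕜 E) (x v w : E)
    (hφ : DifferentiableAt ℝ φ x) :
    extD φ x v w =
      extDeriv (fun y => ContinuousAlternatingMap.ofSubsingleton ℝ E 𝕜 (0 : Fin 1) (φ y)) x
        ![v, w] := by
  have h : HasFDerivAt
      (fun y => ContinuousAlternatingMap.ofSubsingleton ℝ E 𝕜 (0 : Fin 1) (φ y))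
      ((ContinuousAlternatingMap.ofSubsingletonLIE (𝕜 := ℝ) (E := E) (F := 𝕜)
        (0 : Fin 1)).toContinuousLinearEquiv.toContinuousLinearMap.comp (fderiv ℝ φ x)) x :=
    (ContinuousAlternatingMap.ofSubsingletonLIE (𝕜 := ℝ) (E := E) (F := 𝕜)
      (0 : Fin 1)).toContinuousLinearEquiv.toContinuousLinearMap.hasFDerivAt.comp x hφ.hasFDerivAt
  rw [extD_apply, extDeriv, h.fderiv]
  simp [ContinuousAlternatingMap.alternatizeUncurryFin_apply, Fin.sum_univ_two, sub_eq_add_neg]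
  rfl

/-- The degree two part, at one point, of the algebraic ideal generated by the covectors in `V`
and the 2-covectors in `S`. -/
def idealTwo (V : Submodule 𝕜 (Covector 𝕜 E)) (S : Set (Bicovector 𝕜 E)) :
    Submodule 𝕜 (Bicovector 𝕜 E) :=
  Submodule.span 𝕜 {Ω | ∃ α ∈ V, ∃ β, Ω = wedge α β} ⊔ Submodule.span 𝕜 S

/-- The second exterior power `Λ²V` of a space `V` of covectors. -/
def extSquare (V : Submodule 𝕜 (Covector 𝕜 E)) : Submodule 𝕜 (Bicovector 𝕜 E) :=
  Submodule.span 𝕜 {Ω | ∃ α ∈ V, ∃ β ∈ V, Ω = wedge α β}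

/-- The Pfaffian system (bundle of covectors) spanned by a family of 1-forms. -/
def spanForms {ι : Type*} (θ : ι → E → Covector 𝕜 E) (x : E) : Submodule 𝕜 (Covector 𝕜 E) :=
  Submodule.span 𝕜 (Set.range fun i => θ i x)

/-- `φ` is a smooth section over `U` of the Pfaffian system `V`. -/
def IsSection (V : E → Submodule 𝕜 (Covector 𝕜 E)) (U : Set E) (φ : E → Covector 𝕜 E) : Prop :=
  ContDiffOn ℝ ∞ φ U ∧ ∀ y ∈ U, φ y ∈ V y

/-- The (first) derived system of a Pfaffian system `V`: its sections are the sections `φ` of `V`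
such that `dφ ≡ 0` modulo `V`; its fibre at `x` consists of the values at `x` of those that are
defined near `x`. -/
def derivedSystem (V : E → Submodule 𝕜 (Covector 𝕜 E)) (x : E) : Submodule 𝕜 (Covector 𝕜 E) :=
  Submodule.span 𝕜 {α | ∃ U : Set E, IsOpen U ∧ x ∈ U ∧ ∃ φ : E → Covector 𝕜 E,
    IsSection V U φ ∧ (∀ y ∈ U, extD φ y ∈ idealTwo (V y) ∅) ∧ φ x = α}

/-- The derived flag `V = V⁽⁰⁾ ⊇ V⁽¹⁾ ⊇ V⁽²⁾ ⊇ ⋯`. -/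
def derivedFlag (V : E → Submodule 𝕜 (Covector 𝕜 E)) : ℕ → E → Submodule 𝕜 (Covector 𝕜 E)
  | 0 => V
  | n + 1 => derivedSystem (derivedFlag V n)

/-- The final element `V^∞` of the derived flag. -/
def derivedLimit (V : E → Submodule 𝕜 (Covector 𝕜 E)) (x : E) : Submodule 𝕜 (Covector 𝕜 E) :=
  ⨅ n, derivedFlag V n x

/-- `V₁`, `V₂` form a Darboux pair on the open set `U`. -/
structure IsDarbouxPair (U : Set E) (V₁ V₂ : E → Submodule 𝕜 (Covector 𝕜 E)) : Prop where
  sup_left : ∀ x ∈ U, V₁ x ⊔ derivedLimit V₂ x = ⊤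
  sup_right : ∀ x ∈ U, V₂ x ⊔ derivedLimit V₁ x = ⊤
  inf_limits : ∀ x ∈ U, derivedLimit V₁ x ⊓ derivedLimit V₂ x = ⊥
  d_mem : ∀ U' ⊆ U, IsOpen U' → ∀ φ, IsSection (fun x => V₁ x ⊓ V₂ x) U' φ →
    ∀ x ∈ U', extD φ x ∈ extSquare (V₁ x) ⊔ extSquare (V₂ x)

/-- The exterior differential system generated (differentially) by the 1-forms `θ` is decomposed
on the open set `U` by the smooth coframe `(τ, σ₁, σ₂)` and the smooth 2-forms `Ω₁`, `Ω₂`: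
it is algebraically generated by `τ`, `Ω₁`, `Ω₂`, where the `Ω₁` are quadratic in the `σ₁`,
and the `Ω₂` are quadratic in the `σ₂`. -/
structure IsDecomposition {ι : Type*} (U : Set E) (θ : ι → E → Covector 𝕜 E) {r p q s t : ℕ}
    (τ : Fin r → E → Covector 𝕜 E)
    (σ₁ : Fin p → E → Covector 𝕜 E) (σ₂ : Fin q → E → Covector 𝕜 E)
    (Ω₁ : Fin s → E → Bicovector 𝕜 E) (Ω₂ : Fin t → E → Bicovector 𝕜 E) : Prop where
  two_le_left : 2 ≤ p
  two_le_right : 2 ≤ q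
  one_le_left : 1 ≤ s
  one_le_right : 1 ≤ t
  smooth_τ : ∀ i, ContDiffOn ℝ ∞ (τ i) U
  smooth_σ₁ : ∀ i, ContDiffOn ℝ ∞ (σ₁ i) U
  smooth_σ₂ : ∀ i, ContDiffOn ℝ ∞ (σ₂ i) U
  smooth_Ω₁ : ∀ i, ContDiffOn ℝ ∞ (Ω₁ i) U
  smooth_Ω₂ : ∀ i, ContDiffOn ℝ ∞ (Ω₂ i) U
  /-- `(τ, σ₁, σ₂)` is a coframe. -/
  independent : ∀ x ∈ U, LinearIndependent 𝕜
    (Sum.elim (fun i => τ i x) (Sum.elim (fun i => σ₁ i x) (fun i => σ₂ i x)))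
  spanning : ∀ x ∈ U, spanForms τ x ⊔ spanForms σ₁ x ⊔ spanForms σ₂ x = ⊤
  quadratic₁ : ∀ x ∈ U, ∀ b, Ω₁ b x ∈ extSquare (spanForms σ₁ x)
  quadratic₂ : ∀ x ∈ U, ∀ b, Ω₂ b x ∈ extSquare (spanForms σ₂ x)
  /-- The two algebraic ideals agree in degree one. -/
  degree_one : ∀ x ∈ U, spanForms τ x = spanForms θ x
  /-- The two algebraic ideals agree in degree two (hence in all degrees). -/
  degree_two : ∀ x ∈ U,
    idealTwo (spanForms τ x) (Set.range (fun b => Ω₁ b x) ∪ Set.range (fun b => Ω₂ b x)) =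
      idealTwo (spanForms θ x) (Set.range fun i => extD (θ i) x)

/-- The differential system algebraically generated by the 1-forms `τ`, `σ` and the 2-forms `Ω`
is Pfaffian, that is, it is generated differentially by its 1-forms. -/
def IsPfaffian (U : Set E) {r p t : ℕ} (τ : Fin r → E → Covector 𝕜 E)
    (σ : Fin p → E → Covector 𝕜 E) (Ω : Fin t → E → Bicovector 𝕜 E) : Prop :=
  ∀ x ∈ U, idealTwo (spanForms τ x ⊔ spanForms σ x) (Set.range fun b => Ω b x) =
    idealTwo (spanForms τ x ⊔ spanForms σ x)
      (Set.range (fun i => extD (τ i) x) ∪ Set.range (fun i => extD (σ i) x))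

/-- Darboux integrability, over `𝕜`, of the exterior differential system generated on the open set
`W` by the 1-forms `θ`: it is decomposable about every point, its two singular systems are
Pfaffian, and they form a Darboux pair. -/
def IsDarbouxIntegrable {ι : Type*} (W : Set E) (θ : ι → E → Covector 𝕜 E) : Prop :=
  ∀ x ∈ W, ∃ U : Set E, IsOpen U ∧ x ∈ U ∧ U ⊆ W ∧ ∃ (r p q s t : ℕ)
    (τ : Fin r → E → Covector 𝕜 E)
    (σ₁ : Fin p → E → Covector 𝕜 E) (σ₂ : Fin q → E → Covector 𝕜 E)
    (Ω₁ : Fin s → E → Bicovector 𝕜 E) (Ω₂ : Fin t → E → Bicovector 𝕜 E),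
    IsDecomposition U θ τ σ₁ σ₂ Ω₁ Ω₂ ∧
    IsPfaffian U τ σ₁ Ω₂ ∧ IsPfaffian U τ σ₂ Ω₁ ∧
    IsDarbouxPair U (fun x => spanForms τ x ⊔ spanForms σ₁ x)
      (fun x => spanForms τ x ⊔ spanForms σ₂ x)

end Pfaffian

/-! ### Lorentzian surfaces, local orthonormal coframes, curvature, covariant derivatives -/

/-- The coordinate plane. -/
abbrev Plane := EuclideanSpace ℝ (Fin 2)

/-- A smooth Lorentzian metric, of signature `(1, 1)`, on a smooth surface. -/
structure LorentzianMetric (M : Type*) [TopologicalSpace M] [ChartedSpace Plane M]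
    [IsManifold (𝓡 2) ∞ M] where
  inner (x : M) : TangentSpace (𝓡 2) x →L[ℝ] TangentSpace (𝓡 2) x →L[ℝ] ℝ
  symm (x : M) (v w : TangentSpace (𝓡 2) x) : inner x v w = inner x w v
  exists_timelike (x : M) : ∃ v, 0 < inner x v v
  exists_spacelike (x : M) : ∃ v, inner x v v < 0
  contMDiff : ContMDiff (𝓡 2) ((𝓡 2).prod 𝓘(ℝ, Plane →L[ℝ] Plane →L[ℝ] ℝ)) ∞
    (fun x => Bundle.TotalSpace.mk' (Plane →L[ℝ] Plane →L[ℝ] ℝ) x (inner x))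

namespace LorentzianMetric

variable {M : Type*} [TopologicalSpace M] [ChartedSpace Plane M] [IsManifold (𝓡 2) ∞ M]

/-- A local orthonormal coframe of `g`, that is, a local section of the orthonormal frame bundle,
written in a local coordinate system of `M`: the metric is `(η 0)² - (η 1)²`. -/
structure LocalCoframe (g : LorentzianMetric M) where
  chart : OpenPartialHomeomorph M Plane
  chart_mem : chart ∈ IsManifold.maximalAtlas (𝓡 2) ∞ M
  η : Fin 2 → Plane → Covector ℝ Plane
  smooth : ∀ i, ContDiffOn ℝ ∞ (η i) chart.target
  independent : ∀ y ∈ chart.target, LinearIndependent ℝ (fun i => η i y)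
  orthonormal : ∀ y ∈ chart.target, ∀ v w : Plane,
    g.inner (chart.symm y) (mfderiv 𝓘(ℝ, Plane) (𝓡 2) chart.symm y v)
        (mfderiv 𝓘(ℝ, Plane) (𝓡 2) chart.symm y w) =
      η 0 y v * η 0 y w - η 1 y v * η 1 y w

namespace LocalCoframe

variable {g : LorentzianMetric M} (F : LocalCoframe g)

/-- The coefficient `c` in `Ω = c η⁰ ∧ η¹`, for a 2-covector `Ω` at `y`. -/
def areaCoeff (y : Plane) (Ω : Bicovector ℝ Plane) : ℝ :=
  Ω (EuclideanSpace.single 0 1) (EuclideanSpace.single 1 1) /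
    wedge (F.η 0 y) (F.η 1 y) (EuclideanSpace.single 0 1) (EuclideanSpace.single 1 1)

/-- The coefficients in `α = α₀ η⁰ + α₁ η¹`, for a covector `α` at `y`. -/
def coeff (y : Plane) (α : Covector ℝ Plane) : Fin 2 → ℝ :=
  ![F.areaCoeff y (wedge α (F.η 1 y)), F.areaCoeff y (wedge (F.η 0 y) α)]

/-- The connection form `η⁰₁ = η¹₀`, determined by `dη⁰ = -η⁰₁ ∧ η¹` and `dη¹ = -η¹₀ ∧ η⁰`. -/
def connection (y : Plane) : Covector ℝ Plane :=
  -F.areaCoeff y (extD (F.η 0) y) • F.η 0 y + F.areaCoeff y (extD (F.η 1) y) • F.η 1 y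

/-- The matrix `ηⁱⱼ` of connection forms. -/
def connectionMatrix (i j : Fin 2) (y : Plane) : Covector ℝ Plane :=
  if i = j then 0 else F.connection y

/-- The Gauss curvature, determined by `dη⁰₁ = -K η⁰ ∧ η¹`. -/
def gaussCurvature (y : Plane) : ℝ :=
  -F.areaCoeff y (extD F.connection y)

/-- The covariant derivatives `fᵢ` of a function, `df = fᵢ ηⁱ`. -/
def covDeriv (f : Plane → ℝ) (i : Fin 2) (y : Plane) : ℝ :=
  F.coeff y (fderiv ℝ f y) i

/-- The second covariant derivatives `fᵢⱼ` of a function, `dfᵢ = fⱼ ηʲᵢ + fᵢⱼ ηʲ`. -/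
def covDeriv₂ (f : Plane → ℝ) (i j : Fin 2) (y : Plane) : ℝ :=
  F.coeff y (fderiv ℝ (F.covDeriv f i) y -
    ∑ l, F.covDeriv f l y • F.connectionMatrix l i y) j

/-- The function `q = |K|^(-3/4)`. -/
def q (y : Plane) : ℝ :=
  |F.gaussCurvature y| ^ (-(3 / 4) : ℝ)

theorem area_ne_zero {y : Plane} (hy : y ∈ F.chart.target) :
    wedge (F.η 0 y) (F.η 1 y) (EuclideanSpace.single 0 1) (EuclideanSpace.single 1 1) ≠ 0 := by
  intro h
  rw [wedge_apply] at h
  have hli := Fintype.linearIndependent_iff.1 (F.independent y hy)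
  have key : ∀ v : Plane, v = v 0 • EuclideanSpace.single (0 : Fin 2) (1 : ℝ) +
      v 1 • EuclideanSpace.single (1 : Fin 2) (1 : ℝ) := by
    intro v; ext i; fin_cases i <;> simp
  have hz : ∀ a b : ℝ, a * F.η 0 y (EuclideanSpace.single 0 1) +
      b * F.η 1 y (EuclideanSpace.single 0 1) = 0 → a * F.η 0 y (EuclideanSpace.single 1 1) +
      b * F.η 1 y (EuclideanSpace.single 1 1) = 0 → a = 0 ∧ b = 0 := by
    intro a b h0 h1
    have := hli ![a, b] (by
      ext v
      rw [key v]
      simp [Fin.sum_univ_two]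
      linear_combination v 0 * h0 + v 1 * h1)
    exact ⟨by simpa using this 0, by simpa using this 1⟩
  have h1 := hz (F.η 1 y (EuclideanSpace.single 0 1)) (-F.η 0 y (EuclideanSpace.single 0 1))
    (by ring) (by linear_combination -h)
  have h2 := hz (F.η 1 y (EuclideanSpace.single 1 1)) (-F.η 0 y (EuclideanSpace.single 1 1))
    (by linear_combination h) (by ring)
  have h3 := hz 1 0 (by linarith [h1.2]) (by linarith [h2.2])
  exact one_ne_zero h3.1

theorem eq_areaCoeff {y : Plane} (hy : y ∈ F.chart.target) (Ω : Bicovector ℝ Plane)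
    (hΩ : ∀ v, Ω v v = 0) : Ω = F.areaCoeff y Ω • wedge (F.η 0 y) (F.η 1 y) := by
  have key : ∀ v : Plane, v = v 0 • EuclideanSpace.single (0 : Fin 2) (1 : ℝ) +
      v 1 • EuclideanSpace.single (1 : Fin 2) (1 : ℝ) := by
    intro v; ext i; fin_cases i <;> simp
  have main : ∀ B : Bicovector ℝ Plane, (∀ v, B v v = 0) → ∀ v w, B v w =
      (v 0 * w 1 - v 1 * w 0) *
        B (EuclideanSpace.single 0 1) (EuclideanSpace.single 1 1) := by
    intro B hB v w
    have hs : B (EuclideanSpace.single 1 1) (EuclideanSpace.single 0 1) =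
        -B (EuclideanSpace.single 0 1) (EuclideanSpace.single 1 1) := by
      have := hB (EuclideanSpace.single 0 1 + EuclideanSpace.single 1 1)
      simp [hB] at this
      linarith
    conv_lhs => rw [key v, key w]
    simp [hB, hs]
    ring
  ext v w
  have hne := F.area_ne_zero hy
  have e1 := main Ω hΩ v w
  have e2 := main (wedge (F.η 0 y) (F.η 1 y)) (fun v => by rw [wedge_apply]; ring) v w
  rw [smul_apply, smul_apply, e1, e2, areaCoeff]
  simp only [smul_eq_mul]
  field_simp

/-- The structure equations of the orthonormal frame bundle. -/
theorem structure_equations {y : Plane} (hy : y ∈ F.chart.target) :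
    extD (F.η 0) y = -wedge (F.connection y) (F.η 1 y) ∧
    extD (F.η 1) y = -wedge (F.connection y) (F.η 0 y) ∧
    extD F.connection y = -F.gaussCurvature y • wedge (F.η 0 y) (F.η 1 y) := by
  have alt : ∀ φ : Plane → Covector ℝ Plane, ∀ v, extD φ y v v = 0 := by
    intro φ v; rw [extD_apply]; ring
  refine ⟨?_, ?_, ?_⟩
  · rw [F.eq_areaCoeff hy _ (alt (F.η 0))]
    ext v w
    simp [wedge_apply, connection]
    ring
  · rw [F.eq_areaCoeff hy _ (alt (F.η 1))]
    ext v w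
    simp [wedge_apply, connection]
    ring
  · rw [gaussCurvature, neg_neg]
    exact F.eq_areaCoeff hy _ (alt _)

/-- Expansion of a covector in the coframe. -/
theorem eq_sum_coeff {y : Plane} (hy : y ∈ F.chart.target) (α : Covector ℝ Plane) :
    α = ∑ i, F.coeff y α i • F.η i y := by
  have hne := F.area_ne_zero hy
  rw [wedge_apply] at hne
  have key : ∀ v : Plane, v = v 0 • EuclideanSpace.single (0 : Fin 2) (1 : ℝ) +
      v 1 • EuclideanSpace.single (1 : Fin 2) (1 : ℝ) := by
    intro v; ext i; fin_cases i <;> simp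
  ext v
  rw [key v]
  simp only [coeff, areaCoeff, wedge_apply, Fin.sum_univ_two, Matrix.cons_val_zero,
    Matrix.cons_val_one, add_apply, smul_apply, map_add, map_smul, smul_eq_mul]
  generalize F.η 0 y (EuclideanSpace.single 0 1) = a at *
  generalize F.η 0 y (EuclideanSpace.single 1 1) = b at *
  generalize F.η 1 y (EuclideanSpace.single 0 1) = c at *
  generalize F.η 1 y (EuclideanSpace.single 1 1) = d at *
  have hne' : a * d - c * b ≠ 0 := hne
  rw [div_mul_eq_mul_div, div_mul_eq_mul_div, div_mul_eq_mul_div, div_mul_eq_mul_div,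
    ← add_div, ← add_div, mul_div_assoc', mul_div_assoc', ← add_div, eq_div_iff hne']
  ring

end LocalCoframe

end LorentzianMetric

/-! ### Frames of Minkowski space and the isometric embedding system -/

/-- The signature of Minkowski space `ℝ^{1,2}`. -/
def minkowskiSign : Fin 3 → ℝ := ![1, -1, -1]

/-- The inner product `u₀ v₀ - u₁ v₁ - u₂ v₂` of Minkowski space `ℝ^{1,2}`. -/
def minkowskiForm : (Fin 3 → ℝ) →L[ℝ] (Fin 3 → ℝ) →L[ℝ] ℝ :=
  ∑ i, minkowskiSign i • (ContinuousLinearMap.proj (R := ℝ) (φ := fun _ : Fin 3 => ℝ) i).smulRight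
    (ContinuousLinearMap.proj (R := ℝ) (φ := fun _ : Fin 3 => ℝ) i)

theorem minkowskiForm_apply (u v : Fin 3 → ℝ) :
    minkowskiForm u v = u 0 * v 0 - u 1 * v 1 - u 2 * v 2 := by
  simp [minkowskiForm, minkowskiSign, Fin.sum_univ_three]
  ring

/-- The parameter space for six-dimensional coordinate systems. -/
abbrev Six := EuclideanSpace ℝ (Fin 6)

/-- A local coordinate system of the (six-dimensional) bundle of orthonormal frames, with structure
group `SO(1,2)`, of Minkowski space, given by its inverse: a smooth immersion
`p ↦ (base p; frame 0 p, frame 1 p, frame 2 p)` of an open subset of `ℝ⁶` into the bundle. -/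
structure MinkowskiFrames where
  domain : Set Six
  isOpen_domain : IsOpen domain
  base : Six → Fin 3 → ℝ
  frame : Fin 3 → Six → Fin 3 → ℝ
  smooth_base : ContDiffOn ℝ ∞ base domain
  smooth_frame : ∀ i, ContDiffOn ℝ ∞ (frame i) domain
  orthonormal : ∀ p ∈ domain, ∀ i j,
    minkowskiForm (frame i p) (frame j p) = if i = j then minkowskiSign i else 0
  det_eq_one : ∀ p ∈ domain, (Matrix.of fun i j => frame j p i).det = 1
  immersion : ∀ p ∈ domain, Function.Injective fun v : Six =>
    (fderiv ℝ base p v, fun i => fderiv ℝ (frame i) p v)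

namespace MinkowskiFrames

variable (G : MinkowskiFrames)

/-- The canonical forms `ωⁱ`, determined by `dρ = eᵢ ωⁱ` for the base point `ρ`. -/
def canonical (i : Fin 3) (p : Six) : Covector ℝ Six :=
  minkowskiSign i • (minkowskiForm (G.frame i p)).comp (fderiv ℝ G.base p)

/-- The connection forms `ωⁱⱼ`, determined by `deⱼ = eᵢ ωⁱⱼ`. -/
def connection (i j : Fin 3) (p : Six) : Covector ℝ Six :=
  minkowskiSign i • (minkowskiForm (G.frame i p)).comp (fderiv ℝ (G.frame j) p)

end MinkowskiFrames

namespace LorentzianMetric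

variable {M : Type*} [TopologicalSpace M] [ChartedSpace Plane M] [IsManifold (𝓡 2) ∞ M]

/-- The four generators of the isometric embedding system in the coordinates `F`, `G`, as
real 1-forms: `ω²`, `ω⁰ - η⁰`, `ω¹ - η¹`, `ω⁰₁ - η⁰₁` (indices start at `0`). -/
def embeddingForms {g : LorentzianMetric M} (F : LocalCoframe g) (G : MinkowskiFrames) :
    Fin 4 → Plane × Six → Covector ℝ (Plane × Six) :=
  let fromM (α : Plane → Covector ℝ Plane) (z : Plane × Six) : Covector ℝ (Plane × Six) :=
    (α z.1).comp (ContinuousLinearMap.fst ℝ Plane Six)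
  let fromN (β : Six → Covector ℝ Six) (z : Plane × Six) : Covector ℝ (Plane × Six) :=
    (β z.2).comp (ContinuousLinearMap.snd ℝ Plane Six)
  ![fromN (G.canonical 2),
    fromN (G.canonical 0) - fromM (F.η 0),
    fromN (G.canonical 1) - fromM (F.η 1),
    fromN (G.connection 0 1) - fromM F.connection]

/-- The isometric embedding system of `g` into Minkowski space `ℝ^{1,2}`, an exterior differential
system on the product of `M` and the orthonormal frame bundle of `ℝ^{1,2}`, is Darboux integrable
over `𝕜`. Darboux integrability is a local property of the product, so it is expressed in all local
coordinates, and for all local orthonormal coframes on `M`. The real notion is the one for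
hyperbolic systems; elliptic systems have complex singular systems, and need `𝕜 = ℂ`. -/
def EmbeddingDarbouxIntegrable (𝕜 : Type*) [RCLike 𝕜] (g : LorentzianMetric M) : Prop :=
  ∀ (F : LocalCoframe g) (G : MinkowskiFrames),
    IsDarbouxIntegrable (F.chart.target ×ˢ G.domain)
      (fun i z => (RCLike.ofRealCLM : ℝ →L[ℝ] 𝕜).comp (embeddingForms F G i z))

end LorentzianMetric

end

noncomputable section

/-! ### Pointwise ideals, exterior derivatives and derived systems in a moving frame. -/

section Frames

variable {𝕜 : Type*} [RCLike 𝕜] {E : Type*} [NormedAddCommGroup E] [NormedSpace ℝ E]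
variable {ι : Type*} [Fintype ι]

/-! Put `u = ½ log |K|` and write `K = -k²`, with `k = exp u` if `K < 0` and `k = i exp u` if `K >
0`; this is why the elliptic case needs complex forms, and it allows both cases to be treated at
once over `𝕜`. Use a null coframe `χ 0, …, χ 7` on the product: `χ 0, …, χ 3` span the generators
`θ`, `χ 4`, `χ 5` are `ω²₀ ± ω²₁`, and `χ 6`, `χ 7` are `η⁰ ± η¹` (indices from `0`). Modulo `θ`
only `dχ 0` (the symmetry of the second fundamental form) and `dχ 3` (the Gauss equation) survive,
and `2 dχ 3 ∓ 2k dχ 0 ≡ (χ 4 ∓ k χ 7) ∧ (χ 5 ± k χ 6)`. A decomposition of the system therefore has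
to use these two decomposable forms (`mem_singularSystem_or`), and its singular systems are `V_k =
{θ, χ 4 - k χ 7, χ 5 + k χ 6}` and `V_{-k}`, which are interchanged by the symmetry
`IsSingularCoframe.neg`.

Necessity. `V_k` has rank 6 and is annihilated by `X = e 6 - k e 5` and `Y = e 7 + k e 4`. The
bracket of `X` and `Y` yields a third field `T`, and those of `X`, `Y` with `T` yield `P` and `Q`
(`singularField`), so the second derived system is annihilated by five independent fields. A Darboux
pair requires `V_{-k} + V_k^∞ = T*`, so that at least rank two must survive in `V_k^∞`, and the
further brackets can contribute at most one new direction. The brackets of `X, Y, T` with `P, Q`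
give linear conditions on the components along `e 3`, `e 4`, `e 5` (`derivedFlag_three`). Although
they contain unknown derivatives of the curvature quantities, these can be eliminated, and
`eq_of_rank_conditions` leaves three equations for the second derivatives of `u`.

Sufficiency. When these equations hold, the combinations `k (χ 4 - k χ 7) + p χ 3` and `k (χ 5 + k χ
6) + m χ 3`, where `du = p χ 6 + m χ 7`, form a completely integrable system inside `V_k`
(`extD_integrableForms`). By Frobenius it remains in every derived system, and together with
`V_{-k}` it spans. The remaining conditions of Darboux integrability follow directly from the
structure equations.

Translation. The three equations say that `u_ij - (3/2) u_i u_j` has vanishing pure null components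
and mixed null component `k²`. The function `q = exp (-(3/2) u)` linearizes the left side, since
`q_ij = -(3/2) q (u_ij - (3/2) u_i u_j)`, while `q exp (2u) = q^(-1/3)`; this gives the equations in
the statement (`q_equations_iff`, `logDefect_iff`). -/

theorem wedge_add_right (α β γ : Covector 𝕜 E) : wedge α (β + γ) = wedge α β + wedge α γ := by
  ext v w; simp [wedge_apply]; ring

/-- The pairing of a covector with the `𝕜`-tangent vector `∑ i, Z i • e i`. -/
def framePair (e : ι → E) (Z : ι → 𝕜) : Covector 𝕜 E →ₗ[𝕜] 𝕜 where
  toFun φ := ∑ i, Z i * φ (e i)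
  map_add' φ ψ := by simp [mul_add, Finset.sum_add_distrib]
  map_smul' c φ := by
    simp only [smul_apply, smul_eq_mul, RingHom.id_apply, Finset.mul_sum]
    exact Finset.sum_congr rfl fun i _ => by ring

/-- The interior product of a bilinear form with the `𝕜`-tangent vector `∑ i, Z i • e i`. -/
def frameInterior (e : ι → E) (Z : ι → 𝕜) : Bicovector 𝕜 E →ₗ[𝕜] Covector 𝕜 E where
  toFun B := ∑ i, Z i • B (e i)
  map_add' φ ψ := by simp [smul_add, Finset.sum_add_distrib]
  map_smul' c φ := by
    simp only [smul_apply, RingHom.id_apply, Finset.smul_sum]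
    exact Finset.sum_congr rfl fun i _ => smul_comm _ _ _

theorem framePair_apply (e : ι → E) (Z : ι → 𝕜) (φ : Covector 𝕜 E) :
    framePair e Z φ = ∑ i, Z i * φ (e i) := rfl

theorem frameInterior_wedge (e : ι → E) (Z : ι → 𝕜) (α β : Covector 𝕜 E) :
    frameInterior e Z (wedge α β) = framePair e Z α • β - framePair e Z β • α := by
  ext v
  simp only [frameInterior, framePair, LinearMap.coe_mk, AddHom.coe_mk, sum_apply,
    smul_apply, wedge_apply, sub_apply, smul_eq_mul, Finset.sum_mul, ← Finset.sum_sub_distrib]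
  exact Finset.sum_congr rfl fun i _ => by ring

theorem framePair_frameInterior_wedge (e : ι → E) (Z W : ι → 𝕜) (α β : Covector 𝕜 E) :
    framePair e W (frameInterior e Z (wedge α β)) =
      framePair e Z α * framePair e W β - framePair e Z β * framePair e W α := by
  rw [frameInterior_wedge, map_sub, map_smul, map_smul, smul_eq_mul, smul_eq_mul]

theorem wedge_mem_idealTwo {V : Submodule 𝕜 (Covector 𝕜 E)} {S : Set (Bicovector 𝕜 E)}
    {α : Covector 𝕜 E} (hα : α ∈ V) (β : Covector 𝕜 E) : wedge α β ∈ idealTwo V S :=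
  Submodule.mem_sup_left (Submodule.subset_span ⟨α, hα, β, rfl⟩)

theorem wedge_mem_idealTwo' {V : Submodule 𝕜 (Covector 𝕜 E)} {S : Set (Bicovector 𝕜 E)}
    {α : Covector 𝕜 E} (hα : α ∈ V) (β : Covector 𝕜 E) : wedge β α ∈ idealTwo V S := by
  have h := (idealTwo V S).smul_mem (-1 : 𝕜) (wedge_mem_idealTwo hα β)
  have h' : (-1 : 𝕜) • wedge α β = wedge β α := by
    ext v w; simp [wedge_apply]
  rwa [h'] at h

theorem mem_idealTwo_of_mem {V : Submodule 𝕜 (Covector 𝕜 E)} {S : Set (Bicovector 𝕜 E)}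
    {Ω : Bicovector 𝕜 E} (h : Ω ∈ S) : Ω ∈ idealTwo V S :=
  Submodule.mem_sup_right (Submodule.subset_span h)

theorem idealTwo_le {V : Submodule 𝕜 (Covector 𝕜 E)} {S : Set (Bicovector 𝕜 E)}
    {I : Submodule 𝕜 (Bicovector 𝕜 E)} (h₁ : ∀ α ∈ V, ∀ β, wedge α β ∈ I)
    (h₂ : ∀ Ω ∈ S, Ω ∈ I) : idealTwo V S ≤ I :=
  sup_le (Submodule.span_le.2 (by rintro _ ⟨α, hα, β, rfl⟩; exact h₁ α hα β))
    (Submodule.span_le.2 h₂)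

theorem idealTwo_mono {V W : Submodule 𝕜 (Covector 𝕜 E)} {S T : Set (Bicovector 𝕜 E)}
    (h : V ≤ W) (h' : S ⊆ T) : idealTwo V S ≤ idealTwo W T :=
  idealTwo_le (fun _ hα β => wedge_mem_idealTwo (h hα) β) fun _ hΩ => mem_idealTwo_of_mem (h' hΩ)

/-- A bilinear form in the ideal of `V` vanishes on pairs of vectors annihilated by `V`. -/
theorem framePair_frameInterior_eq_zero {V : Submodule 𝕜 (Covector 𝕜 E)} (e : ι → E)
    {Z W : ι → 𝕜} (hZ : ∀ α ∈ V, framePair e Z α = 0) (hW : ∀ α ∈ V, framePair e W α = 0)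
    {Ω : Bicovector 𝕜 E} (hΩ : Ω ∈ idealTwo V ∅) :
    framePair e W (frameInterior e Z Ω) = 0 := by
  have : idealTwo V ∅ ≤ LinearMap.ker ((framePair e W).comp (frameInterior e Z)) :=
    idealTwo_le (fun α hα β => by
      simp [framePair_frameInterior_wedge, hZ α hα, hW α hα]) (by simp)
  simpa using this hΩ

theorem extD_congr {φ ψ : E → Covector 𝕜 E} {x : E} (h : φ =ᶠ[nhds x] ψ) :
    extD φ x = extD ψ x := by
  rw [extD, extD, h.fderiv_eq]

theorem extD_add {φ ψ : E → Covector 𝕜 E} {x : E} (hφ : DifferentiableAt ℝ φ x)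
    (hψ : DifferentiableAt ℝ ψ x) : extD (fun y => φ y + ψ y) x = extD φ x + extD ψ x := by
  ext v w
  simp only [extD_apply, fderiv_fun_add hφ hψ, add_apply]
  ring

theorem extD_smul {f : E → 𝕜} {df : Covector 𝕜 E} {φ : E → Covector 𝕜 E} {x : E}
    (hf : HasFDerivAt f df x) (hφ : DifferentiableAt ℝ φ x) :
    extD (fun y => f y • φ y) x = wedge df (φ x) + f x • extD φ x := by
  have h := (hf.smul hφ.hasFDerivAt).fderiv
  ext v w
  have h' : fderiv ℝ (fun y => f y • φ y) x = f x • fderiv ℝ φ x + df.smulRight (φ x) := h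
  simp only [extD_apply, h', add_apply, smul_apply, wedge_apply,
    ContinuousLinearMap.smulRight_apply, smul_eq_mul]
  ring

theorem extD_sum {κ : Type*} (s : Finset κ) {φ : κ → E → Covector 𝕜 E} {x : E}
    (hφ : ∀ i ∈ s, DifferentiableAt ℝ (φ i) x) :
    extD (fun y => ∑ i ∈ s, φ i y) x = ∑ i ∈ s, extD (φ i) x := by
  ext v w
  simp only [extD_apply, fderiv_fun_sum hφ, sum_apply, Finset.sum_sub_distrib]

/-- The exterior derivative of `∑ i, f i • χ i`. -/
theorem extD_sum_smul {f : ι → E → 𝕜} {df : ι → Covector 𝕜 E} {χ : ι → E → Covector 𝕜 E}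
    {φ : E → Covector 𝕜 E} {x : E} (hf : ∀ i, HasFDerivAt (f i) (df i) x)
    (hχ : ∀ i, DifferentiableAt ℝ (χ i) x) (hφ : φ =ᶠ[nhds x] fun y => ∑ i, f i y • χ i y) :
    extD φ x = ∑ i, (wedge (df i) (χ i x) + f i x • extD (χ i) x) := by
  rw [extD_congr hφ, extD_sum]
  · exact Finset.sum_congr rfl fun i _ => extD_smul (hf i) (hχ i)
  · exact fun i _ => (hf i).differentiableAt.smul (hχ i)

/-! ### Derived flags, brackets of annihilating vector fields, and integrable subsystems. -/

theorem derivedSystem_le (V : E → Submodule 𝕜 (Covector 𝕜 E)) (x : E) :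
    derivedSystem V x ≤ V x :=
  Submodule.span_le.2 (by
    rintro _ ⟨U, -, hx, φ, hφ, -, rfl⟩
    exact hφ.2 x hx)

theorem derivedFlag_succ_le (V : E → Submodule 𝕜 (Covector 𝕜 E)) (n : ℕ) (x : E) :
    derivedFlag V (n + 1) x ≤ derivedFlag V n x :=
  derivedSystem_le _ x

theorem derivedLimit_le (V : E → Submodule 𝕜 (Covector 𝕜 E)) (n : ℕ) (x : E) :
    derivedLimit V x ≤ derivedFlag V n x :=
  iInf_le _ n

/-- A smooth moving frame on `O`, with dual coframe `χ`. -/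
structure IsMovingFrame (O : Set E) (e : ι → E → E) (χ : ι → E → Covector 𝕜 E) : Prop where
  isOpen : IsOpen O
  smooth_frame : ∀ i, ContDiffOn ℝ ∞ (e i) O
  smooth_coframe : ∀ i, ContDiffOn ℝ ∞ (χ i) O
  apply_self : ∀ y ∈ O, ∀ i, χ i y (e i y) = 1
  apply_ne : ∀ y ∈ O, ∀ i j, i ≠ j → χ i y (e j y) = 0
  expand : ∀ y ∈ O, ∀ φ : Covector 𝕜 E, φ = ∑ i, φ (e i y) • χ i y

namespace IsMovingFrame

variable {O : Set E} {e : ι → E → E} {χ : ι → E → Covector 𝕜 E}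

theorem differentiableAt_coframe (h : IsMovingFrame O e χ) {y : E} (hy : y ∈ O) (i : ι) :
    DifferentiableAt ℝ (χ i) y :=
  ((h.smooth_coframe i).contDiffAt (h.isOpen.mem_nhds hy)).differentiableAt (by simp)

theorem differentiableAt_component (h : IsMovingFrame O e χ) {y : E} (hy : y ∈ O)
    {φ : E → Covector 𝕜 E} (hφ : DifferentiableAt ℝ φ y) (i : ι) :
    DifferentiableAt ℝ (fun z => φ z (e i z)) y :=
  hφ.clm_apply (((h.smooth_frame i).contDiffAt (h.isOpen.mem_nhds hy)).differentiableAt (by simp))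

theorem pair_coframe (h : IsMovingFrame O e χ) {y : E} (hy : y ∈ O) (Z : ι → 𝕜) (i : ι) :
    framePair (fun j => e j y) Z (χ i y) = Z i := by
  classical
  rw [framePair_apply, Finset.sum_eq_single i]
  · rw [h.apply_self y hy, mul_one]
  · intro j _ hj
    rw [h.apply_ne y hy i j (Ne.symm hj), mul_zero]
  · simp

theorem extD_section (h : IsMovingFrame O e χ) {y : E} (hy : y ∈ O) {φ : E → Covector 𝕜 E}
    (hφ : DifferentiableAt ℝ φ y) :
    extD φ y = ∑ i, (wedge (fderiv ℝ (fun z => φ z (e i z)) y) (χ i y) +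
      φ y (e i y) • extD (χ i) y) :=
  extD_sum_smul (fun i => (h.differentiableAt_component hy hφ i).hasFDerivAt)
    (h.differentiableAt_coframe hy)
    (Filter.eventually_of_mem (h.isOpen.mem_nhds hy) fun z hz => h.expand z hz (φ z))

/-- If the vector fields `Z`, `W` are annihilated by `V` then their bracket is annihilated by the
derived system of `V`. -/
theorem derivedSystem_bracket (h : IsMovingFrame O e χ) {V : E → Submodule 𝕜 (Covector 𝕜 E)}
    {U : Set E} (hU : IsOpen U) (hUO : U ⊆ O) {Z W : E → ι → 𝕜} {y : E} (hy : y ∈ U)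
    (hZ : ∀ z ∈ U, ∀ α ∈ V z, framePair (fun j => e j z) (Z z) α = 0)
    (hW : ∀ z ∈ U, ∀ α ∈ V z, framePair (fun j => e j z) (W z) α = 0)
    {dZ dW : ι → Covector 𝕜 E} (hdZ : ∀ i, HasFDerivAt (fun z => Z z i) (dZ i) y)
    (hdW : ∀ i, HasFDerivAt (fun z => W z i) (dW i) y)
    {α : Covector 𝕜 E} (hα : α ∈ derivedSystem V y) :
    framePair (fun j => e j y) (fun i =>
      framePair (fun j => e j y) (W y) (frameInterior (fun j => e j y) (Z y) (extD (χ i) y)) +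
      framePair (fun j => e j y) (W y) (dZ i) - framePair (fun j => e j y) (Z y) (dW i)) α = 0 := by
  rw [← LinearMap.mem_ker]
  refine (Submodule.span_le (p := LinearMap.ker _)).2 ?_ hα
  rintro _ ⟨U', hU', hyU', φ, ⟨hφs, hφV⟩, hdφ, rfl⟩
  rw [SetLike.mem_coe, LinearMap.mem_ker]
  have hyO := hUO hy
  have hφd : DifferentiableAt ℝ φ y :=
    (hφs.contDiffAt (hU'.mem_nhds hyU')).differentiableAt (by simp)
  have hzero := framePair_frameInterior_eq_zero (fun j => e j y) (hZ y hy) (hW y hy) (hdφ y hyU')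
  -- The identity `φ(Y) = 0` holds on a neighbourhood, so it may be differentiated; this is used for
  -- `Y = Z` and `Y = W`. The derivative is real, and pairing with a field that has coefficients in
  -- `𝕜` is its linear extension over the frame.
  have hc : ∀ Y : E → ι → 𝕜, (∀ z ∈ U, ∀ α ∈ V z, framePair (fun j => e j z) (Y z) α = 0) →
      ∀ dY : ι → Covector 𝕜 E, (∀ i, HasFDerivAt (fun z => Y z i) (dY i) y) →
      ∀ v, ∑ i, (Y y i * fderiv ℝ (fun z => φ z (e i z)) y v + φ y (e i y) * dY i v) = 0 := by
    intro Y hY dY hdY v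
    have h1 : HasFDerivAt (fun z => ∑ i, Y z i * φ z (e i z))
        (∑ i, (Y y i • fderiv ℝ (fun z => φ z (e i z)) y + φ y (e i y) • dY i)) y :=
      HasFDerivAt.fun_sum fun i _ =>
        (hdY i).mul (h.differentiableAt_component hyO hφd i).hasFDerivAt
    have h2 : (fun z => ∑ i, Y z i * φ z (e i z)) =ᶠ[nhds y] fun _ => 0 :=
      Filter.eventually_of_mem ((hU.inter hU').mem_nhds ⟨hy, hyU'⟩) fun z hz =>
        hY z hz.1 _ (hφV z hz.2)
    have h3 := (h1.congr_of_eventuallyEq h2.symm).unique (hasFDerivAt_const (0 : 𝕜) y)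
    have h4 := congrArg (fun T : Covector 𝕜 E => T v) h3
    simpa using h4
  have hcp : ∀ Y : E → ι → 𝕜, (∀ z ∈ U, ∀ α ∈ V z, framePair (fun j => e j z) (Y z) α = 0) →
      ∀ dY : ι → Covector 𝕜 E, (∀ i, HasFDerivAt (fun z => Y z i) (dY i) y) → ∀ X : ι → 𝕜,
      ∑ i, (Y y i * framePair (fun j => e j y) X (fderiv ℝ (fun z => φ z (e i z)) y) +
        φ y (e i y) * framePair (fun j => e j y) X (dY i)) = 0 := by
    intro Y hY dY hdY X
    simp only [framePair_apply, Finset.mul_sum, ← Finset.sum_add_distrib]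
    rw [Finset.sum_comm]
    refine Finset.sum_eq_zero fun j _ => ?_
    have := hc Y hY dY hdY (e j y)
    rw [← mul_zero (X j), ← this, Finset.mul_sum]
    exact Finset.sum_congr rfl fun i _ => by ring
  have hz := hcp Z hZ dZ hdZ (W y)
  have hw := hcp W hW dW hdW (Z y)
  rw [h.extD_section hyO hφd] at hzero
  simp only [map_sum, map_add, map_smul, framePair_frameInterior_wedge, h.pair_coframe hyO,
    smul_eq_mul] at hzero
  rw [framePair_apply]
  have key : ∀ f₁ f₂ f₃ f₄ : ι → 𝕜, ∑ i, f₁ i = 0 → ∑ i, f₂ i = 0 → ∑ i, f₃ i = 0 →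
      (∀ i, f₄ i = f₁ i + f₂ i - f₃ i) → ∑ i, f₄ i = 0 := by
    intro f₁ f₂ f₃ f₄ h₁ h₂ h₃ h₄
    simp [h₄, Finset.sum_add_distrib, Finset.sum_sub_distrib, h₁, h₂, h₃]
  -- Cartan's formula: `dφ(Z, W) = 0`, plus `W` applied to `φ(Z) = 0`, minus `Z` applied to `φ(W) =
  -- 0`. The derivatives of the components of `φ` cancel, and what remains is `-φ([Z, W])`.
  exact key _ _ _ _ hzero hz hw fun i => by ring

end IsMovingFrame

/-- A completely integrable subsystem of `V` lies in the derived flag of `V`. -/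
theorem mem_derivedFlag_of_integrable {κ : Type*} {V : E → Submodule 𝕜 (Covector 𝕜 E)}
    {O : Set E} (hO : IsOpen O) {ν : κ → E → Covector 𝕜 E} (hν : ∀ i, ContDiffOn ℝ ∞ (ν i) O)
    (hV : ∀ y ∈ O, ∀ i, ν i y ∈ V y)
    (hd : ∀ y ∈ O, ∀ i, extD (ν i) y ∈ idealTwo (spanForms ν y) ∅) (n : ℕ) :
    ∀ y ∈ O, ∀ i, ν i y ∈ derivedFlag V n y := by
  induction n with
  | zero => exact hV
  | succ n ih =>
    intro y hy i
    refine Submodule.subset_span ⟨O, hO, hy, ν i, ⟨hν i, fun z hz => ih z hz i⟩,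
      fun z hz => ?_, rfl⟩
    -- The derivatives of the `ν i` vanish modulo the `ν j`, which by induction belong to the `n`-th
    -- derived system.
    refine idealTwo_mono ?_ subset_rfl (hd z hz i)
    exact Submodule.span_le.2 (by rintro _ ⟨j, rfl⟩; exact ih z hz j)

theorem mem_derivedLimit_of_integrable {κ : Type*} {V : E → Submodule 𝕜 (Covector 𝕜 E)}
    {O : Set E} (hO : IsOpen O) {ν : κ → E → Covector 𝕜 E} (hν : ∀ i, ContDiffOn ℝ ∞ (ν i) O)
    (hV : ∀ y ∈ O, ∀ i, ν i y ∈ V y)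
    (hd : ∀ y ∈ O, ∀ i, extD (ν i) y ∈ idealTwo (spanForms ν y) ∅) {y : E} (hy : y ∈ O) (i : κ) :
    ν i y ∈ derivedLimit V y :=
  (Submodule.mem_iInf _).2 fun n => mem_derivedFlag_of_integrable hO hν hV hd n y hy i

end Frames

/-! ### The structure equations of the null coframe and the first three derived systems of a
singular system. -/

section SingularCoframe

variable {𝕜 : Type*} [RCLike 𝕜] {E : Type*} [NormedAddCommGroup E] [NormedSpace ℝ E]

/-- A moving coframe `χ` satisfying the structure equations of the isometric embedding system in
null coordinates. The system is spanned by `χ 0, …, χ 3`, the forms `χ 6`, `χ 7` are a null coframe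
of the surface with connection form `α₁ χ 6 + α₂ χ 7`, and `χ 4`, `χ 5` are the components of the
second fundamental form. The Gauss curvature is `-k²`, the derivatives of `log k` are `p`, `m`, and
`a`, `b`, `c` measure the second derivatives of `log k`. -/
structure IsSingularCoframe (O : Set E) (e : Fin 8 → E → E) (χ : Fin 8 → E → Covector 𝕜 E)
    (k p m a b c α₁ α₂ : E → 𝕜) : Prop extends IsMovingFrame O e χ where
  d_zero : ∀ y ∈ O, extD (χ 0) y = (-(1 / 2) : 𝕜) •
    (wedge (χ 4 y) (χ 6 y + χ 1 y) + wedge (χ 5 y) (χ 7 y + χ 2 y))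
  d_one : ∀ y ∈ O, extD (χ 1) y = (-1 : 𝕜) • (wedge (χ 3 y) (χ 6 y) +
    wedge (α₁ y • χ 6 y + α₂ y • χ 7 y) (χ 1 y) + wedge (χ 3 y) (χ 1 y) + wedge (χ 5 y) (χ 0 y))
  d_two : ∀ y ∈ O, extD (χ 2) y = wedge (χ 3 y) (χ 7 y) +
    wedge (α₁ y • χ 6 y + α₂ y • χ 7 y) (χ 2 y) + wedge (χ 3 y) (χ 2 y) + wedge (χ 0 y) (χ 4 y)
  d_three : ∀ y ∈ O, extD (χ 3) y = (1 / 2 : 𝕜) •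
    (wedge (χ 4 y) (χ 5 y) + k y ^ 2 • wedge (χ 6 y) (χ 7 y))
  d_four : ∀ y ∈ O, extD (χ 4) y = wedge (α₁ y • χ 6 y + α₂ y • χ 7 y + χ 3 y) (χ 4 y)
  d_five : ∀ y ∈ O, extD (χ 5) y = wedge (χ 5 y) (α₁ y • χ 6 y + α₂ y • χ 7 y + χ 3 y)
  d_six : ∀ y ∈ O, extD (χ 6) y = α₂ y • wedge (χ 6 y) (χ 7 y)
  d_seven : ∀ y ∈ O, extD (χ 7) y = α₁ y • wedge (χ 6 y) (χ 7 y)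
  k_ne_zero : ∀ y ∈ O, k y ≠ 0
  smooth_k : ContDiffOn ℝ ∞ k O
  smooth_p : ContDiffOn ℝ ∞ p O
  smooth_m : ContDiffOn ℝ ∞ m O
  hasFDerivAt_k : ∀ y ∈ O, HasFDerivAt k ((k y * p y) • χ 6 y + (k y * m y) • χ 7 y) y
  hasFDerivAt_p : ∀ y ∈ O, HasFDerivAt p
    ((p y * α₁ y + 2 * k y * a y + p y ^ 2 / 2) • χ 6 y +
      (p y * α₂ y + 2 * k y * b y + k y ^ 2 + p y * m y / 2) • χ 7 y) y
  hasFDerivAt_m : ∀ y ∈ O, HasFDerivAt m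
    ((-m y * α₁ y + 2 * k y * b y + k y ^ 2 + p y * m y / 2) • χ 6 y +
      (-m y * α₂ y + 2 * k y * c y + m y ^ 2 / 2) • χ 7 y) y
  hasFDerivAt_a : ∀ y ∈ O, ∃ a₁ a₂ : 𝕜, HasFDerivAt a (a₁ • χ 6 y + a₂ • χ 7 y) y
  hasFDerivAt_b : ∀ y ∈ O, ∃ b₁ b₂ : 𝕜, HasFDerivAt b (b₁ • χ 6 y + b₂ • χ 7 y) y
  hasFDerivAt_c : ∀ y ∈ O, ∃ c₁ c₂ : 𝕜, HasFDerivAt c (c₁ • χ 6 y + c₂ • χ 7 y) y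

/-- The singular system of the isometric embedding system that belongs to `k`. -/
def singularSystem (e : Fin 8 → E → E) (k : E → 𝕜) (y : E) : Submodule 𝕜 (Covector 𝕜 E) :=
  LinearMap.ker (framePair (fun i => e i y) ![0, 0, 0, 0, 0, -k y, 1, 0]) ⊓
    LinearMap.ker (framePair (fun i => e i y) ![0, 0, 0, 0, k y, 0, 0, 1])

theorem mem_singularSystem {e : Fin 8 → E → E} {k : E → 𝕜} {y : E} {φ : Covector 𝕜 E} :
    φ ∈ singularSystem e k y ↔
      φ (e 6 y) = k y * φ (e 5 y) ∧ φ (e 7 y) = -(k y * φ (e 4 y)) := by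
  simp only [singularSystem, Submodule.mem_inf, LinearMap.mem_ker, framePair_apply,
    Fin.sum_univ_eight]
  simp
  constructor
  · rintro ⟨h₁, h₂⟩
    exact ⟨by linear_combination h₁, by linear_combination h₂⟩
  · rintro ⟨h₁, h₂⟩
    exact ⟨by linear_combination h₁, by linear_combination h₂⟩

/-- `f` has differential `f₁ χ 6 + f₂ χ 7`. -/
def HasNullDeriv (χ : Fin 8 → E → Covector 𝕜 E) (y : E) (f : E → 𝕜) (f₁ f₂ : 𝕜) : Prop :=
  HasFDerivAt f (f₁ • χ 6 y + f₂ • χ 7 y) y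

namespace HasNullDeriv

variable {χ : Fin 8 → E → Covector 𝕜 E} {y : E} {f : E → 𝕜} {f₁ f₂ : 𝕜}

theorem mk (h : HasFDerivAt f (f₁ • χ 6 y + f₂ • χ 7 y) y) : HasNullDeriv χ y f f₁ f₂ := h

theorem const (c : 𝕜) : HasNullDeriv χ y (fun _ => c) 0 0 := by
  have : (0 : 𝕜) • χ 6 y + (0 : 𝕜) • χ 7 y = 0 := by ext; simp
  rw [HasNullDeriv, this]
  exact hasFDerivAt_const c y

theorem const_mul (h : HasNullDeriv χ y f f₁ f₂) (c : 𝕜) :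
    HasNullDeriv χ y (fun z => c * f z) (c * f₁) (c * f₂) := by
  have h' : HasFDerivAt f (f₁ • χ 6 y + f₂ • χ 7 y) y := h
  have := h'.const_mul c
  unfold HasNullDeriv
  rwa [smul_add, smul_smul, smul_smul] at this

theorem neg (h : HasNullDeriv χ y f f₁ f₂) : HasNullDeriv χ y (fun z => -f z) (-f₁) (-f₂) := by
  simpa using h.const_mul (-1)

end HasNullDeriv

namespace IsSingularCoframe

variable {O : Set E} {e : Fin 8 → E → E} {χ : Fin 8 → E → Covector 𝕜 E}
  {k p m a b c α₁ α₂ : E → 𝕜}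

/-- The values of the structure equations on a pair of `𝕜`-tangent vectors. -/
theorem structure_eval (h : IsSingularCoframe O e χ k p m a b c α₁ α₂) {y : E} (hy : y ∈ O)
    (Z W : Fin 8 → 𝕜) (i : Fin 8) :
    framePair (fun j => e j y) W (frameInterior (fun j => e j y) Z (extD (χ i) y)) =
      ![-(1 / 2) * (Z 4 * (W 6 + W 1) - (Z 6 + Z 1) * W 4 +
          (Z 5 * (W 7 + W 2) - (Z 7 + Z 2) * W 5)),
        -((Z 3 * W 6 - Z 6 * W 3) + ((α₁ y * Z 6 + α₂ y * Z 7) * W 1 -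
          Z 1 * (α₁ y * W 6 + α₂ y * W 7)) + (Z 3 * W 1 - Z 1 * W 3) + (Z 5 * W 0 - Z 0 * W 5)),
        (Z 3 * W 7 - Z 7 * W 3) + ((α₁ y * Z 6 + α₂ y * Z 7) * W 2 -
          Z 2 * (α₁ y * W 6 + α₂ y * W 7)) + (Z 3 * W 2 - Z 2 * W 3) + (Z 0 * W 4 - Z 4 * W 0),
        (1 / 2) * ((Z 4 * W 5 - Z 5 * W 4) + k y ^ 2 * (Z 6 * W 7 - Z 7 * W 6)),
        (α₁ y * Z 6 + α₂ y * Z 7 + Z 3) * W 4 - Z 4 * (α₁ y * W 6 + α₂ y * W 7 + W 3),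
        Z 5 * (α₁ y * W 6 + α₂ y * W 7 + W 3) - (α₁ y * Z 6 + α₂ y * Z 7 + Z 3) * W 5,
        α₂ y * (Z 6 * W 7 - Z 7 * W 6),
        α₁ y * (Z 6 * W 7 - Z 7 * W 6)] i := by
  fin_cases i
  · change framePair _ _ (frameInterior _ _ (extD (χ 0) y)) = _
    simp only [h.d_zero y hy, map_add, map_smul, framePair_frameInterior_wedge, h.pair_coframe hy,
      smul_eq_mul]
    simp
  · change framePair _ _ (frameInterior _ _ (extD (χ 1) y)) = _
    simp only [h.d_one y hy, map_add, map_smul, framePair_frameInterior_wedge, h.pair_coframe hy,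
      smul_eq_mul]
    simp
  · change framePair _ _ (frameInterior _ _ (extD (χ 2) y)) = _
    simp only [h.d_two y hy, map_add, map_smul, framePair_frameInterior_wedge, h.pair_coframe hy,
      smul_eq_mul]
    simp
  · change framePair _ _ (frameInterior _ _ (extD (χ 3) y)) = _
    simp only [h.d_three y hy, map_add, map_smul, framePair_frameInterior_wedge, h.pair_coframe hy,
      smul_eq_mul]
    simp
  · change framePair _ _ (frameInterior _ _ (extD (χ 4) y)) = _
    simp only [h.d_four y hy, map_add, map_smul, framePair_frameInterior_wedge, h.pair_coframe hy,
      smul_eq_mul]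
    simp
  · change framePair _ _ (frameInterior _ _ (extD (χ 5) y)) = _
    simp only [h.d_five y hy, map_add, map_smul, framePair_frameInterior_wedge, h.pair_coframe hy,
      smul_eq_mul]
    simp
  · change framePair _ _ (frameInterior _ _ (extD (χ 6) y)) = _
    simp only [h.d_six y hy, map_smul, framePair_frameInterior_wedge, h.pair_coframe hy,
      smul_eq_mul]
    simp
  · change framePair _ _ (frameInterior _ _ (extD (χ 7) y)) = _
    simp only [h.d_seven y hy, map_smul, framePair_frameInterior_wedge, h.pair_coframe hy,
      smul_eq_mul]
    simp

/-- The bracket lemma for fields whose coefficients are functions on the surface: their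
differentials involve only `χ 6` and `χ 7`, so differentiation along `Z` or `W` sees only the
components with indices 6 and 7. -/
theorem bracket_eq_zero (h : IsSingularCoframe O e χ k p m a b c α₁ α₂)
    {V : E → Submodule 𝕜 (Covector 𝕜 E)} {U : Set E} (hU : IsOpen U) (hUO : U ⊆ O)
    {Z W : E → Fin 8 → 𝕜} {y : E} (hy : y ∈ U)
    (hZ : ∀ z ∈ U, ∀ α ∈ V z, framePair (fun j => e j z) (Z z) α = 0)
    (hW : ∀ z ∈ U, ∀ α ∈ V z, framePair (fun j => e j z) (W z) α = 0)
    {Z₁ Z₂ W₁ W₂ : Fin 8 → 𝕜}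
    (hdZ : ∀ i, HasNullDeriv χ y (fun z => Z z i) (Z₁ i) (Z₂ i))
    (hdW : ∀ i, HasNullDeriv χ y (fun z => W z i) (W₁ i) (W₂ i))
    {φ : Covector 𝕜 E} (hφ : φ ∈ derivedSystem V y) :
    ∑ i, (framePair (fun j => e j y) (W y) (frameInterior (fun j => e j y) (Z y) (extD (χ i) y)) +
      (Z₁ i * W y 6 + Z₂ i * W y 7) - (W₁ i * Z y 6 + W₂ i * Z y 7)) * φ (e i y) = 0 := by
  have := h.derivedSystem_bracket hU hUO hy hZ hW hdZ hdW hφ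
  rw [framePair_apply] at this
  simpa only [map_add, map_smul, h.pair_coframe (hUO hy), smul_eq_mul] using this

/-- The vector fields annihilated by the singular system and its derived systems. -/
def singularField (k p m a b c : E → 𝕜) : Fin 5 → E → Fin 8 → 𝕜 :=
  ![fun y => ![0, 0, 0, 0, 0, -k y, 1, 0], fun y => ![0, 0, 0, 0, k y, 0, 0, 1],
    fun y => ![1, 0, 0, k y, -p y, -m y, 0, 0], fun y => ![0, 1, 0, -(1 / 2) * p y, a y, b y, 0, 0],
    fun y => ![0, 0, 1, (1 / 2) * m y, -b y, -c y, 0, 0]]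

/-- The bracket of the two fields annihilating the singular system is, up to sign and modulo these
fields, `k` times the third of the `singularField`s. Only the inclusion of `V` in the singular
system is needed, so the conclusion applies to any decomposition. -/
theorem derivedFlag_one (h : IsSingularCoframe O e χ k p m a b c α₁ α₂)
    {V : E → Submodule 𝕜 (Covector 𝕜 E)} {U : Set E} (hU : IsOpen U) (hUO : U ⊆ O)
    (hV : ∀ z ∈ U, V z ≤ singularSystem e k z) {y : E} (hy : y ∈ U) {φ : Covector 𝕜 E}
    (hφ : φ ∈ derivedFlag V 1 y) :
    φ (e 0 y) = -k y * φ (e 3 y) + p y * φ (e 4 y) + m y * φ (e 5 y) := by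
  have hyO := hUO hy
  have hk := HasNullDeriv.mk (h.hasFDerivAt_k y hyO)
  have hφ' := mem_singularSystem.1 (hV y hy (derivedFlag_succ_le V 0 y hφ))
  have key := h.bracket_eq_zero hU hUO (V := V) (Z := singularField k p m a b c 0)
    (W := singularField k p m a b c 1) hy
    (fun z hz α hα => LinearMap.mem_ker.1 (hV z hz hα).1)
    (fun z hz α hα => LinearMap.mem_ker.1 (hV z hz hα).2)
    (Z₁ := ![0, 0, 0, 0, 0, -(k y * p y), 0, 0]) (Z₂ := ![0, 0, 0, 0, 0, -(k y * m y), 0, 0])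
    (W₁ := ![0, 0, 0, 0, k y * p y, 0, 0, 0]) (W₂ := ![0, 0, 0, 0, k y * m y, 0, 0, 0])
    (by intro i; fin_cases i <;> first | exact .const _ | exact hk.neg)
    (by intro i; fin_cases i <;> first | exact .const _ | exact hk) hφ
  simp only [h.structure_eval hyO, Fin.sum_univ_eight] at key
  simp [singularField] at key
  refine mul_left_cancel₀ (h.k_ne_zero y hyO) ?_
  rw [hφ'.1, hφ'.2] at key
  linear_combination key

/-- The brackets of `X` and `Y` with `T` are, up to sign and modulo `X`, `Y`, `T`, equal to `2k`
times the last two `singularField`s. The normalization of `a`, `b`, `c` in the derivatives of `p`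
and `m` is chosen so that these fields have exactly these coefficients. -/
theorem derivedFlag_two (h : IsSingularCoframe O e χ k p m a b c α₁ α₂)
    {V : E → Submodule 𝕜 (Covector 𝕜 E)} {U : Set E} (hU : IsOpen U) (hUO : U ⊆ O)
    (hV : ∀ z ∈ U, V z ≤ singularSystem e k z) {y : E} (hy : y ∈ U) {φ : Covector 𝕜 E}
    (hφ : φ ∈ derivedFlag V 2 y) :
    φ (e 1 y) = 1 / 2 * p y * φ (e 3 y) - a y * φ (e 4 y) - b y * φ (e 5 y) ∧
      φ (e 2 y) = -(1 / 2) * m y * φ (e 3 y) + b y * φ (e 4 y) + c y * φ (e 5 y) := by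
  have hyO := hUO hy
  have hk := HasNullDeriv.mk (h.hasFDerivAt_k y hyO)
  have hp := HasNullDeriv.mk (h.hasFDerivAt_p y hyO)
  have hm := HasNullDeriv.mk (h.hasFDerivAt_m y hyO)
  have hle : ∀ z ∈ U, derivedFlag V 1 z ≤ singularSystem e k z := fun z hz =>
    (derivedFlag_succ_le V 0 z).trans (hV z hz)
  have hφ₁ := derivedFlag_succ_le V 1 y hφ
  have hφ₀ := mem_singularSystem.1 (hle y hy hφ₁)
  have hφ₁' := h.derivedFlag_one hU hUO hV hy hφ₁
  have hT : ∀ z ∈ U, ∀ α ∈ derivedFlag V 1 z,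
      framePair (fun j => e j z) (singularField k p m a b c 2 z) α = 0 := by
    intro z hz α hα
    have := h.derivedFlag_one hU hUO hV hz hα
    simp [framePair_apply, Fin.sum_univ_eight, singularField]
    linear_combination this
  have hdT : ∀ i, HasNullDeriv χ y (fun z => singularField k p m a b c 2 z i)
      (![0, 0, 0, k y * p y, -(p y * α₁ y + 2 * k y * a y + p y ^ 2 / 2),
        -(-m y * α₁ y + 2 * k y * b y + k y ^ 2 + p y * m y / 2), 0, 0] i)
      (![0, 0, 0, k y * m y, -(p y * α₂ y + 2 * k y * b y + k y ^ 2 + p y * m y / 2),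
        -(-m y * α₂ y + 2 * k y * c y + m y ^ 2 / 2), 0, 0] i) := by
    intro i
    fin_cases i <;> first | exact .const _ | exact hk | exact hp.neg | exact hm.neg
  have key₁ := h.bracket_eq_zero hU hUO (V := derivedFlag V 1) (Z := singularField k p m a b c 0)
    (W := singularField k p m a b c 2) hy
    (fun z hz α hα => LinearMap.mem_ker.1 (hle z hz hα).1) hT
    (Z₁ := ![0, 0, 0, 0, 0, -(k y * p y), 0, 0]) (Z₂ := ![0, 0, 0, 0, 0, -(k y * m y), 0, 0])
    (by intro i; fin_cases i <;> first | exact .const _ | exact hk.neg) hdT hφ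
  have key₂ := h.bracket_eq_zero hU hUO (V := derivedFlag V 1) (Z := singularField k p m a b c 1)
    (W := singularField k p m a b c 2) hy
    (fun z hz α hα => LinearMap.mem_ker.1 (hle z hz hα).2) hT
    (Z₁ := ![0, 0, 0, 0, k y * p y, 0, 0, 0]) (Z₂ := ![0, 0, 0, 0, k y * m y, 0, 0, 0])
    (by intro i; fin_cases i <;> first | exact .const _ | exact hk) hdT hφ
  simp only [h.structure_eval hyO, Fin.sum_univ_eight] at key₁ key₂
  simp [singularField] at key₁ key₂
  have hk0 := h.k_ne_zero y hyO
  simp only [hφ₁'] at key₁ key₂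
  exact ⟨mul_left_cancel₀ hk0 (by linear_combination (1 / 2) * key₁),
    mul_left_cancel₀ hk0 (by linear_combination (-1 / 2) * key₂)⟩

/-- Since `X, Y, T, P, Q` already determine the other components, each further bracket gives an
equation in `φ (e 3)`, `φ (e 4)`, `φ (e 5)`. The brackets of `T` with `P`, `Q` are explicit, because
these fields have no components along `e 6`, `e 7` and so do not differentiate the coefficients. The
brackets with `X` and `Y` contain derivatives of `a`, `b`, `c`, hidden in the `rᵢ`. As `b` is a
coefficient of both `P` and `Q`, with opposite signs, its derivatives enter two of the equations
through `r₂` and `-r₂`, and likewise through `r₅` and `-r₅`; this allows their elimination. -/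
theorem derivedFlag_three (h : IsSingularCoframe O e χ k p m a b c α₁ α₂)
    {V : E → Submodule 𝕜 (Covector 𝕜 E)} {U : Set E} (hU : IsOpen U) (hUO : U ⊆ O)
    (hV : ∀ z ∈ U, V z ≤ singularSystem e k z) {y : E} (hy : y ∈ U) :
    ∃ r₁ r₂ r₃ r₄ r₅ r₆ : 𝕜, ∀ φ ∈ derivedFlag V 3 y,
      (-(k y * p y) * φ (e 3 y) + 2 * k y * a y * φ (e 4 y) +
        (p y * m y + a y * c y - b y ^ 2) * φ (e 5 y) = 0 ∧
      -(k y * m y) * φ (e 3 y) + (p y * m y + a y * c y - b y ^ 2) * φ (e 4 y) +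
        2 * k y * c y * φ (e 5 y) = 0) ∧
      (k y * a y * φ (e 3 y) + r₁ * φ (e 4 y) + r₂ * φ (e 5 y) = 0 ∧
      -(k y * b y + k y ^ 2) * φ (e 3 y) + (k y * p y - r₂) * φ (e 4 y) + r₃ * φ (e 5 y) = 0) ∧
      (k y * b y + k y ^ 2) * φ (e 3 y) + r₄ * φ (e 4 y) + r₅ * φ (e 5 y) = 0 ∧
      -(k y * c y) * φ (e 3 y) + (-(k y * m y) - r₅) * φ (e 4 y) + r₆ * φ (e 5 y) = 0 := by
  have hyO := hUO hy
  have hk := HasNullDeriv.mk (h.hasFDerivAt_k y hyO)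
  have hp := HasNullDeriv.mk (h.hasFDerivAt_p y hyO)
  have hm := HasNullDeriv.mk (h.hasFDerivAt_m y hyO)
  obtain ⟨a₁, a₂, ha⟩ := h.hasFDerivAt_a y hyO
  obtain ⟨b₁, b₂, hb⟩ := h.hasFDerivAt_b y hyO
  obtain ⟨c₁, c₂, hc⟩ := h.hasFDerivAt_c y hyO
  have ha := HasNullDeriv.mk ha
  have hb := HasNullDeriv.mk hb
  have hc := HasNullDeriv.mk hc
  have hle₁ : ∀ z ∈ U, derivedFlag V 1 z ≤ singularSystem e k z := fun z hz =>
    (derivedFlag_succ_le V 0 z).trans (hV z hz)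
  have hle : ∀ z ∈ U, derivedFlag V 2 z ≤ singularSystem e k z := fun z hz =>
    (derivedFlag_succ_le V 1 z).trans (hle₁ z hz)
  have hA : ∀ i, ∀ z ∈ U, ∀ α ∈ derivedFlag V 2 z,
      framePair (fun j => e j z) (singularField k p m a b c i z) α = 0 := by
    intro i z hz α hα
    have h₀ := hle z hz hα
    have h₁ := h.derivedFlag_one hU hUO hV hz (derivedFlag_succ_le V 1 z hα)
    have h₂ := h.derivedFlag_two hU hUO hV hz hα
    fin_cases i
    · exact LinearMap.mem_ker.1 h₀.1
    · exact LinearMap.mem_ker.1 h₀.2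
    · simp [framePair_apply, Fin.sum_univ_eight, singularField]
      linear_combination h₁
    · simp [framePair_apply, Fin.sum_univ_eight, singularField]
      linear_combination h₂.1
    · simp [framePair_apply, Fin.sum_univ_eight, singularField]
      linear_combination h₂.2
  have hX : ∀ i, HasNullDeriv χ y (fun z => singularField k p m a b c 0 z i)
      (![0, 0, 0, 0, 0, -(k y * p y), 0, 0] i) (![0, 0, 0, 0, 0, -(k y * m y), 0, 0] i) := by
    intro i; fin_cases i <;> first | exact .const _ | exact hk.neg
  have hY : ∀ i, HasNullDeriv χ y (fun z => singularField k p m a b c 1 z i)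
      (![0, 0, 0, 0, k y * p y, 0, 0, 0] i) (![0, 0, 0, 0, k y * m y, 0, 0, 0] i) := by
    intro i; fin_cases i <;> first | exact .const _ | exact hk
  have hT : ∀ i, HasNullDeriv χ y (fun z => singularField k p m a b c 2 z i)
      (![0, 0, 0, k y * p y, -(p y * α₁ y + 2 * k y * a y + p y ^ 2 / 2),
        -(-m y * α₁ y + 2 * k y * b y + k y ^ 2 + p y * m y / 2), 0, 0] i)
      (![0, 0, 0, k y * m y, -(p y * α₂ y + 2 * k y * b y + k y ^ 2 + p y * m y / 2),
        -(-m y * α₂ y + 2 * k y * c y + m y ^ 2 / 2), 0, 0] i) := by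
    intro i
    fin_cases i <;> first | exact .const _ | exact hk | exact hp.neg | exact hm.neg
  have hP : ∀ i, HasNullDeriv χ y (fun z => singularField k p m a b c 3 z i)
      (![0, 0, 0, -(1 / 2) * (p y * α₁ y + 2 * k y * a y + p y ^ 2 / 2), a₁, b₁, 0, 0] i)
      (![0, 0, 0, -(1 / 2) * (p y * α₂ y + 2 * k y * b y + k y ^ 2 + p y * m y / 2), a₂, b₂,
        0, 0] i) := by
    intro i
    fin_cases i <;> first | exact .const _ | exact hp.const_mul _ | exact ha | exact hb
  have hQ : ∀ i, HasNullDeriv χ y (fun z => singularField k p m a b c 4 z i)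
      (![0, 0, 0, (1 / 2) * (-m y * α₁ y + 2 * k y * b y + k y ^ 2 + p y * m y / 2), -b₁, -c₁,
        0, 0] i)
      (![0, 0, 0, (1 / 2) * (-m y * α₂ y + 2 * k y * c y + m y ^ 2 / 2), -b₂, -c₂, 0, 0] i) := by
    intro i
    fin_cases i <;> first | exact .const _ | exact hm.const_mul _ | exact hb.neg | exact hc.neg
  -- These are the coefficients of `φ (e 4)` and `φ (e 5)` read off from the brackets, after the
  -- components along `e 0`, `e 1`, `e 2`, `e 6`, `e 7` have been eliminated.
  refine ⟨p y * a y - (a₁ - 2 * a y * α₁ y), k y * p y / 2 + m y * a y / 2 + p y * b y / 2 - b₁,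
    (c₁ + 2 * c y * α₁ y) - m y * b y, p y * b y - (a₂ - 2 * a y * α₂ y),
    m y * b y / 2 - k y * m y / 2 + p y * c y / 2 - b₂,
    (c₂ + 2 * c y * α₂ y) - m y * c y, fun φ hφ => ?_⟩
  have h₂ := h.derivedFlag_two hU hUO hV hy (derivedFlag_succ_le V 2 y hφ)
  have h₁ := h.derivedFlag_one hU hUO hV hy
    (derivedFlag_succ_le V 1 y (derivedFlag_succ_le V 2 y hφ))
  have h₀ := mem_singularSystem.1 (hle y hy (derivedFlag_succ_le V 2 y hφ))
  have kXP := h.bracket_eq_zero hU hUO (V := derivedFlag V 2) hy (hA 0) (hA 3) hX hP hφ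
  have kXQ := h.bracket_eq_zero hU hUO (V := derivedFlag V 2) hy (hA 0) (hA 4) hX hQ hφ
  have kYP := h.bracket_eq_zero hU hUO (V := derivedFlag V 2) hy (hA 1) (hA 3) hY hP hφ
  have kYQ := h.bracket_eq_zero hU hUO (V := derivedFlag V 2) hy (hA 1) (hA 4) hY hQ hφ
  have kTP := h.bracket_eq_zero hU hUO (V := derivedFlag V 2) hy (hA 2) (hA 3) hT hP hφ
  have kTQ := h.bracket_eq_zero hU hUO (V := derivedFlag V 2) hy (hA 2) (hA 4) hT hQ hφ
  simp only [h.structure_eval hyO, Fin.sum_univ_eight] at kXP kXQ kYP kYQ kTP kTQ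
  simp [singularField] at kXP kXQ kYP kYQ kTP kTQ
  simp only [h₁, h₂.1, h₂.2] at kXP kXQ kYP kYQ kTP kTQ
  refine ⟨⟨?_, ?_⟩, ⟨?_, ?_⟩, ?_, ?_⟩
  · linear_combination kTP
  · linear_combination kTQ
  · linear_combination kXP
  · linear_combination kXQ
  · linear_combination kYP
  · linear_combination kYQ

end IsSingularCoframe
end SingularCoframe

/-! ### Necessity: a Darboux integrable system has the expected singular systems and satisfies the
curvature equations. -/

section SingularCoframe

variable {𝕜 : Type*} [RCLike 𝕜] {E : Type*} [NormedAddCommGroup E] [NormedSpace ℝ E]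

/-- The generators enter the definition only through the degree one and degree two parts of the
differential ideal at each point. -/
theorem IsDarbouxIntegrable.congr {ι κ : Type*} {W : Set E} {θ : ι → E → Covector 𝕜 E}
    {θ' : κ → E → Covector 𝕜 E} (h₁ : ∀ y ∈ W, spanForms θ y = spanForms θ' y)
    (h₂ : ∀ y ∈ W, idealTwo (spanForms θ y) (Set.range fun i => extD (θ i) y) =
      idealTwo (spanForms θ' y) (Set.range fun i => extD (θ' i) y))
    (h : IsDarbouxIntegrable W θ) : IsDarbouxIntegrable W θ' := by
  intro x hx
  obtain ⟨U, hU, hxU, hUW, r, p, q, s, t, τ, σ₁, σ₂, Ω₁, Ω₂, hd, hrest⟩ := h x hx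
  refine ⟨U, hU, hxU, hUW, r, p, q, s, t, τ, σ₁, σ₂, Ω₁, Ω₂, ?_, hrest⟩
  exact { hd with
    degree_one := fun y hy => (hd.degree_one y hy).trans (h₁ y (hUW hy))
    degree_two := fun y hy => (hd.degree_two y hy).trans (h₂ y (hUW hy)) }

theorem covector_zero_smul (φ : Covector 𝕜 E) : (0 : 𝕜) • φ = 0 := by
  ext; simp

theorem spanForms_le_iff {ι : Type*} {θ : ι → E → Covector 𝕜 E} {y : E}
    {S : Submodule 𝕜 (Covector 𝕜 E)} : spanForms θ y ≤ S ↔ ∀ i, θ i y ∈ S :=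
  Submodule.span_le.trans Set.range_subset_iff

theorem mem_spanForms {ι : Type*} (θ : ι → E → Covector 𝕜 E) (y : E) (i : ι) :
    θ i y ∈ spanForms θ y :=
  Submodule.subset_span ⟨i, rfl⟩

/-- The second exterior power of a plane is a line, so a form quadratic in two `σ`'s is
automatically decomposable. -/
theorem extSquare_span_pair {V : Submodule 𝕜 (Covector 𝕜 E)} {s t : Covector 𝕜 E}
    (hV : V ≤ Submodule.span 𝕜 {s, t}) {Ω : Bicovector 𝕜 E} (hΩ : Ω ∈ extSquare V) :
    ∃ c : 𝕜, Ω = c • wedge s t := by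
  have : extSquare V ≤ Submodule.span 𝕜 {wedge s t} := by
    refine Submodule.span_le.2 ?_
    rintro _ ⟨α, hα, β, hβ, rfl⟩
    obtain ⟨x, y, rfl⟩ := Submodule.mem_span_pair.1 (hV hα)
    obtain ⟨z, w, rfl⟩ := Submodule.mem_span_pair.1 (hV hβ)
    refine Submodule.mem_span_singleton.2 ⟨x * w - y * z, ?_⟩
    ext u v
    simp [wedge_apply]
    ring
  obtain ⟨c, hc⟩ := Submodule.mem_span_singleton.1 (this hΩ)
  exact ⟨c, hc.symm⟩

/-- The solution of the algebraic system that expresses that the third derived system of the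
singular system has rank two. -/
theorem eq_of_rank_conditions {𝕜 : Type*} [Field 𝕜] [CharZero 𝕜] {k p m a b c f g r₂ r₅ : 𝕜}
    (hk : k ≠ 0) (h₁ : k * a = k * p * f) (h₂ : p * m + a * c - b ^ 2 = 2 * k * m * f)
    (h₃ : p * m + a * c - b ^ 2 = 2 * k * p * g) (h₄ : k * c = k * m * g)
    (h₅ : r₂ = -(2 * k * a * g)) (h₆ : k * p - r₂ = 2 * (k * b + k ^ 2) * f)
    (h₇ : r₅ = -(2 * (k * b + k ^ 2) * g)) (h₈ : -(k * m) - r₅ = 2 * k * c * f) :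
    2 * k * a = p ^ 2 ∧ 2 * k * b = p * m ∧ 2 * k * c = m ^ 2 := by
  subst h₅ h₇
  have ha : a = p * f := mul_left_cancel₀ hk (by linear_combination h₁)
  have hc : c = m * g := mul_left_cancel₀ hk (by linear_combination h₄)
  have hp : p = 2 * (b + k) * f - 2 * a * g := mul_left_cancel₀ hk (by linear_combination h₆)
  have hm : m = 2 * (b + k) * g - 2 * c * f := mul_left_cancel₀ hk (by linear_combination -h₈)
  subst ha hc
  -- If `f = 0` then `a = p = 0` and `b² = 0`, and the equation for `m` reduces to the last claim;
  -- the case `g = 0` is symmetric. In both cases the first two or the last two claims become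
  -- trivial.
  by_cases hf : f = 0
  · subst hf
    have hp' : p = 0 := by linear_combination hp
    subst hp'
    have hb : b = 0 := by
      have : b ^ 2 = 0 := by linear_combination -h₂
      exact pow_eq_zero_iff (two_ne_zero) |>.1 this
    subst hb
    refine ⟨by ring, by ring, by linear_combination (-m) * hm⟩
  by_cases hg : g = 0
  · subst hg
    have hm' : m = 0 := by linear_combination hm
    subst hm'
    have hb : b = 0 := by
      have : b ^ 2 = 0 := by linear_combination -h₃
      exact pow_eq_zero_iff (two_ne_zero) |>.1 this
    subst hb
    refine ⟨by linear_combination (-p) * hp, by ring, by ring⟩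
  -- In the generic case `h₂` and `h₃` give `m f = p g`, so `(p, m)` is a multiple `r` of `(f, g)`;
  -- then `b` is determined, and `h₂` becomes the perfect square `(r / 2 - k)² = 0`.
  obtain ⟨r, rfl⟩ : ∃ r, p = r * f := ⟨p / f, by field_simp⟩
  have hmr : m = r * g := by
    have : k * f * m = k * f * (r * g) := by linear_combination (h₃ - h₂) / 2
    exact mul_left_cancel₀ (mul_ne_zero hk hf) this
  subst hmr
  have hb : b = r / 2 + r * f * g - k := by
    have : f * b = f * (r / 2 + r * f * g - k) := by linear_combination -hp / 2
    exact mul_left_cancel₀ hf this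
  subst hb
  have hr : r = 2 * k := by
    have : (r / 2 - k) ^ 2 = 0 := by linear_combination -h₂
    have := pow_eq_zero_iff (two_ne_zero) |>.1 this
    linear_combination 2 * this
  subst hr
  exact ⟨by ring, by ring, by ring⟩

/-- The first four forms of a coframe of eight. -/
def firstFour (χ : Fin 8 → E → Covector 𝕜 E) (i : Fin 4) : E → Covector 𝕜 E :=
  χ (Fin.castLE (by norm_num) i)

theorem spanForms_firstFour_le_iff {χ : Fin 8 → E → Covector 𝕜 E} {y : E}
    {S : Submodule 𝕜 (Covector 𝕜 E)} :
    spanForms (firstFour χ) y ≤ S ↔ χ 0 y ∈ S ∧ χ 1 y ∈ S ∧ χ 2 y ∈ S ∧ χ 3 y ∈ S := by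
  rw [spanForms_le_iff, Fin.forall_fin_succ, Fin.forall_fin_succ, Fin.forall_fin_succ,
    Fin.forall_fin_succ]
  simp only [IsEmpty.forall_iff, and_true]
  exact Iff.rfl

namespace IsMovingFrame

variable {ι : Type*} [Fintype ι] {O : Set E} {e : ι → E → E} {χ : ι → E → Covector 𝕜 E}

theorem linearIndependent (h : IsMovingFrame O e χ) {y : E} (hy : y ∈ O) :
    LinearIndependent 𝕜 (fun i => χ i y) := by
  classical
  refine Fintype.linearIndependent_iff.2 fun g hg i => ?_
  have := congrArg (framePair (fun j => e j y) (Pi.single i 1)) hg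
  simpa [h.pair_coframe hy, Pi.single_apply] using this

theorem span_eq_top (h : IsMovingFrame O e χ) {y : E} (hy : y ∈ O) : spanForms χ y = ⊤ := by
  refine (Submodule.eq_top_iff').2 fun φ => ?_
  rw [h.expand y hy φ]
  exact Submodule.sum_mem _ fun i _ => Submodule.smul_mem _ _ (mem_spanForms χ y i)

end IsMovingFrame

namespace IsSingularCoframe

variable {O : Set E} {e : Fin 8 → E → E} {χ : Fin 8 → E → Covector 𝕜 E}
  {k p m a b c α₁ α₂ : E → 𝕜}

/-- The structure equations contain `k` only through `k²`, and the differentials of `p` and `m` only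
through `k²` and the products `k a`, `k b`, `k c`, so `k`, `a`, `b`, `c` may change sign together.
This passes to the other singular system without a second computation. -/
theorem neg (h : IsSingularCoframe O e χ k p m a b c α₁ α₂) :
    IsSingularCoframe O e χ (-k) p m (-a) (-b) (-c) α₁ α₂ where
  toIsMovingFrame := h.toIsMovingFrame
  d_zero := h.d_zero
  d_one := h.d_one
  d_two := h.d_two
  d_three y hy := by rw [h.d_three y hy, Pi.neg_apply, neg_sq]
  d_four := h.d_four
  d_five := h.d_five
  d_six := h.d_six
  d_seven := h.d_seven
  k_ne_zero y hy := neg_ne_zero.2 (h.k_ne_zero y hy)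
  smooth_k := h.smooth_k.neg
  smooth_p := h.smooth_p
  smooth_m := h.smooth_m
  hasFDerivAt_k y hy := by
    have := HasNullDeriv.neg (h.hasFDerivAt_k y hy)
    simp only [← neg_mul] at this
    exact this
  hasFDerivAt_p y hy := by
    convert h.hasFDerivAt_p y hy using 4 <;> simp
  hasFDerivAt_m y hy := by
    convert h.hasFDerivAt_m y hy using 4 <;> simp
  hasFDerivAt_a y hy := by
    obtain ⟨x, z, h⟩ := h.hasFDerivAt_a y hy
    exact ⟨_, _, HasNullDeriv.neg h⟩
  hasFDerivAt_b y hy := by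
    obtain ⟨x, z, h⟩ := h.hasFDerivAt_b y hy
    exact ⟨_, _, HasNullDeriv.neg h⟩
  hasFDerivAt_c y hy := by
    obtain ⟨x, z, h⟩ := h.hasFDerivAt_c y hy
    exact ⟨_, _, HasNullDeriv.neg h⟩

theorem firstFour_le_singularSystem (h : IsSingularCoframe O e χ k p m a b c α₁ α₂) {y : E}
    (hy : y ∈ O) : spanForms (firstFour χ) y ≤ singularSystem e k y := by
  rw [spanForms_firstFour_le_iff]
  simp [mem_singularSystem, h.apply_ne y hy]

theorem mem_firstFour_of_apply (h : IsSingularCoframe O e χ k p m a b c α₁ α₂) {y : E}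
    (hy : y ∈ O) {φ : Covector 𝕜 E} (h₄ : φ (e 4 y) = 0) (h₅ : φ (e 5 y) = 0)
    (h₆ : φ (e 6 y) = 0) (h₇ : φ (e 7 y) = 0) : φ ∈ spanForms (firstFour χ) y := by
  have hmem := spanForms_firstFour_le_iff.1 (le_refl (spanForms (firstFour χ) y))
  rw [h.expand y hy φ, Fin.sum_univ_eight, h₄, h₅, h₆, h₇]
  simp only [covector_zero_smul, add_zero]
  exact add_mem (add_mem (add_mem (Submodule.smul_mem _ _ hmem.1) (Submodule.smul_mem _ _ hmem.2.1))
    (Submodule.smul_mem _ _ hmem.2.2.1)) (Submodule.smul_mem _ _ hmem.2.2.2)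

/-- The conditions for `k` and `-k` differ only in the sign of the components along `e 4` and `e 5`;
since `k ≠ 0`, together they force all four components along `e 4, …, e 7` to vanish. -/
theorem mem_firstFour_of_mem_inf (h : IsSingularCoframe O e χ k p m a b c α₁ α₂) {y : E}
    (hy : y ∈ O) {φ : Covector 𝕜 E} (h₁ : φ ∈ singularSystem e k y)
    (h₂ : φ ∈ singularSystem e (-k) y) : φ ∈ spanForms (firstFour χ) y := by
  rw [mem_singularSystem] at h₁ h₂
  simp only [Pi.neg_apply] at h₂
  have hk := h.k_ne_zero y hy
  have h₅ : φ (e 5 y) = 0 :=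
    mul_left_cancel₀ hk (by linear_combination (h₂.1 - h₁.1) / 2)
  have h₄ : φ (e 4 y) = 0 :=
    mul_left_cancel₀ hk (by linear_combination (h₁.2 - h₂.2) / 2)
  refine h.mem_firstFour_of_apply hy h₄ h₅ ?_ ?_
  · rw [h₁.1, h₅, mul_zero]
  · rw [h₁.2, h₄, mul_zero, neg_zero]

theorem interior_mem_firstFour {Z : Fin 8 → 𝕜} {y : E}
    (hZ : ∀ α ∈ spanForms (firstFour χ) y, framePair (fun j => e j y) Z α = 0)
    {Θ : Bicovector 𝕜 E} (hΘ : Θ ∈ idealTwo (spanForms (firstFour χ) y) ∅) :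
    frameInterior (fun j => e j y) Z Θ ∈ spanForms (firstFour χ) y := by
  have : idealTwo (spanForms (firstFour χ) y) ∅ ≤
      (spanForms (firstFour χ) y).comap (frameInterior (fun j => e j y) Z) := by
    refine idealTwo_le (fun α hα β => ?_) (by simp)
    rw [Submodule.mem_comap, frameInterior_wedge, hZ α hα, covector_zero_smul, zero_sub]
    exact neg_mem (Submodule.smul_mem _ _ hα)
  exact this hΘ

/-- A decomposition of the degree two part of the embedding system into two decomposable forms
consists of the singular systems. -/
theorem mem_singularSystem_or (h : IsSingularCoframe O e χ k p m a b c α₁ α₂) {y : E}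
    (hy : y ∈ O) {s₁ t₁ s₂ t₂ : Covector 𝕜 E}
    (hli : ∀ x₁ y₁ x₂ y₂ : 𝕜, x₁ • s₁ + y₁ • t₁ + (x₂ • s₂ + y₂ • t₂) ∈
      spanForms (firstFour χ) y → x₁ = 0 ∧ y₁ = 0 ∧ x₂ = 0 ∧ y₂ = 0)
    (hΩ : ∀ i : Fin 4, ∃ Θ ∈ idealTwo (spanForms (firstFour χ) y) ∅, ∃ u v : 𝕜,
      extD (firstFour χ i) y = Θ + u • wedge s₁ t₁ + v • wedge s₂ t₂) :
    (s₁ ∈ singularSystem e k y ∧ t₁ ∈ singularSystem e k y) ∨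
      (s₂ ∈ singularSystem e k y ∧ t₂ ∈ singularSystem e k y) := by
  obtain ⟨Θ₀, hΘ₀, u₀, v₀, h₀⟩ := hΩ 0
  obtain ⟨Θ₃, hΘ₃, u₃, v₃, h₃⟩ := hΩ 3
  change extD (χ 0) y = _ at h₀
  change extD (χ 3) y = _ at h₃
  have hk := h.k_ne_zero y hy
  have hle := h.firstFour_le_singularSystem hy
  have hmem := spanForms_firstFour_le_iff.1 (le_refl (spanForms (firstFour χ) y))
  -- The combination `2 dχ 3 - 2k dχ 0` is decomposable modulo the system, and its kernel there is
  -- spanned by the two vectors that define the singular system of `k`.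
  have hΘ : (2 : 𝕜) • Θ₃ + (-2 * k y) • Θ₀ ∈ idealTwo (spanForms (firstFour χ) y) ∅ :=
    Submodule.add_mem _ (Submodule.smul_mem _ _ hΘ₃) (Submodule.smul_mem _ _ hΘ₀)
  have heq : (2 : 𝕜) • extD (χ 3) y + (-2 * k y) • extD (χ 0) y =
      ((2 : 𝕜) • Θ₃ + (-2 * k y) • Θ₀) + (2 * u₃ - 2 * k y * u₀) • wedge s₁ t₁ +
        (2 * v₃ - 2 * k y * v₀) • wedge s₂ t₂ := by
    rw [h₀, h₃]
    ext w z
    simp only [add_apply, smul_apply, smul_eq_mul]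
    ring
  generalize (2 : 𝕜) • Θ₃ + (-2 * k y) • Θ₀ = Θ at hΘ heq
  generalize 2 * u₃ - 2 * k y * u₀ = u at heq
  generalize 2 * v₃ - 2 * k y * v₀ = v at heq
  -- The combination takes the value `k² ≠ 0` on `e 6`, `e 7`, on which the system vanishes.
  have huv : u ≠ 0 ∨ v ≠ 0 := by
    by_contra! hcon
    rw [hcon.1, hcon.2] at heq
    have hΘ' : (2 : 𝕜) • extD (χ 3) y + (-2 * k y) • extD (χ 0) y ∈
        idealTwo (spanForms (firstFour χ) y) ∅ := by
      have h0 : Θ + (0 : 𝕜) • wedge s₁ t₁ + (0 : 𝕜) • wedge s₂ t₂ = Θ := by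
        ext w z
        simp only [add_apply, smul_apply, smul_eq_mul, zero_mul, add_zero]
      rw [heq, h0]; exact hΘ
    have hz : ∀ i : Fin 8, 4 ≤ i → ∀ α ∈ spanForms (firstFour χ) y,
        framePair (fun j => e j y) (Pi.single i 1) α = 0 := by
      intro i hi
      change spanForms (firstFour χ) y ≤ LinearMap.ker (framePair (fun j => e j y) (Pi.single i 1))
      rw [spanForms_firstFour_le_iff]
      simp only [LinearMap.mem_ker, h.pair_coframe hy]
      refine ⟨?_, ?_, ?_, ?_⟩ <;> exact Pi.single_eq_of_ne (by rintro rfl; revert hi; decide) _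
    have := framePair_frameInterior_eq_zero (fun j => e j y) (hz 6 (by decide)) (hz 7 (by decide))
      hΘ'
    rw [map_add, map_smul, map_smul, map_add, map_smul, map_smul, h.structure_eval hy,
      h.structure_eval hy] at this
    simp at this
    exact hk this
  -- A kernel vector `Z` of `u s₁ ∧ t₁ + v s₂ ∧ t₂` makes `u (s₁(Z) t₁ - t₁(Z) s₁) + v (s₂(Z) t₂ -
  -- t₂(Z) s₂)` vanish modulo the system. By independence `Z` annihilates each pair whose
  -- coefficient is not zero.
  have main : ∀ Z : Fin 8 → 𝕜,
      (∀ α ∈ spanForms (firstFour χ) y, framePair (fun j => e j y) Z α = 0) →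
      frameInterior (fun j => e j y) Z ((2 : 𝕜) • extD (χ 3) y + (-2 * k y) • extD (χ 0) y) ∈
        spanForms (firstFour χ) y →
      (u ≠ 0 → framePair (fun j => e j y) Z s₁ = 0 ∧ framePair (fun j => e j y) Z t₁ = 0) ∧
      (v ≠ 0 → framePair (fun j => e j y) Z s₂ = 0 ∧ framePair (fun j => e j y) Z t₂ = 0) := by
    intro Z hZ hin
    rw [heq, map_add, map_add, map_smul, map_smul, frameInterior_wedge, frameInterior_wedge,
      add_assoc] at hin
    have hin' := sub_mem hin (interior_mem_firstFour hZ hΘ)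
    rw [add_sub_cancel_left] at hin'
    obtain ⟨z₁, z₂, z₃, z₄⟩ := hli (-(u * framePair (fun j => e j y) Z t₁))
      (u * framePair (fun j => e j y) Z s₁) (-(v * framePair (fun j => e j y) Z t₂))
      (v * framePair (fun j => e j y) Z s₂) (by
        convert hin' using 1
        ext w
        simp
        ring)
    refine ⟨fun hu => ⟨?_, ?_⟩, fun hv => ⟨?_, ?_⟩⟩
    · exact (mul_eq_zero.1 z₂).resolve_left hu
    · exact (mul_eq_zero.1 (neg_eq_zero.1 z₁)).resolve_left hu
    · exact (mul_eq_zero.1 z₄).resolve_left hv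
    · exact (mul_eq_zero.1 (neg_eq_zero.1 z₃)).resolve_left hv
  have hX := main ![0, 0, 0, 0, 0, -k y, 1, 0] (fun α hα => LinearMap.mem_ker.1 (hle hα).1) (by
    have : frameInterior (fun j => e j y) ![0, 0, 0, 0, 0, -k y, 1, 0]
        ((2 : 𝕜) • extD (χ 3) y + (-2 * k y) • extD (χ 0) y) = (-k y ^ 2) • χ 2 y := by
      simp only [map_add, map_smul, h.d_zero y hy, h.d_three y hy, frameInterior_wedge,
        h.pair_coframe hy]
      ext w
      simp
      ring
    rw [this]
    exact Submodule.smul_mem _ _ hmem.2.2.1)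
  have hY := main ![0, 0, 0, 0, k y, 0, 0, 1] (fun α hα => LinearMap.mem_ker.1 (hle hα).2) (by
    have : frameInterior (fun j => e j y) ![0, 0, 0, 0, k y, 0, 0, 1]
        ((2 : 𝕜) • extD (χ 3) y + (-2 * k y) • extD (χ 0) y) = (k y ^ 2) • χ 1 y := by
      simp only [map_add, map_smul, h.d_zero y hy, h.d_three y hy, frameInterior_wedge,
        h.pair_coframe hy]
      ext w
      simp
      ring
    rw [this]
    exact Submodule.smul_mem _ _ hmem.2.1)
  rcases huv with hu | hv
  · exact Or.inl ⟨⟨(hX.1 hu).1, (hY.1 hu).1⟩, ⟨(hX.1 hu).2, (hY.1 hu).2⟩⟩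
  · exact Or.inr ⟨⟨(hX.2 hv).1, (hY.2 hv).1⟩, ⟨(hX.2 hv).2, (hY.2 hv).2⟩⟩

/-- The ranks in a decomposition of the embedding system. -/
theorem decomposition_ranks (h : IsSingularCoframe O e χ k p m a b c α₁ α₂) {y : E} (hy : y ∈ O)
    {r n₁ n₂ s t : ℕ} {τ : Fin r → E → Covector 𝕜 E} {σ₁ : Fin n₁ → E → Covector 𝕜 E}
    {σ₂ : Fin n₂ → E → Covector 𝕜 E} {Ω₁ : Fin s → E → Bicovector 𝕜 E}
    {Ω₂ : Fin t → E → Bicovector 𝕜 E} {U : Set E}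
    (hd : IsDecomposition U (firstFour χ) τ σ₁ σ₂ Ω₁ Ω₂) (hyU : y ∈ U) :
    n₁ = 2 ∧ n₂ = 2 := by
  have hli := hd.independent y hyU
  have hsp : ⊤ ≤ Submodule.span 𝕜 (Set.range
      (Sum.elim (fun i => τ i y) (Sum.elim (fun i => σ₁ i y) (fun i => σ₂ i y)))) := by
    rw [← hd.spanning y hyU, Set.Sum.elim_range, Set.Sum.elim_range, Submodule.span_union,
      Submodule.span_union, ← sup_assoc]
    exact le_refl _
  have hχ := h.linearIndependent hy
  have hcard := Fintype.card_congr ((Module.Basis.mk hli hsp).indexEquiv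
    (Module.Basis.mk hχ (h.span_eq_top hy).ge))
  have hτ : LinearIndependent 𝕜 (fun i => τ i y) := hli.comp Sum.inl Sum.inl_injective
  have hf : LinearIndependent 𝕜 (fun i => firstFour χ i y) :=
    hχ.comp (Fin.castLE (by norm_num)) (Fin.castLE_injective _)
  have h₁ := finrank_span_eq_card hτ
  have h₂ := finrank_span_eq_card hf
  have h₃ : Submodule.span 𝕜 (Set.range fun i => τ i y) =
      Submodule.span 𝕜 (Set.range fun i => firstFour χ i y) := hd.degree_one y hyU
  rw [h₃, h₂] at h₁
  simp at h₁ hcard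
  -- The `τ` have rank four, so four forms remain for the two families of `σ`'s, each of which has
  -- at least two.
  have := hd.two_le_left
  have := hd.two_le_right
  omega

/-- The first half of the forms in a decomposition at the point `z` is a singular system. -/
theorem singular_cases (h : IsSingularCoframe O e χ k p m a b c α₁ α₂) {y : E} (hy : y ∈ O)
    {r s t : ℕ} {τ : Fin r → E → Covector 𝕜 E} {σ₁ σ₂ : Fin 2 → E → Covector 𝕜 E}
    {Ω₁ : Fin s → E → Bicovector 𝕜 E} {Ω₂ : Fin t → E → Bicovector 𝕜 E} {U : Set E}
    (hd : IsDecomposition U (firstFour χ) τ σ₁ σ₂ Ω₁ Ω₂) (hyU : y ∈ U) :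
    ((∀ i, σ₁ i y ∈ singularSystem e k y) ∨ (∀ i, σ₂ i y ∈ singularSystem e k y)) ∧
      ¬((∀ i, σ₁ i y ∈ singularSystem e k y) ∧ ∀ i, σ₁ i y ∈ singularSystem e (-k) y) ∧
      ¬((∀ i, σ₂ i y ∈ singularSystem e k y) ∧ ∀ i, σ₂ i y ∈ singularSystem e (-k) y) := by
  have hli : ∀ x₁ y₁ x₂ y₂ : 𝕜, x₁ • σ₁ 0 y + y₁ • σ₁ 1 y + (x₂ • σ₂ 0 y + y₂ • σ₂ 1 y) ∈
      spanForms (firstFour χ) y → x₁ = 0 ∧ y₁ = 0 ∧ x₂ = 0 ∧ y₂ = 0 := by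
    intro x₁ y₁ x₂ y₂ hm
    rw [← hd.degree_one y hyU] at hm
    obtain ⟨g, hg⟩ := (Submodule.mem_span_range_iff_exists_fun 𝕜).1 hm
    have := Fintype.linearIndependent_iff.1 (hd.independent y hyU)
      (Sum.elim g (Sum.elim ![-x₁, -y₁] ![-x₂, -y₂])) (by
        simp only [Fintype.sum_sum_type, Sum.elim_inl, Sum.elim_inr, hg, Fin.sum_univ_two]
        ext w
        simp
        ring)
    exact ⟨by simpa using this (Sum.inr (Sum.inl 0)), by simpa using this (Sum.inr (Sum.inl 1)),
      by simpa using this (Sum.inr (Sum.inr 0)), by simpa using this (Sum.inr (Sum.inr 1))⟩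
  have hpair : ∀ σ : Fin 2 → E → Covector 𝕜 E,
      spanForms σ y ≤ Submodule.span 𝕜 {σ 0 y, σ 1 y} := by
    intro σ
    rw [spanForms_le_iff, Fin.forall_fin_two]
    exact ⟨Submodule.subset_span (by simp), Submodule.subset_span (by simp)⟩
  refine ⟨?_, fun hcon => ?_, fun hcon => ?_⟩
  · simp only [Fin.forall_fin_two]
    refine h.mem_singularSystem_or hy hli fun i => ?_
    have hm : extD (firstFour χ i) y ∈ idealTwo (spanForms (firstFour χ) y)
        (Set.range fun i => extD (firstFour χ i) y) := mem_idealTwo_of_mem ⟨i, rfl⟩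
    rw [← hd.degree_two y hyU, hd.degree_one y hyU] at hm
    have hle : idealTwo (spanForms (firstFour χ) y)
        (Set.range (fun b => Ω₁ b y) ∪ Set.range (fun b => Ω₂ b y)) ≤
        idealTwo (spanForms (firstFour χ) y) ∅ ⊔
          (Submodule.span 𝕜 {wedge (σ₁ 0 y) (σ₁ 1 y)} ⊔
            Submodule.span 𝕜 {wedge (σ₂ 0 y) (σ₂ 1 y)}) := by
      refine idealTwo_le (fun α hα β => Submodule.mem_sup_left (wedge_mem_idealTwo hα β)) ?_
      rintro _ (⟨j, rfl⟩ | ⟨j, rfl⟩)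
      · obtain ⟨u, hu⟩ := extSquare_span_pair (hpair σ₁) (hd.quadratic₁ y hyU j)
        exact Submodule.mem_sup_right (Submodule.mem_sup_left
          (Submodule.mem_span_singleton.2 ⟨u, hu.symm⟩))
      · obtain ⟨u, hu⟩ := extSquare_span_pair (hpair σ₂) (hd.quadratic₂ y hyU j)
        exact Submodule.mem_sup_right (Submodule.mem_sup_right
          (Submodule.mem_span_singleton.2 ⟨u, hu.symm⟩))
    obtain ⟨Θ, hΘ, Ψ, hΨ, hsum⟩ := Submodule.mem_sup.1 (hle hm)
    obtain ⟨Ψ₁, h₁, Ψ₂, h₂, rfl⟩ := Submodule.mem_sup.1 hΨ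
    obtain ⟨u, rfl⟩ := Submodule.mem_span_singleton.1 h₁
    obtain ⟨v, rfl⟩ := Submodule.mem_span_singleton.1 h₂
    exact ⟨Θ, hΘ, u, v, by
      rw [← hsum]
      ext w z
      simp only [add_apply, smul_apply]
      ring⟩
  · have := hli 1 0 0 0 (by
      convert h.mem_firstFour_of_mem_inf hy (hcon.1 0) (hcon.2 0) using 1
      ext w; simp)
    exact one_ne_zero this.1
  · have := hli 0 0 1 0 (by
      convert h.mem_firstFour_of_mem_inf hy (hcon.1 0) (hcon.2 0) using 1
      ext w; simp)
    exact one_ne_zero this.2.2.1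

/-- The Darboux pair condition supplies, at `y`, two elements of the third derived system with
independent components along `e 4` and `e 5`. Substituting them into the linear conditions of
`derivedFlag_three` gives the hypotheses of `eq_of_rank_conditions`. -/
theorem relations_of_decomposition (h : IsSingularCoframe O e χ k p m a b c α₁ α₂) {y : E}
    {r s t : ℕ} {τ : Fin r → E → Covector 𝕜 E} {σ₁ σ₂ : Fin 2 → E → Covector 𝕜 E}
    {Ω₁ : Fin s → E → Bicovector 𝕜 E} {Ω₂ : Fin t → E → Bicovector 𝕜 E} {U : Set E}
    (hU : IsOpen U) (hUO : U ⊆ O) (hyU : y ∈ U)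
    (hd : IsDecomposition U (firstFour χ) τ σ₁ σ₂ Ω₁ Ω₂)
    (hp : IsDarbouxPair U (fun x => spanForms τ x ⊔ spanForms σ₁ x)
      (fun x => spanForms τ x ⊔ spanForms σ₂ x))
    (hk : ∀ i, σ₁ i y ∈ singularSystem e k y) :
    2 * k y * a y = p y ^ 2 ∧ 2 * k y * b y = p y * m y ∧ 2 * k y * c y = m y ^ 2 := by
  have hcase : ∀ z ∈ U, (¬∀ i, σ₁ i z ∈ singularSystem e (-k) z) →
      (∀ i, σ₁ i z ∈ singularSystem e k z) ∧ ∀ i, σ₂ i z ∈ singularSystem e (-k) z := by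
    intro z hz hn
    have c₁ := h.singular_cases (hUO hz) hd hz
    have c₂ := (h.neg.singular_cases (hUO hz) hd hz).1.resolve_left hn
    exact ⟨c₁.1.resolve_right fun hh => c₁.2.2 ⟨hh, c₂⟩, c₂⟩
  have hny : ¬∀ i, σ₁ i y ∈ singularSystem e (-k) y := fun hh =>
    (h.singular_cases (hUO hyU) hd hyU).2.1 ⟨hk, hh⟩
  -- Which family belongs to `k` is so far decided only pointwise, whereas derived systems need a
  -- neighbourhood. Not lying in the system of `-k` is an open condition, and by `hcase` it forces
  -- the assignment of both families.
  have hev : ∀ᶠ z in nhds y, ¬∀ i, σ₁ i z ∈ singularSystem e (-k) z := by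
    push Not at hny
    obtain ⟨i, hi⟩ := hny
    have hσ : ContinuousAt (σ₁ i) y :=
      ((hd.smooth_σ₁ i).continuousOn).continuousAt (hU.mem_nhds hyU)
    have he : ∀ j, ContinuousAt (e j) y := fun j =>
      ((h.smooth_frame j).continuousOn).continuousAt (h.isOpen.mem_nhds (hUO hyU))
    have hkc : ContinuousAt k y :=
      (h.smooth_k.continuousOn).continuousAt (h.isOpen.mem_nhds (hUO hyU))
    have hc : ∀ j, ContinuousAt (fun z => σ₁ i z (e j z)) y := fun j => hσ.clm_apply (he j)
    rw [mem_singularSystem, not_and_or] at hi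
    rcases hi with hi | hi
    · filter_upwards [((hc 6).sub (hkc.neg.mul (hc 5))).eventually_ne (sub_ne_zero.2 hi)] with
        z hz hcon
      exact hz (sub_eq_zero.2 (mem_singularSystem.1 (hcon i)).1)
    · filter_upwards [((hc 7).sub (hkc.neg.mul (hc 4)).neg).eventually_ne (sub_ne_zero.2 hi)]
        with z hz hcon
      exact hz (sub_eq_zero.2 (mem_singularSystem.1 (hcon i)).2)
  obtain ⟨U', hU'sub, hU', hyU'⟩ := mem_nhds_iff.1 hev
  have hτ : ∀ z ∈ U, spanForms τ z ≤ singularSystem e k z ∧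
      spanForms τ z ≤ singularSystem e (-k) z := by
    intro z hz
    rw [hd.degree_one z hz]
    exact ⟨h.firstFour_le_singularSystem (hUO hz), h.neg.firstFour_le_singularSystem (hUO hz)⟩
  obtain ⟨r₁, r₂, r₃, r₄, r₅, r₆, hrel⟩ := h.derivedFlag_three (hU.inter hU')
    (fun z hz => hUO hz.1) (V := fun x => spanForms τ x ⊔ spanForms σ₁ x)
    (fun z hz => sup_le (hτ z hz.1).1 (spanForms_le_iff.2 (hcase z hz.1 (hU'sub hz.2)).1))
    ⟨hyU, hyU'⟩
  have hV₁ : spanForms τ y ⊔ spanForms σ₁ y ≤ singularSystem e k y :=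
    sup_le (hτ y hyU).1 (spanForms_le_iff.2 (hcase y hyU hny).1)
  have hV₂ : spanForms τ y ⊔ spanForms σ₂ y ≤ singularSystem e (-k) y :=
    sup_le (hτ y hyU).2 (spanForms_le_iff.2 (hcase y hyU hny).2)
  have htop := hp.sup_right y hyU
  have hkne := h.k_ne_zero y (hUO hyU)
  -- Each coframe element is split along `V_{-k} + V_k^∞ = T*`.
  have hget : ∀ j : Fin 8, ∃ v ∈ singularSystem e (-k) y, ∃ f ∈ singularSystem e k y,
      f ∈ derivedFlag (fun x => spanForms τ x ⊔ spanForms σ₁ x) 3 y ∧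
      ∀ i, v (e i y) + f (e i y) = χ j y (e i y) := by
    intro j
    have : χ j y ∈ (⊤ : Submodule 𝕜 (Covector 𝕜 E)) := Submodule.mem_top
    rw [← htop] at this
    obtain ⟨v, hv, f, hf, hvf⟩ := Submodule.mem_sup.1 this
    exact ⟨v, hV₂ hv, f, hV₁ (derivedLimit_le _ 0 y hf), derivedLimit_le _ 3 y hf,
      fun i => by rw [← hvf]; rfl⟩
  obtain ⟨v, hv, f, hf, hf₃, hvf⟩ := hget 4
  obtain ⟨w, hw, g, hg, hg₃, hwg⟩ := hget 5
  rw [mem_singularSystem] at hv hf hw hg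
  simp only [Pi.neg_apply] at hv hw
  have a4 := hvf 4
  have a5 := hvf 5
  have a6 := hvf 6
  have a7 := hvf 7
  have b4 := hwg 4
  have b5 := hwg 5
  have b6 := hwg 6
  have b7 := hwg 7
  have hyO := hUO hyU
  rw [h.apply_self y hyO] at a4 b5
  rw [h.apply_ne y hyO _ _ (by decide)] at a5 a6 a7 b4 b6 b7
  -- On `V_k` the components along `e 6`, `e 7` are tied to those along `e 5`, `e 4` by `k`, on
  -- `V_{-k}` by `-k`. Hence the part of `χ 4` in `V_k` is half of `χ 4 - k χ 7`, up to elements of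
  -- the system, and that of `χ 5` is half of `χ 5 + k χ 6`.
  have f5 : f (e 5 y) = 0 :=
    mul_left_cancel₀ hkne (by linear_combination (a6 - hv.1 - hf.1 + k y * a5) / 2)
  have f4 : f (e 4 y) = 1 / 2 :=
    mul_left_cancel₀ hkne (by linear_combination (-a7 + hv.2 + hf.2 + k y * a4) / 2)
  have g5 : g (e 5 y) = 1 / 2 :=
    mul_left_cancel₀ hkne (by linear_combination (b6 - hw.1 - hg.1 + k y * b5) / 2)
  have g4 : g (e 4 y) = 0 :=
    mul_left_cancel₀ hkne (by linear_combination (-b7 + hw.2 + hg.2 + k y * b4) / 2)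
  have hF := hrel f hf₃
  have hG := hrel g hg₃
  rw [f4, f5] at hF
  rw [g4, g5] at hG
  obtain ⟨⟨hF₁, hF₂⟩, ⟨hF₃, hF₄⟩, hF₅, hF₆⟩ := hF
  obtain ⟨⟨hG₁, hG₂⟩, ⟨hG₃, hG₄⟩, hG₅, hG₆⟩ := hG
  -- The components of the two elements along `e 3` are not known; they are eliminated by the
  -- algebra, together with the derivatives of `b` in `r₂` and `r₅`.
  refine eq_of_rank_conditions (f := f (e 3 y)) (g := g (e 3 y)) (r₂ := r₂) (r₅ := r₅) hkne
    ?_ ?_ ?_ ?_ ?_ ?_ ?_ ?_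
  · linear_combination hF₁
  · linear_combination 2 * hF₂
  · linear_combination 2 * hG₁
  · linear_combination hG₂
  · linear_combination 2 * hG₃
  · linear_combination 2 * hF₄
  · linear_combination 2 * hG₅
  · linear_combination 2 * hF₆

/-- At the given point the first family belongs to `k` or to `-k`. In the second case the symmetry
`neg` applies, and the equations are invariant under it. -/
theorem relations_of_isDarbouxIntegrable (h : IsSingularCoframe O e χ k p m a b c α₁ α₂)
    (hD : IsDarbouxIntegrable O (firstFour χ)) {y : E} (hy : y ∈ O) :
    2 * k y * a y = p y ^ 2 ∧ 2 * k y * b y = p y * m y ∧ 2 * k y * c y = m y ^ 2 := by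
  obtain ⟨U, hU, hyU, hUO, r, n₁, n₂, s, t, τ, σ₁, σ₂, Ω₁, Ω₂, hd, -, -, hp⟩ := hD y hy
  obtain ⟨rfl, rfl⟩ := h.decomposition_ranks hy hd hyU
  have c₁ := h.singular_cases hy hd hyU
  have c₂ := h.neg.singular_cases hy hd hyU
  rcases c₁.1 with hk | hk
  · exact h.relations_of_decomposition hU hUO hyU hd hp hk
  · have hn : ∀ i, σ₁ i y ∈ singularSystem e (-k) y :=
      c₂.1.resolve_right fun hh => c₁.2.2 ⟨hk, hh⟩
    simpa using h.neg.relations_of_decomposition hU hUO hyU hd hp hn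

end IsSingularCoframe
end SingularCoframe

/-! ### Sufficiency: the decomposition, the integrable subsystem and the Darboux pair. -/

section SingularCoframe

variable {𝕜 : Type*} [RCLike 𝕜] {E : Type*} [NormedAddCommGroup E] [NormedSpace ℝ E]

theorem ContDiffOn.wedge {U : Set E} {φ ψ : E → Covector 𝕜 E} (hφ : ContDiffOn ℝ ∞ φ U)
    (hψ : ContDiffOn ℝ ∞ ψ U) : ContDiffOn ℝ ∞ (fun y => wedge (φ y) (ψ y)) U := by
  have key : ∀ φ ψ : E → Covector 𝕜 E, ContDiffOn ℝ ∞ φ U → ContDiffOn ℝ ∞ ψ U →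
      ContDiffOn ℝ ∞ (fun y => (φ y).smulRight (ψ y)) U := by
    intro φ ψ hφ hψ
    have h₁ : ContDiffOn ℝ ∞
        (fun y => (ContinuousLinearMap.lsmul ℝ 𝕜 (E := Covector 𝕜 E)).flip (ψ y)) U :=
      (ContinuousLinearMap.contDiff _).comp_contDiffOn hψ
    have h := h₁.clm_comp hφ
    refine h.congr fun y _ => ?_
    ext v w
    simp
  exact (key φ ψ hφ hψ).sub (key ψ φ hψ hφ)

/-- Modulo `V` all covectors are combinations of `s` and `t`, hence all 2-covectors are multiples of
`s ∧ t`. -/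
theorem wedge_mem_idealTwo_of_sup_eq_top {V : Submodule 𝕜 (Covector 𝕜 E)}
    {S : Set (Bicovector 𝕜 E)} {s t : Covector 𝕜 E} (hV : V ⊔ Submodule.span 𝕜 {s, t} = ⊤)
    (hst : wedge s t ∈ S) (α β : Covector 𝕜 E) : wedge α β ∈ idealTwo V S := by
  have hget : ∀ φ : Covector 𝕜 E, ∃ v ∈ V, ∃ x y : 𝕜, φ = v + (x • s + y • t) := by
    intro φ
    have : φ ∈ V ⊔ Submodule.span 𝕜 {s, t} := hV ▸ Submodule.mem_top
    obtain ⟨v, hv, w, hw, rfl⟩ := Submodule.mem_sup.1 this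
    obtain ⟨x, y, rfl⟩ := Submodule.mem_span_pair.1 hw
    exact ⟨v, hv, x, y, rfl⟩
  obtain ⟨v, hv, x, y, rfl⟩ := hget α
  obtain ⟨w, hw, z, u, rfl⟩ := hget β
  have : wedge (v + (x • s + y • t)) (w + (z • s + u • t)) =
      wedge v (w + (z • s + u • t)) + wedge (x • s + y • t) w + (x * u - y * z) • wedge s t := by
    ext a b
    simp only [wedge_apply, add_apply, smul_apply, smul_eq_mul]
    ring
  rw [this]
  exact Submodule.add_mem _ (Submodule.add_mem _ (wedge_mem_idealTwo hv _)
    (wedge_mem_idealTwo' hw _)) (Submodule.smul_mem _ _ (mem_idealTwo_of_mem hst))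

/-- The two forms that complement the embedding system in the singular system of `k`. -/
def singularForms (χ : Fin 8 → E → Covector 𝕜 E) (k : E → 𝕜) : Fin 2 → E → Covector 𝕜 E :=
  ![fun y => χ 4 y + (-k y) • χ 7 y, fun y => χ 5 y + k y • χ 6 y]

/-- The completely integrable subsystem of the singular system of `k`. -/
def integrableForms (χ : Fin 8 → E → Covector 𝕜 E) (k p m : E → 𝕜) : Fin 2 → E → Covector 𝕜 E :=
  ![fun y => k y • χ 4 y + (-(k y * k y)) • χ 7 y + p y • χ 3 y,
    fun y => k y • χ 5 y + (k y * k y) • χ 6 y + m y • χ 3 y]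

theorem singularForms_zero (χ : Fin 8 → E → Covector 𝕜 E) (k : E → 𝕜) (y : E) :
    singularForms χ k 0 y = χ 4 y + (-k y) • χ 7 y := rfl

theorem singularForms_one (χ : Fin 8 → E → Covector 𝕜 E) (k : E → 𝕜) (y : E) :
    singularForms χ k 1 y = χ 5 y + k y • χ 6 y := rfl

theorem integrableForms_zero (χ : Fin 8 → E → Covector 𝕜 E) (k p m : E → 𝕜) (y : E) :
    integrableForms χ k p m 0 y = k y • χ 4 y + (-(k y * k y)) • χ 7 y + p y • χ 3 y := rfl

theorem integrableForms_one (χ : Fin 8 → E → Covector 𝕜 E) (k p m : E → 𝕜) (y : E) :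
    integrableForms χ k p m 1 y = k y • χ 5 y + (k y * k y) • χ 6 y + m y • χ 3 y := rfl

namespace IsSingularCoframe

variable {O : Set E} {e : Fin 8 → E → E} {χ : Fin 8 → E → Covector 𝕜 E}
  {k p m a b c α₁ α₂ : E → 𝕜}

/-- By the structure equations the exterior derivative of every form is a combination of wedge
products. It is used for an ideal that contains all 2-covectors arising in this way. -/
theorem extD_mem_of_wedge_mem (h : IsSingularCoframe O e χ k p m a b c α₁ α₂) {y : E}
    (hy : y ∈ O) {S : Submodule 𝕜 (Bicovector 𝕜 E)} (hS : ∀ α β, wedge α β ∈ S)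
    {φ : E → Covector 𝕜 E} (hφ : DifferentiableAt ℝ φ y) : extD φ y ∈ S := by
  rw [h.extD_section hy hφ]
  refine Submodule.sum_mem _ fun i _ => Submodule.add_mem _ (hS _ _) (Submodule.smul_mem _ _ ?_)
  fin_cases i
  · change extD (χ 0) y ∈ S
    rw [h.d_zero y hy]
    exact Submodule.smul_mem _ _ (Submodule.add_mem _ (hS _ _) (hS _ _))
  · change extD (χ 1) y ∈ S
    rw [h.d_one y hy]
    exact Submodule.smul_mem _ _ (Submodule.add_mem _ (Submodule.add_mem _ (Submodule.add_mem _
      (hS _ _) (hS _ _)) (hS _ _)) (hS _ _))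
  · change extD (χ 2) y ∈ S
    rw [h.d_two y hy]
    exact Submodule.add_mem _ (Submodule.add_mem _ (Submodule.add_mem _
      (hS _ _) (hS _ _)) (hS _ _)) (hS _ _)
  · change extD (χ 3) y ∈ S
    rw [h.d_three y hy]
    exact Submodule.smul_mem _ _ (Submodule.add_mem _ (hS _ _) (Submodule.smul_mem _ _ (hS _ _)))
  · change extD (χ 4) y ∈ S
    rw [h.d_four y hy]
    exact hS _ _
  · change extD (χ 5) y ∈ S
    rw [h.d_five y hy]
    exact hS _ _
  · change extD (χ 6) y ∈ S
    rw [h.d_six y hy]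
    exact Submodule.smul_mem _ _ (hS _ _)
  · change extD (χ 7) y ∈ S
    rw [h.d_seven y hy]
    exact Submodule.smul_mem _ _ (hS _ _)

theorem smooth_singularForms (h : IsSingularCoframe O e χ k p m a b c α₁ α₂) (i : Fin 2) :
    ContDiffOn ℝ ∞ (singularForms χ k i) O := by
  fin_cases i
  · exact (h.smooth_coframe 4).add (h.smooth_k.neg.smul (h.smooth_coframe 7))
  · exact (h.smooth_coframe 5).add (h.smooth_k.smul (h.smooth_coframe 6))

theorem smooth_integrableForms (h : IsSingularCoframe O e χ k p m a b c α₁ α₂) (i : Fin 2) :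
    ContDiffOn ℝ ∞ (integrableForms χ k p m i) O := by
  fin_cases i
  · exact ((h.smooth_k.smul (h.smooth_coframe 4)).add
      ((h.smooth_k.mul h.smooth_k).neg.smul (h.smooth_coframe 7))).add
        (h.smooth_p.smul (h.smooth_coframe 3))
  · exact ((h.smooth_k.smul (h.smooth_coframe 5)).add
      ((h.smooth_k.mul h.smooth_k).smul (h.smooth_coframe 6))).add
        (h.smooth_m.smul (h.smooth_coframe 3))

/-- The forms are `k` times the singular forms, corrected by multiples of `χ 3`. The curvature
equations turn the coefficients of `dp` and `dm` into polynomials in `k`, `p`, `m` and the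
connection, after which the Frobenius condition can be checked explicitly. -/
theorem extD_integrableForms (h : IsSingularCoframe O e χ k p m a b c α₁ α₂)
    (hrel : ∀ y ∈ O, 2 * k y * a y = p y ^ 2 ∧ 2 * k y * b y = p y * m y ∧
      2 * k y * c y = m y ^ 2) {y : E} (hy : y ∈ O) (i : Fin 2) :
    extD (integrableForms χ k p m i) y ∈ idealTwo (spanForms (integrableForms χ k p m) y) ∅ := by
  have hk := h.hasFDerivAt_k y hy
  have hkk : HasFDerivAt (fun z => k z * k z) _ y := hk.mul hk
  have hkk' : HasFDerivAt (fun z => -(k z * k z)) _ y := hkk.neg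
  have hp := h.hasFDerivAt_p y hy
  have hm := h.hasFDerivAt_m y hy
  have hkne := h.k_ne_zero y hy
  have hd := h.differentiableAt_coframe hy
  have ha : a y = p y ^ 2 / (2 * k y) := by
    rw [eq_div_iff (by simpa using hkne)]; linear_combination (hrel y hy).1
  have hb : b y = p y * m y / (2 * k y) := by
    rw [eq_div_iff (by simpa using hkne)]; linear_combination (hrel y hy).2.1
  have hc : c y = m y ^ 2 / (2 * k y) := by
    rw [eq_div_iff (by simpa using hkne)]; linear_combination (hrel y hy).2.2
  have hmem := mem_spanForms (integrableForms χ k p m) y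
  fin_cases i
  · change extD (fun y => k y • χ 4 y + (-(k y * k y)) • χ 7 y + p y • χ 3 y) y ∈ _
    -- In the first factor, `p χ 6 + m χ 7` is `dk / k` and the next terms are the connection forms
    -- in `dχ 4`. The terms with `k` in the denominator compensate for `(p / 2) χ 4 ∧ χ 5`, which
    -- comes from `p dχ 3`, and for the products with `χ 3` that this introduces.
    have : extD (fun y => k y • χ 4 y + (-(k y * k y)) • χ 7 y + p y • χ 3 y) y =
        wedge (p y • χ 6 y + m y • χ 7 y + χ 3 y + α₁ y • χ 6 y + α₂ y • χ 7 y +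
          (-(p y / (2 * k y))) • χ 5 y) (integrableForms χ k p m 0 y) +
        wedge ((p y / 2) • χ 7 y + (-(p y ^ 2 / (2 * k y ^ 2))) • χ 3 y)
          (integrableForms χ k p m 1 y) := by
      rw [extD_add, extD_add, extD_smul hk (hd 4), extD_smul hkk' (hd 7), extD_smul hp (hd 3),
        h.d_four y hy, h.d_seven y hy, h.d_three y hy, ha, hb]
      · ext v w
        simp only [integrableForms_zero, integrableForms_one, wedge_apply, add_apply,
          smul_apply, neg_apply,
          smul_eq_mul]
        field_simp
        ring
      · exact hk.differentiableAt.smul (hd 4)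
      · exact hkk'.differentiableAt.smul (hd 7)
      · exact (hk.differentiableAt.smul (hd 4)).add (hkk'.differentiableAt.smul (hd 7))
      · exact hp.differentiableAt.smul (hd 3)
    rw [this]
    exact Submodule.add_mem _ (wedge_mem_idealTwo' (hmem 0) _) (wedge_mem_idealTwo' (hmem 1) _)
  · change extD (fun y => k y • χ 5 y + (k y * k y) • χ 6 y + m y • χ 3 y) y ∈ _
    have : extD (fun y => k y • χ 5 y + (k y * k y) • χ 6 y + m y • χ 3 y) y =
        wedge (p y • χ 6 y + m y • χ 7 y + -(χ 3 y + α₁ y • χ 6 y + α₂ y • χ 7 y) +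
          (m y / (2 * k y)) • χ 4 y) (integrableForms χ k p m 1 y) +
        wedge ((m y / 2) • χ 6 y + (m y ^ 2 / (2 * k y ^ 2)) • χ 3 y)
          (integrableForms χ k p m 0 y) := by
      rw [extD_add, extD_add, extD_smul hk (hd 5), extD_smul hkk (hd 6), extD_smul hm (hd 3),
        h.d_five y hy, h.d_six y hy, h.d_three y hy, hc, hb]
      · ext v w
        simp only [integrableForms_zero, integrableForms_one, wedge_apply, add_apply,
          smul_apply, neg_apply,
          smul_eq_mul]
        field_simp
        ring
      · exact hk.differentiableAt.smul (hd 5)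
      · exact hkk.differentiableAt.smul (hd 6)
      · exact (hk.differentiableAt.smul (hd 5)).add (hkk.differentiableAt.smul (hd 6))
      · exact hm.differentiableAt.smul (hd 3)
    rw [this]
    exact Submodule.add_mem _ (wedge_mem_idealTwo' (hmem 1) _) (wedge_mem_idealTwo' (hmem 0) _)

/-- Half the sums of the singular forms of `k` and `-k` are `χ 4` and `χ 5`; their differences,
divided by `±2k`, are `χ 7` and `χ 6`. -/
theorem eq_top_of_mem (h : IsSingularCoframe O e χ k p m a b c α₁ α₂) {y : E} (hy : y ∈ O)
    {S : Submodule 𝕜 (Covector 𝕜 E)} (h₀ : spanForms (firstFour χ) y ≤ S)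
    (h₁ : ∀ i, singularForms χ k i y ∈ S) (h₂ : ∀ i, singularForms χ (-k) i y ∈ S) : S = ⊤ := by
  have hkne := h.k_ne_zero y hy
  obtain ⟨m₀, m₁, m₂, m₃⟩ := spanForms_firstFour_le_iff.1 h₀
  have e₄ : χ 4 y = (1 / 2 : 𝕜) • (singularForms χ k 0 y + singularForms χ (-k) 0 y) := by
    ext v
    simp only [singularForms_zero, add_apply, smul_apply, smul_eq_mul,
      Pi.neg_apply]
    ring
  have e₅ : χ 5 y = (1 / 2 : 𝕜) • (singularForms χ k 1 y + singularForms χ (-k) 1 y) := by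
    ext v
    simp only [singularForms_one, add_apply, smul_apply, smul_eq_mul,
      Pi.neg_apply]
    ring
  have e₆ : χ 6 y = (1 / (2 * k y)) • (singularForms χ k 1 y - singularForms χ (-k) 1 y) := by
    ext v
    simp only [singularForms_one, add_apply, smul_apply, smul_eq_mul,
      Pi.neg_apply, sub_apply]
    field_simp
    ring
  have e₇ : χ 7 y = (1 / (2 * k y)) • (singularForms χ (-k) 0 y - singularForms χ k 0 y) := by
    ext v
    simp only [singularForms_zero, add_apply, smul_apply, smul_eq_mul,
      Pi.neg_apply, sub_apply]
    field_simp
    ring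
  refine top_le_iff.1 ?_
  rw [← h.span_eq_top hy, spanForms_le_iff]
  intro i
  fin_cases i
  · exact m₀
  · exact m₁
  · exact m₂
  · exact m₃
  · change χ 4 y ∈ S
    rw [e₄]
    exact Submodule.smul_mem _ _ (add_mem (h₁ 0) (h₂ 0))
  · change χ 5 y ∈ S
    rw [e₅]
    exact Submodule.smul_mem _ _ (add_mem (h₁ 1) (h₂ 1))
  · change χ 6 y ∈ S
    rw [e₆]
    exact Submodule.smul_mem _ _ (sub_mem (h₁ 1) (h₂ 1))
  · change χ 7 y ∈ S
    rw [e₇]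
    exact Submodule.smul_mem _ _ (sub_mem (h₂ 0) (h₁ 0))

/-- The Gauss equation and the symmetry of the second fundamental form combine, with weights `2` and
`-2k`, into a perfect product; the last summand is in the ideal of `χ 1` and `χ 2`. -/
theorem wedge_singularForms (h : IsSingularCoframe O e χ k p m a b c α₁ α₂) {y : E}
    (hy : y ∈ O) : wedge (singularForms χ k 0 y) (singularForms χ k 1 y) =
      (2 : 𝕜) • extD (χ 3) y + (-2 * k y) • extD (χ 0) y +
        (-k y) • (wedge (χ 4 y) (χ 1 y) + wedge (χ 5 y) (χ 2 y)) := by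
  rw [h.d_three y hy, h.d_zero y hy]
  ext v w
  simp only [singularForms_zero, singularForms_one, wedge_apply, add_apply, smul_apply, smul_eq_mul]
  ring

theorem singularForms_mem (h : IsSingularCoframe O e χ k p m a b c α₁ α₂) {y : E}
    (hy : y ∈ O) (i : Fin 2) : singularForms χ k i y ∈ singularSystem e k y := by
  fin_cases i <;>
  simp [mem_singularSystem, singularForms, h.apply_ne y hy, h.apply_self y hy]

/-- The degree two part of the ideal of the embedding system. -/
theorem idealTwo_firstFour (h : IsSingularCoframe O e χ k p m a b c α₁ α₂) {y : E} (hy : y ∈ O) :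
    idealTwo (spanForms (firstFour χ) y)
      ({wedge (singularForms χ k 0 y) (singularForms χ k 1 y)} ∪
        {wedge (singularForms χ (-k) 0 y) (singularForms χ (-k) 1 y)}) =
      idealTwo (spanForms (firstFour χ) y) (Set.range fun i => extD (firstFour χ i) y) := by
  have hkne := h.k_ne_zero y hy
  obtain ⟨m₀, m₁, m₂, m₃⟩ :=
    spanForms_firstFour_le_iff.1 (le_refl (spanForms (firstFour χ) y))
  have hs := h.wedge_singularForms hy
  have hs' := h.neg.wedge_singularForms hy
  refine le_antisymm (idealTwo_le (fun α hα β => wedge_mem_idealTwo hα β) ?_)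
    (idealTwo_le (fun α hα β => wedge_mem_idealTwo hα β) ?_)
  · have d₀ : extD (χ 0) y ∈ idealTwo (spanForms (firstFour χ) y)
        (Set.range fun i => extD (firstFour χ i) y) := mem_idealTwo_of_mem ⟨0, rfl⟩
    have d₃ : extD (χ 3) y ∈ idealTwo (spanForms (firstFour χ) y)
        (Set.range fun i => extD (firstFour χ i) y) := mem_idealTwo_of_mem ⟨3, rfl⟩
    have hgen : ∀ u v w : 𝕜, u • extD (χ 3) y + v • extD (χ 0) y +
        w • (wedge (χ 4 y) (χ 1 y) + wedge (χ 5 y) (χ 2 y)) ∈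
        idealTwo (spanForms (firstFour χ) y) (Set.range fun i => extD (firstFour χ i) y) :=
      fun u v w => Submodule.add_mem _ (Submodule.add_mem _ (Submodule.smul_mem _ _ d₃)
        (Submodule.smul_mem _ _ d₀)) (Submodule.smul_mem _ _ (Submodule.add_mem _
          (wedge_mem_idealTwo' m₁ _) (wedge_mem_idealTwo' m₂ _)))
    rintro _ (rfl | rfl)
    · rw [hs]; exact hgen _ _ _
    · rw [hs']; exact hgen _ _ _
  · set I := idealTwo (spanForms (firstFour χ) y)
      ({wedge (singularForms χ k 0 y) (singularForms χ k 1 y)} ∪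
        {wedge (singularForms χ (-k) 0 y) (singularForms χ (-k) 1 y)})
    have i₁ : wedge (singularForms χ k 0 y) (singularForms χ k 1 y) ∈ I :=
      mem_idealTwo_of_mem (Or.inl rfl)
    have i₂ : wedge (singularForms χ (-k) 0 y) (singularForms χ (-k) 1 y) ∈ I :=
      mem_idealTwo_of_mem (Or.inr rfl)
    rintro _ ⟨i, rfl⟩
    fin_cases i
    · change extD (χ 0) y ∈ I
      -- The two product identities, for `k` and `-k`, are solved for `dχ 0` by subtraction and
      -- below for `dχ 3` by addition; `dχ 1` and `dχ 2` are already in the ideal of the 1-forms.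
      have : extD (χ 0) y =
          (-(1 / (4 * k y))) • wedge (singularForms χ k 0 y) (singularForms χ k 1 y) +
          (1 / (4 * k y)) • wedge (singularForms χ (-k) 0 y) (singularForms χ (-k) 1 y) +
          (-(1 / 2) : 𝕜) • (wedge (χ 4 y) (χ 1 y) + wedge (χ 5 y) (χ 2 y)) := by
        rw [hs, hs']
        ext v w
        simp only [add_apply, smul_apply, smul_eq_mul, Pi.neg_apply]
        field_simp
        ring
      rw [this]
      exact Submodule.add_mem _ (Submodule.add_mem _ (Submodule.smul_mem _ _ i₁)
        (Submodule.smul_mem _ _ i₂)) (Submodule.smul_mem _ _ (Submodule.add_mem _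
          (wedge_mem_idealTwo' m₁ _) (wedge_mem_idealTwo' m₂ _)))
    · change extD (χ 1) y ∈ I
      rw [h.d_one y hy]
      exact Submodule.smul_mem _ _ (Submodule.add_mem _ (Submodule.add_mem _ (Submodule.add_mem _
        (wedge_mem_idealTwo m₃ _) (wedge_mem_idealTwo' m₁ _)) (wedge_mem_idealTwo m₃ _))
        (wedge_mem_idealTwo' m₀ _))
    · change extD (χ 2) y ∈ I
      rw [h.d_two y hy]
      exact Submodule.add_mem _ (Submodule.add_mem _ (Submodule.add_mem _
        (wedge_mem_idealTwo m₃ _) (wedge_mem_idealTwo' m₂ _)) (wedge_mem_idealTwo m₃ _))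
        (wedge_mem_idealTwo m₀ _)
    · change extD (χ 3) y ∈ I
      have : extD (χ 3) y =
          (1 / 4 : 𝕜) • wedge (singularForms χ k 0 y) (singularForms χ k 1 y) +
          (1 / 4 : 𝕜) • wedge (singularForms χ (-k) 0 y) (singularForms χ (-k) 1 y) := by
        rw [hs, hs']
        ext v w
        simp only [add_apply, smul_apply, smul_eq_mul, Pi.neg_apply]
        ring
      rw [this]
      exact Submodule.add_mem _ (Submodule.smul_mem _ _ i₁) (Submodule.smul_mem _ _ i₂)

theorem sup_span_singularForms (h : IsSingularCoframe O e χ k p m a b c α₁ α₂) {y : E}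
    (hy : y ∈ O) : spanForms (firstFour χ) y ⊔ spanForms (singularForms χ k) y ⊔
      spanForms (singularForms χ (-k)) y = ⊤ :=
  h.eq_top_of_mem hy (le_sup_left.trans le_sup_left)
    (fun i => Submodule.mem_sup_left (Submodule.mem_sup_right (mem_spanForms _ y i)))
    (fun i => Submodule.mem_sup_right (mem_spanForms _ y i))

theorem independent_singularForms (h : IsSingularCoframe O e χ k p m a b c α₁ α₂) {y : E}
    (hy : y ∈ O) : LinearIndependent 𝕜 (Sum.elim (fun i => firstFour χ i y)
      (Sum.elim (fun i => singularForms χ k i y) (fun i => singularForms χ (-k) i y))) := by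
  have hkne := h.k_ne_zero y hy
  refine Fintype.linearIndependent_iff.2 fun g hg => ?_
  simp only [Fintype.sum_sum_type, Sum.elim_inl, Sum.elim_inr, Fin.sum_univ_two,
    Fin.sum_univ_four] at hg
  have ev : ∀ j : Fin 8, _ := fun j => congrArg (fun φ : Covector 𝕜 E => φ (e j y)) hg
  have f0 : firstFour χ 0 = χ 0 := rfl
  have f1 : firstFour χ 1 = χ 1 := rfl
  have f2 : firstFour χ 2 = χ 2 := rfl
  have f3 : firstFour χ 3 = χ 3 := rfl
  have v0 := ev 0
  have v1 := ev 1
  have v2 := ev 2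
  have v3 := ev 3
  have v4 := ev 4
  have v5 := ev 5
  have v6 := ev 6
  have v7 := ev 7
  simp [f0, f1, f2, f3, singularForms, h.apply_ne y hy, h.apply_self y hy]
    at v0 v1 v2 v3 v4 v5 v6 v7
  have w0 : g (Sum.inr (Sum.inl 0)) = 0 :=
    -- The components along `e 4` and `e 7` give the sum of two coefficients and `k` times their
    -- difference; those along `e 5` and `e 6` do the same for the other two.
    mul_left_cancel₀ hkne (by linear_combination (k y * v4 - v7) / 2)
  have w0' : g (Sum.inr (Sum.inr 0)) = 0 := by linear_combination v4 - w0
  have w1 : g (Sum.inr (Sum.inl 1)) = 0 :=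
    mul_left_cancel₀ hkne (by linear_combination (k y * v5 + v6) / 2)
  have w1' : g (Sum.inr (Sum.inr 1)) = 0 := by linear_combination v5 - w1
  rintro (i | i | i)
  · fin_cases i
    · exact v0
    · exact v1
    · exact v2
    · exact v3
  · fin_cases i
    · exact w0
    · exact w1
  · fin_cases i
    · exact w0'
    · exact w1'

theorem integrableForms_mem (χ : Fin 8 → E → Covector 𝕜 E) (k p m : E → 𝕜) (y : E) (i : Fin 2) :
    integrableForms χ k p m i y ∈
      spanForms (firstFour χ) y ⊔ spanForms (singularForms χ k) y := by
  have m₃ := (spanForms_firstFour_le_iff.1 (le_refl (spanForms (firstFour χ) y))).2.2.2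
  have hs := mem_spanForms (singularForms χ k) y
  fin_cases i
  · have : integrableForms χ k p m 0 y = p y • χ 3 y + k y • singularForms χ k 0 y := by
      ext v
      simp only [integrableForms_zero, singularForms_zero, add_apply, smul_apply, smul_eq_mul]
      ring
    change integrableForms χ k p m 0 y ∈ _
    rw [this]
    exact Submodule.add_mem_sup (Submodule.smul_mem _ _ m₃) (Submodule.smul_mem _ _ (hs 0))
  · have : integrableForms χ k p m 1 y = m y • χ 3 y + k y • singularForms χ k 1 y := by
      ext v
      simp only [integrableForms_one, singularForms_one, add_apply, smul_apply, smul_eq_mul]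
      ring
    change integrableForms χ k p m 1 y ∈ _
    rw [this]
    exact Submodule.add_mem_sup (Submodule.smul_mem _ _ m₃) (Submodule.smul_mem _ _ (hs 1))

/-- The integrable forms lie in the limit of the derived flag of `V_k`, and modulo `χ 3`, which
belongs to `V_{-k}`, they are `k` times the singular forms of `k`. -/
theorem sup_derivedLimit (h : IsSingularCoframe O e χ k p m a b c α₁ α₂)
    (hrel : ∀ y ∈ O, 2 * k y * a y = p y ^ 2 ∧ 2 * k y * b y = p y * m y ∧
      2 * k y * c y = m y ^ 2) {y : E} (hy : y ∈ O) :
    spanForms (firstFour χ) y ⊔ spanForms (singularForms χ (-k)) y ⊔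
      derivedLimit (fun x => spanForms (firstFour χ) x ⊔
        spanForms (singularForms χ k) x) y = ⊤ := by
  have hkne := h.k_ne_zero y hy
  have hlim := mem_derivedLimit_of_integrable
    (V := fun x => spanForms (firstFour χ) x ⊔ spanForms (singularForms χ k) x) h.isOpen
    h.smooth_integrableForms (fun z _ i => integrableForms_mem χ k p m z i)
    (fun z hz i => h.extD_integrableForms hrel hz i) hy
  have m₃ := (spanForms_firstFour_le_iff.1 (le_refl (spanForms (firstFour χ) y))).2.2.2
  refine h.eq_top_of_mem hy (le_sup_left.trans le_sup_left) (fun i => ?_) fun i =>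
    Submodule.mem_sup_left (Submodule.mem_sup_right (mem_spanForms _ y i))
  fin_cases i
  · have : singularForms χ k 0 y =
        (-(p y / k y)) • χ 3 y + (1 / k y) • integrableForms χ k p m 0 y := by
      ext v
      simp only [integrableForms_zero, singularForms_zero, add_apply, smul_apply, smul_eq_mul]
      field_simp
      ring
    change singularForms χ k 0 y ∈ _
    rw [this]
    exact Submodule.add_mem_sup (Submodule.smul_mem _ _ (Submodule.mem_sup_left m₃))
      (Submodule.smul_mem _ _ (hlim 0))
  · have : singularForms χ k 1 y =
        (-(m y / k y)) • χ 3 y + (1 / k y) • integrableForms χ k p m 1 y := by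
      ext v
      simp only [integrableForms_one, singularForms_one, add_apply, smul_apply, smul_eq_mul]
      field_simp
      ring
    change singularForms χ k 1 y ∈ _
    rw [this]
    exact Submodule.add_mem_sup (Submodule.smul_mem _ _ (Submodule.mem_sup_left m₃))
      (Submodule.smul_mem _ _ (hlim 1))

theorem sup_le_singularSystem (h : IsSingularCoframe O e χ k p m a b c α₁ α₂) {y : E}
    (hy : y ∈ O) :
    spanForms (firstFour χ) y ⊔ spanForms (singularForms χ k) y ≤ singularSystem e k y :=
  sup_le (h.firstFour_le_singularSystem hy) (spanForms_le_iff.2 (h.singularForms_mem hy))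

/-- A common element of `V_k` and `V_{-k}` has no components along `e 4, …, e 7`. The first derived
systems then give `φ (e 0) = ∓k φ (e 3)`, so both vanish, and the second derived system removes the
components along `e 1` and `e 2`. The curvature equations play no role. -/
theorem derivedLimit_inf_derivedLimit (h : IsSingularCoframe O e χ k p m a b c α₁ α₂) {y : E}
    (hy : y ∈ O) :
    derivedLimit (fun x => spanForms (firstFour χ) x ⊔ spanForms (singularForms χ k) x) y ⊓
      derivedLimit (fun x => spanForms (firstFour χ) x ⊔ spanForms (singularForms χ (-k)) x) y =
      ⊥ := by
  refine (Submodule.eq_bot_iff _).2 fun φ hφ => ?_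
  have hkne := h.k_ne_zero y hy
  have r₁ := h.derivedFlag_one h.isOpen subset_rfl
    (V := fun x => spanForms (firstFour χ) x ⊔ spanForms (singularForms χ k) x)
    (fun z hz => h.sup_le_singularSystem hz) hy (derivedLimit_le _ 1 y hφ.1)
  have r₂ := h.neg.derivedFlag_one h.isOpen subset_rfl
    (V := fun x => spanForms (firstFour χ) x ⊔ spanForms (singularForms χ (-k)) x)
    (fun z hz => h.neg.sup_le_singularSystem hz) hy (derivedLimit_le _ 1 y hφ.2)
  have r₃ := h.derivedFlag_two h.isOpen subset_rfl
    (V := fun x => spanForms (firstFour χ) x ⊔ spanForms (singularForms χ k) x)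
    (fun z hz => h.sup_le_singularSystem hz) hy (derivedLimit_le _ 2 y hφ.1)
  have s₁ := mem_singularSystem.1 (h.sup_le_singularSystem hy (derivedLimit_le _ 0 y hφ.1))
  have s₂ := mem_singularSystem.1 (h.neg.sup_le_singularSystem hy (derivedLimit_le _ 0 y hφ.2))
  simp only [Pi.neg_apply] at s₂ r₂
  have z₅ : φ (e 5 y) = 0 := mul_left_cancel₀ hkne (by linear_combination (s₂.1 - s₁.1) / 2)
  have z₄ : φ (e 4 y) = 0 := mul_left_cancel₀ hkne (by linear_combination (s₁.2 - s₂.2) / 2)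
  have z₆ : φ (e 6 y) = 0 := by rw [s₁.1, z₅, mul_zero]
  have z₇ : φ (e 7 y) = 0 := by rw [s₁.2, z₄, mul_zero, neg_zero]
  have z₃ : φ (e 3 y) = 0 := mul_left_cancel₀ hkne (by linear_combination (r₁ - r₂) / 2)
  have z₀ : φ (e 0 y) = 0 := by rw [r₁, z₃, z₄, z₅]; ring
  have z₁ : φ (e 1 y) = 0 := by rw [r₃.1, z₃, z₄, z₅]; ring
  have z₂ : φ (e 2 y) = 0 := by rw [r₃.2, z₃, z₄, z₅]; ring
  rw [h.expand y hy φ, Fin.sum_univ_eight, z₀, z₁, z₂, z₃, z₄, z₅, z₆, z₇]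
  ext v
  simp

/-- A section of `V_k ∩ V_{-k}` is a section of the embedding system, so its derivative lies in the
degree two part of the ideal, generated by `θ` and the two decomposable forms. The products of `θ`
with arbitrary covectors split because `V_k` and `V_{-k}` together span. -/
theorem extD_mem_extSquare (h : IsSingularCoframe O e χ k p m a b c α₁ α₂) {U : Set E}
    (hU : IsOpen U) (hUO : U ⊆ O) {φ : E → Covector 𝕜 E}
    (hφ : IsSection (fun x => (spanForms (firstFour χ) x ⊔ spanForms (singularForms χ k) x) ⊓
      (spanForms (firstFour χ) x ⊔ spanForms (singularForms χ (-k)) x)) U φ) {x : E}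
    (hx : x ∈ U) :
    extD φ x ∈ extSquare (spanForms (firstFour χ) x ⊔ spanForms (singularForms χ k) x) ⊔
      extSquare (spanForms (firstFour χ) x ⊔ spanForms (singularForms χ (-k)) x) := by
  have hxO := hUO hx
  obtain ⟨m₀, m₁, m₂, m₃⟩ :=
    spanForms_firstFour_le_iff.1 (le_refl (spanForms (firstFour χ) x))
  have hφd : DifferentiableAt ℝ φ x :=
    (hφ.1.contDiffAt (hU.mem_nhds hx)).differentiableAt (by simp)
  have hzero : ∀ z ∈ U, φ z (e 4 z) = 0 ∧ φ z (e 5 z) = 0 ∧ φ z (e 6 z) = 0 ∧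
      φ z (e 7 z) = 0 := by
    intro z hz
    have hzO := hUO hz
    have hm := h.mem_firstFour_of_mem_inf hzO (h.sup_le_singularSystem hzO (hφ.2 z hz).1)
      (h.neg.sup_le_singularSystem hzO (hφ.2 z hz).2)
    have hker : ∀ j : Fin 8, 4 ≤ j → φ z (e j z) = 0 := by
      intro j hj
      have hle : spanForms (firstFour χ) z ≤
          LinearMap.ker (framePair (fun j => e j z) (Pi.single j 1)) := by
        rw [spanForms_firstFour_le_iff]
        simp only [LinearMap.mem_ker, h.pair_coframe hzO]
        refine ⟨?_, ?_, ?_, ?_⟩ <;> exact Pi.single_eq_of_ne (by rintro rfl; revert hj; decide) _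
      have := LinearMap.mem_ker.1 (hle hm)
      simpa [framePair_apply, Pi.single_apply] using this
    exact ⟨hker 4 (by decide), hker 5 (by decide), hker 6 (by decide), hker 7 (by decide)⟩
  have hfd : ∀ j : Fin 8, (∀ z ∈ U, φ z (e j z) = 0) →
      fderiv ℝ (fun z => φ z (e j z)) x = 0 := by
    intro j hj
    have : (fun z => φ z (e j z)) =ᶠ[nhds x] fun _ => 0 :=
      Filter.eventually_of_mem (hU.mem_nhds hx) hj
    rw [this.fderiv_eq]
    simp
  have hterm : ∀ i : Fin 8, wedge (fderiv ℝ (fun z => φ z (e i z)) x) (χ i x) +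
      φ x (e i x) • extD (χ i) x ∈
      idealTwo (spanForms (firstFour χ) x) (Set.range fun i => extD (firstFour χ i) x) := by
    have low : ∀ i : Fin 4, wedge (fderiv ℝ (fun z => φ z (e (Fin.castLE (by norm_num) i) z)) x)
        (firstFour χ i x) + φ x (e (Fin.castLE (by norm_num) i) x) • extD (firstFour χ i) x ∈
        idealTwo (spanForms (firstFour χ) x) (Set.range fun i => extD (firstFour χ i) x) :=
      fun i => Submodule.add_mem _ (wedge_mem_idealTwo' (mem_spanForms _ x i) _)
        (Submodule.smul_mem _ _ (mem_idealTwo_of_mem ⟨i, rfl⟩))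
    have high : ∀ j : Fin 8, (∀ z ∈ U, φ z (e j z) = 0) →
        wedge (fderiv ℝ (fun z => φ z (e j z)) x) (χ j x) + φ x (e j x) • extD (χ j) x ∈
        idealTwo (spanForms (firstFour χ) x) (Set.range fun i => extD (firstFour χ i) x) := by
      intro j hj
      have : wedge (fderiv ℝ (fun z => φ z (e j z)) x) (χ j x) + φ x (e j x) • extD (χ j) x =
          0 := by
        rw [hfd j hj, hj x hx]
        ext v w
        simp only [wedge_apply, add_apply, smul_apply, smul_eq_mul, zero_apply]
        ring
      rw [this]
      exact Submodule.zero_mem _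
    intro i
    fin_cases i
    · exact low 0
    · exact low 1
    · exact low 2
    · exact low 3
    · exact high 4 fun z hz => (hzero z hz).1
    · exact high 5 fun z hz => (hzero z hz).2.1
    · exact high 6 fun z hz => (hzero z hz).2.2.1
    · exact high 7 fun z hz => (hzero z hz).2.2.2
  rw [h.extD_section hxO hφd]
  have hmem : ∀ k' : E → 𝕜, wedge (singularForms χ k' 0 x) (singularForms χ k' 1 x) ∈
      extSquare (spanForms (firstFour χ) x ⊔ spanForms (singularForms χ k') x) := fun k' =>
    Submodule.subset_span ⟨_, Submodule.mem_sup_right (mem_spanForms _ x 0), _,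
      Submodule.mem_sup_right (mem_spanForms _ x 1), rfl⟩
  have hle : idealTwo (spanForms (firstFour χ) x)
      (Set.range fun i => extD (firstFour χ i) x) ≤
      extSquare (spanForms (firstFour χ) x ⊔ spanForms (singularForms χ k) x) ⊔
      extSquare (spanForms (firstFour χ) x ⊔ spanForms (singularForms χ (-k)) x) := by
    rw [← h.idealTwo_firstFour hxO]
    refine idealTwo_le (fun α hα β => ?_) ?_
    · have hβ : β ∈ spanForms (firstFour χ) x ⊔ spanForms (singularForms χ k) x ⊔
          spanForms (singularForms χ (-k)) x :=
        h.sup_span_singularForms hxO ▸ Submodule.mem_top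
      obtain ⟨β₁, h₁, β₂, h₂, rfl⟩ := Submodule.mem_sup.1 hβ
      rw [wedge_add_right]
      exact Submodule.add_mem_sup
        (Submodule.subset_span ⟨_, Submodule.mem_sup_left hα, _, h₁, rfl⟩)
        (Submodule.subset_span ⟨_, Submodule.mem_sup_left hα, _, Submodule.mem_sup_right h₂, rfl⟩)
    · rintro _ (rfl | rfl)
      · exact Submodule.mem_sup_left (hmem k)
      · exact Submodule.mem_sup_right (hmem (-k))
  exact Submodule.sum_mem _ fun i _ => hle (hterm i)

/-- The two singular forms of `-k` complement `V_k`, so their product generates all 2-covectors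
modulo `V_k`; conversely it is a combination of `dχ 3` and `dχ 0` modulo `θ`. -/
theorem isPfaffian (h : IsSingularCoframe O e χ k p m a b c α₁ α₂) :
    IsPfaffian O (firstFour χ) (singularForms χ k)
      (fun (_ : Fin 1) y => wedge (singularForms χ (-k) 0 y) (singularForms χ (-k) 1 y)) := by
  intro y hy
  obtain ⟨m₀, m₁, m₂, m₃⟩ := spanForms_firstFour_le_iff.1
    (le_sup_left (a := spanForms (firstFour χ) y) (b := spanForms (singularForms χ k) y))
  refine le_antisymm (idealTwo_le (fun α hα β => wedge_mem_idealTwo hα β) ?_)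
    (idealTwo_le (fun α hα β => wedge_mem_idealTwo hα β) ?_)
  · rintro _ ⟨-, rfl⟩
    simp only
    rw [h.neg.wedge_singularForms hy]
    exact Submodule.add_mem _ (Submodule.add_mem _
      (Submodule.smul_mem _ _ (mem_idealTwo_of_mem (Or.inl ⟨3, rfl⟩)))
      (Submodule.smul_mem _ _ (mem_idealTwo_of_mem (Or.inl ⟨0, rfl⟩))))
      (Submodule.smul_mem _ _ (Submodule.add_mem _ (wedge_mem_idealTwo' m₁ _)
        (wedge_mem_idealTwo' m₂ _)))
  · have hw := wedge_mem_idealTwo_of_sup_eq_top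
      (S := Set.range fun (_ : Fin 1) =>
        wedge (singularForms χ (-k) 0 y) (singularForms χ (-k) 1 y))
      (V := spanForms (firstFour χ) y ⊔ spanForms (singularForms χ k) y)
      (s := singularForms χ (-k) 0 y) (t := singularForms χ (-k) 1 y) (by
        rw [← top_le_iff, ← h.sup_span_singularForms hy]
        refine sup_le_sup_left (spanForms_le_iff.2 ?_) _
        rw [Fin.forall_fin_two]
        exact ⟨Submodule.subset_span (by simp), Submodule.subset_span (by simp)⟩) ⟨0, rfl⟩
    rintro _ (⟨i, rfl⟩ | ⟨i, rfl⟩)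
    · exact h.extD_mem_of_wedge_mem hy hw (h.differentiableAt_coframe hy _)
    · exact h.extD_mem_of_wedge_mem hy hw (((h.smooth_singularForms i).contDiffAt
        (h.isOpen.mem_nhds hy)).differentiableAt (by simp))

theorem isDecomposition (h : IsSingularCoframe O e χ k p m a b c α₁ α₂) :
    IsDecomposition O (firstFour χ) (firstFour χ) (singularForms χ k) (singularForms χ (-k))
      (fun (_ : Fin 1) y => wedge (singularForms χ k 0 y) (singularForms χ k 1 y))
      (fun (_ : Fin 1) y => wedge (singularForms χ (-k) 0 y) (singularForms χ (-k) 1 y)) where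
  two_le_left := le_refl _
  two_le_right := le_refl _
  one_le_left := le_refl _
  one_le_right := le_refl _
  smooth_τ i := h.smooth_coframe _
  smooth_σ₁ := h.smooth_singularForms
  smooth_σ₂ := h.neg.smooth_singularForms
  smooth_Ω₁ _ := (h.smooth_singularForms 0).wedge (h.smooth_singularForms 1)
  smooth_Ω₂ _ := (h.neg.smooth_singularForms 0).wedge (h.neg.smooth_singularForms 1)
  independent y hy := h.independent_singularForms hy
  spanning y hy := h.sup_span_singularForms hy
  quadratic₁ y _ _ := Submodule.subset_span ⟨_, mem_spanForms _ y 0, _, mem_spanForms _ y 1, rfl⟩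
  quadratic₂ y _ _ := Submodule.subset_span ⟨_, mem_spanForms _ y 0, _, mem_spanForms _ y 1, rfl⟩
  degree_one _ _ := rfl
  degree_two y hy := by
    rw [← h.idealTwo_firstFour hy, Set.range_const, Set.range_const]

theorem isDarbouxIntegrable_iff (h : IsSingularCoframe O e χ k p m a b c α₁ α₂) :
    IsDarbouxIntegrable O (firstFour χ) ↔ ∀ y ∈ O, 2 * k y * a y = p y ^ 2 ∧
      2 * k y * b y = p y * m y ∧ 2 * k y * c y = m y ^ 2 := by
  refine ⟨fun hD y hy => h.relations_of_isDarbouxIntegrable hD hy, fun hrel y hy => ?_⟩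
  -- The conditions on the other singular system come from the symmetry `k ↦ -k`, applied together
  -- with `-(-k) = k`.
  have hP := h.neg.isPfaffian
  have hS := fun z (hz : z ∈ O) => h.neg.sup_derivedLimit (fun y hy => by simpa using hrel y hy) hz
  rw [neg_neg] at hP hS
  exact ⟨O, h.isOpen, hy, subset_rfl, 4, 2, 2, 1, 1, firstFour χ, singularForms χ k,
    singularForms χ (-k), _, _, h.isDecomposition, h.isPfaffian, hP,
    { sup_left := hS
      sup_right := fun z hz => h.sup_derivedLimit hrel hz
      inf_limits := fun z hz => h.derivedLimit_inf_derivedLimit hz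
      d_mem := fun U' hU' hU'o φ hφ x hx => h.extD_mem_extSquare hU'o hU' hφ hx }⟩

end IsSingularCoframe
end SingularCoframe

/-! ### Moving frames of Minkowski space: completeness, skew-symmetry and structure equations. -/

namespace MinkowskiFrames

variable (G : MinkowskiFrames)

/-- The components, in the moving frame, of the differential of a vector valued function. -/
def component (f : Six → Fin 3 → ℝ) (i : Fin 3) (p : Six) : Covector ℝ Six :=
  minkowskiSign i • (minkowskiForm (G.frame i p)).comp (fderiv ℝ f p)

theorem component_apply (f : Six → Fin 3 → ℝ) (i : Fin 3) (p v : Six) :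
    G.component f i p v = minkowskiSign i * minkowskiForm (G.frame i p) (fderiv ℝ f p v) := rfl

theorem minkowskiSign_mul_self (i : Fin 3) : minkowskiSign i * minkowskiSign i = 1 := by
  fin_cases i <;> simp [minkowskiSign]

theorem minkowskiForm_symm (u v : Fin 3 → ℝ) : minkowskiForm u v = minkowskiForm v u := by
  rw [minkowskiForm_apply, minkowskiForm_apply]; ring

theorem sign_mul_minkowskiForm (f : Six → Fin 3 → ℝ) (i : Fin 3) (p v : Six) :
    minkowskiForm (G.frame i p) (fderiv ℝ f p v) = minkowskiSign i * G.component f i p v := by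
  rw [component_apply, ← mul_assoc, minkowskiSign_mul_self, one_mul]

variable {G}

/-- Expansion of the inner product in an orthonormal frame. -/
theorem minkowskiForm_eq_sum {p : Six} (hp : p ∈ G.domain) (u v : Fin 3 → ℝ) :
    minkowskiForm u v = ∑ l, minkowskiSign l *
      (minkowskiForm (G.frame l p) u * minkowskiForm (G.frame l p) v) := by
  set P : Matrix (Fin 3) (Fin 3) ℝ := Matrix.of fun i j => G.frame j p i with hP
  set D : Matrix (Fin 3) (Fin 3) ℝ := Matrix.diagonal minkowskiSign with hD
  have h₁ : D * P.transpose * D * P = 1 := by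
    ext i j
    have h := G.orthonormal p hp i j
    rw [minkowskiForm_apply] at h
    have hs := minkowskiSign_mul_self i
    have : (D * P.transpose * D * P) i j = minkowskiSign i * (G.frame i p 0 * G.frame j p 0 -
        G.frame i p 1 * G.frame j p 1 - G.frame i p 2 * G.frame j p 2) := by
      rw [hD, hP, Matrix.mul_apply]
      simp [Fin.sum_univ_three, minkowskiSign, Matrix.mul_diagonal, Matrix.diagonal_mul]
      ring
    rw [this, h, Matrix.one_apply]
    split_ifs with hij
    · exact hs
    · simp
  -- Orthonormality of the columns says that `D Pᵀ D` is a left inverse of `P`; as a right inverse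
  -- it gives the completeness relation for the rows.
  have h₂ : P * (D * P.transpose * D) = 1 := mul_eq_one_comm.1 h₁
  have h₃ : ∀ i j, G.frame 0 p i * G.frame 0 p j - G.frame 1 p i * G.frame 1 p j -
      G.frame 2 p i * G.frame 2 p j = if i = j then minkowskiSign j else 0 := by
    intro i j
    have h := congrFun (congrFun h₂ i) j
    rw [hD, hP, Matrix.mul_apply, Matrix.one_apply] at h
    simp [Fin.sum_univ_three, Matrix.mul_diagonal, Matrix.diagonal_mul] at h
    have hs := minkowskiSign_mul_self j
    have h' := congrArg (fun x => x * minkowskiSign j) h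
    simp only [ite_mul, one_mul, zero_mul] at h'
    rw [← h']
    simp only [show minkowskiSign 0 = 1 from rfl, show minkowskiSign 1 = -1 from rfl,
      show minkowskiSign 2 = -1 from rfl]
    linear_combination (-(G.frame 0 p i * G.frame 0 p j - G.frame 1 p i * G.frame 1 p j -
      G.frame 2 p i * G.frame 2 p j)) * hs
  have e00 := h₃ 0 0
  have e01 := h₃ 0 1
  have e02 := h₃ 0 2
  have e11 := h₃ 1 1
  have e12 := h₃ 1 2
  have e22 := h₃ 2 2
  simp [minkowskiSign] at e00 e01 e02 e11 e12 e22
  simp only [Fin.sum_univ_three, minkowskiForm_apply, show minkowskiSign 0 = 1 from rfl,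
    show minkowskiSign 1 = -1 from rfl, show minkowskiSign 2 = -1 from rfl]
  linear_combination -(u 0 * v 0) * e00 + (u 0 * v 1 + u 1 * v 0) * e01 +
    (u 0 * v 2 + u 2 * v 0) * e02 - (u 1 * v 1) * e11 - (u 1 * v 2 + u 2 * v 1) * e12 -
    (u 2 * v 2) * e22

theorem eq_zero_of_minkowskiForm {p : Six} (hp : p ∈ G.domain) {u : Fin 3 → ℝ}
    (h : ∀ l, minkowskiForm (G.frame l p) u = 0) : u = 0 := by
  have hz : ∀ v, minkowskiForm u v = 0 := fun v => by
    rw [minkowskiForm_eq_sum hp u v]; simp [h]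
  have h0 := hz ![1, 0, 0]
  have h1 := hz ![0, 1, 0]
  have h2 := hz ![0, 0, 1]
  simp [minkowskiForm_apply] at h0 h1 h2
  ext i
  fin_cases i
  · exact h0
  · exact h1
  · exact h2

theorem differentiableAt_frame {p : Six} (hp : p ∈ G.domain) (i : Fin 3) :
    DifferentiableAt ℝ (G.frame i) p :=
  ((G.smooth_frame i).contDiffAt (G.isOpen_domain.mem_nhds hp)).differentiableAt (by simp)

/-- The inner products of the frame vectors are constant; differentiate them. -/
theorem connection_symm {p : Six} (hp : p ∈ G.domain) (i j : Fin 3) (v : Six) :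
    minkowskiSign i * G.connection i j p v = -(minkowskiSign j * G.connection j i p v) := by
  have hi := (differentiableAt_frame hp i).hasFDerivAt
  have hj := (differentiableAt_frame hp j).hasFDerivAt
  have h₁ : HasFDerivAt (fun q => minkowskiForm (G.frame i q) (G.frame j q)) _ p :=
    (minkowskiForm.hasFDerivAt.comp p hi).clm_apply hj
  have h₂ : (fun q => minkowskiForm (G.frame i q) (G.frame j q)) =ᶠ[nhds p]
      fun _ => if i = j then minkowskiSign i else 0 :=
    Filter.eventually_of_mem (G.isOpen_domain.mem_nhds hp) fun q hq => G.orthonormal q hq i j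
  have h₃ := (h₁.congr_of_eventuallyEq h₂.symm).unique (hasFDerivAt_const _ p)
  have h₄ := congrArg (fun T : Covector ℝ Six => T v) h₃
  simp at h₄
  change minkowskiSign i * G.component (G.frame j) i p v =
    -(minkowskiSign j * G.component (G.frame i) j p v)
  rw [← sign_mul_minkowskiForm, ← sign_mul_minkowskiForm, minkowskiForm_symm (G.frame j p)]
  linarith

theorem smooth_component {f : Six → Fin 3 → ℝ} (hf : ContDiffOn ℝ ∞ f G.domain) (i : Fin 3) :
    ContDiffOn ℝ ∞ (G.component f i) G.domain :=
  ((minkowskiForm.contDiff.comp_contDiffOn (G.smooth_frame i)).clm_comp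
    (hf.fderiv_of_isOpen G.isOpen_domain (by simp))).const_smul _

/-- The structure equations of Minkowski space. -/
theorem extD_component {f : Six → Fin 3 → ℝ} (hf : ContDiffOn ℝ ∞ f G.domain) {p : Six}
    (hp : p ∈ G.domain) (i : Fin 3) (v w : Six) :
    extD (G.component f i) p v w = -∑ l, (G.connection i l p v * G.component f l p w -
      G.connection i l p w * G.component f l p v) := by
  have hi := (differentiableAt_frame hp i).hasFDerivAt
  have hfp := hf.contDiffAt (G.isOpen_domain.mem_nhds hp)
  have hdf : HasFDerivAt (fderiv ℝ f) (fderiv ℝ (fderiv ℝ f) p) p :=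
    (((hf.fderiv_of_isOpen (m := ∞) G.isOpen_domain (by simp)).contDiffAt
      (G.isOpen_domain.mem_nhds hp)).differentiableAt (by simp)).hasFDerivAt
  have hB : HasFDerivAt (fun q => minkowskiForm (G.frame i q)) _ p :=
    minkowskiForm.hasFDerivAt.comp p hi
  have h := (hB.clm_comp hdf).const_smul (minkowskiSign i)
  -- This is `d(df) = 0`. With `f` the base point it will give the equations for the canonical
  -- forms, with `f` a frame vector those for the connection forms.
  have hsymm : fderiv ℝ (fderiv ℝ f) p v w = fderiv ℝ (fderiv ℝ f) p w v :=
    (hfp.isSymmSndFDerivAt (by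
      simp only [minSmoothness_of_isRCLikeNormedField]
      exact WithTop.coe_le_coe.2 (le_top : (2 : ℕ∞) ≤ ⊤))) v w
  have hval : extD (G.component f i) p v w = minkowskiSign i *
      (minkowskiForm (fderiv ℝ (G.frame i) p v) (fderiv ℝ f p w) -
        minkowskiForm (fderiv ℝ (G.frame i) p w) (fderiv ℝ f p v)) := by
    rw [extD_apply]
    have h' : fderiv ℝ (G.component f i) p = _ := h.fderiv
    rw [h']
    simp [hsymm]
    ring
  rw [hval, minkowskiForm_eq_sum hp, minkowskiForm_eq_sum hp (fderiv ℝ (G.frame i) p w),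
    ← Finset.sum_sub_distrib, Finset.mul_sum, ← Finset.sum_neg_distrib]
  refine Finset.sum_congr rfl fun l _ => ?_
  simp only [sign_mul_minkowskiForm]
  change _ = -(G.connection i l p v * _ - G.connection i l p w * _)
  have hv : minkowskiSign i * G.connection i l p v =
      -(minkowskiSign l * G.component (G.frame i) l p v) := connection_symm hp i l v
  have hw : minkowskiSign i * G.connection i l p w =
      -(minkowskiSign l * G.component (G.frame i) l p w) := connection_symm hp i l w
  have hi2 := minkowskiSign_mul_self i
  have hl2 := minkowskiSign_mul_self l
  have hv' : G.connection i l p v =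
      -(minkowskiSign i * minkowskiSign l * G.component (G.frame i) l p v) := by
    linear_combination minkowskiSign i * hv - G.connection i l p v * hi2
  have hw' : G.connection i l p w =
      -(minkowskiSign i * minkowskiSign l * G.component (G.frame i) l p w) := by
    linear_combination minkowskiSign i * hw - G.connection i l p w * hi2
  rw [hv', hw']
  linear_combination minkowskiSign i * minkowskiSign l *
    (G.component (G.frame i) l p v * G.component f l p w -
      G.component (G.frame i) l p w * G.component f l p v) * hl2

/-- By skew-symmetry three connection forms determine all nine, hence the differentials of the base
point and the frame vectors vanish on `v`, and the immersion condition applies. Thus these six forms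
are a coframe. -/
theorem eq_zero_of_forms {p : Six} (hp : p ∈ G.domain) {v : Six}
    (hω : ∀ i, G.canonical i p v = 0) (h₀₁ : G.connection 0 1 p v = 0)
    (h₂₀ : G.connection 2 0 p v = 0) (h₂₁ : G.connection 2 1 p v = 0) : v = 0 := by
  have hs : ∀ i, minkowskiSign i ≠ 0 := by
    intro i; fin_cases i <;> simp [minkowskiSign]
  have hflip : ∀ i j, G.connection i j p v = 0 → G.connection j i p v = 0 := by
    intro i j h
    have := connection_symm hp j i v
    rw [h, mul_zero, neg_zero] at this
    exact (mul_eq_zero.1 this).resolve_left (hs j)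
  have hdiag : ∀ i, G.connection i i p v = 0 := by
    intro i
    have := connection_symm hp i i v
    have : minkowskiSign i * G.connection i i p v = 0 := by linarith
    exact (mul_eq_zero.1 this).resolve_left (hs i)
  have hconn : ∀ i j, G.connection i j p v = 0 := by
    intro i j
    fin_cases i <;> fin_cases j
    exacts [hdiag 0, h₀₁, hflip _ _ h₂₀, hflip _ _ h₀₁, hdiag 1, hflip _ _ h₂₁, h₂₀, h₂₁, hdiag 2]
  have hzero : ∀ f : Six → Fin 3 → ℝ, (∀ i, G.component f i p v = 0) → fderiv ℝ f p v = 0 := by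
    intro f hf
    refine eq_zero_of_minkowskiForm hp fun l => ?_
    rw [sign_mul_minkowskiForm, hf l, mul_zero]
  refine G.immersion p hp ?_
  simp only [map_zero, hzero G.base hω, fun j => hzero (G.frame j) fun i => hconn i j]

end MinkowskiFrames

/-! ### An explicit coordinate system on the frame bundle, needed so that integrability in all
coordinates is not vacuous. -/

/-- The Lorentz boost with velocity coordinates `u`, `v` followed by a rotation by `t`. -/
def boostFrame (i : Fin 3) (s : Six) : Fin 3 → ℝ :=
  let u := s 3
  let v := s 4
  let r := Real.sqrt (1 + u ^ 2 + v ^ 2)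
  let f₁ : Fin 3 → ℝ := ![u, 1 + u ^ 2 / (1 + r), u * v / (1 + r)]
  let f₂ : Fin 3 → ℝ := ![v, u * v / (1 + r), 1 + v ^ 2 / (1 + r)]
  ![![r, u, v], fun j => Real.cos (s 5) * f₁ j + Real.sin (s 5) * f₂ j,
    fun j => -Real.sin (s 5) * f₁ j + Real.cos (s 5) * f₂ j] i

theorem boost_radius_pos (u v : ℝ) : 0 < Real.sqrt (1 + u ^ 2 + v ^ 2) :=
  Real.sqrt_pos.2 (by positivity)

theorem contDiff_six_apply (i : Fin 6) : ContDiff ℝ ∞ fun s : Six => s i :=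
  (EuclideanSpace.proj i : Six →L[ℝ] ℝ).contDiff

theorem contDiff_boostFrame (i : Fin 3) : ContDiff ℝ ∞ (boostFrame i) := by
  have h3 := contDiff_six_apply 3
  have h4 := contDiff_six_apply 4
  have h5 := contDiff_six_apply 5
  have hr : ContDiff ℝ ∞ fun s : Six => Real.sqrt (1 + s 3 ^ 2 + s 4 ^ 2) :=
    ((contDiff_const.add (h3.pow 2)).add (h4.pow 2)).sqrt fun s => by positivity
  have hr1 : ContDiff ℝ ∞ fun s : Six => 1 + Real.sqrt (1 + s 3 ^ 2 + s 4 ^ 2) :=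
    contDiff_const.add hr
  have hne : ∀ s : Six, 1 + Real.sqrt (1 + s 3 ^ 2 + s 4 ^ 2) ≠ 0 := fun s => by positivity
  have hA : ContDiff ℝ ∞ fun s : Six =>
      1 + s 3 ^ 2 / (1 + Real.sqrt (1 + s 3 ^ 2 + s 4 ^ 2)) :=
    contDiff_const.add ((h3.pow 2).div hr1 hne)
  have hB : ContDiff ℝ ∞ fun s : Six =>
      s 3 * s 4 / (1 + Real.sqrt (1 + s 3 ^ 2 + s 4 ^ 2)) := (h3.mul h4).div hr1 hne
  have hC : ContDiff ℝ ∞ fun s : Six =>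
      1 + s 4 ^ 2 / (1 + Real.sqrt (1 + s 3 ^ 2 + s 4 ^ 2)) :=
    contDiff_const.add ((h4.pow 2).div hr1 hne)
  have hcos := h5.cos
  have hsin := h5.sin
  rw [contDiff_pi]
  intro j
  fin_cases i <;> fin_cases j
  · exact hr
  · exact h3
  · exact h4
  · exact (hcos.mul h3).add (hsin.mul h4)
  · exact (hcos.mul hA).add (hsin.mul hB)
  · exact (hcos.mul hB).add (hsin.mul hC)
  · exact (hsin.neg.mul h3).add (hcos.mul h4)
  · exact (hsin.neg.mul hA).add (hcos.mul hB)
  · exact (hsin.neg.mul hB).add (hcos.mul hC)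

theorem boostFrame_orthonormal (s : Six) (i j : Fin 3) :
    minkowskiForm (boostFrame i s) (boostFrame j s) = if i = j then minkowskiSign i else 0 := by
  have hr := boost_radius_pos (s 3) (s 4)
  have hr2 : Real.sqrt (1 + s 3 ^ 2 + s 4 ^ 2) ^ 2 = 1 + s 3 ^ 2 + s 4 ^ 2 :=
    Real.sq_sqrt (by positivity)
  have hcs := Real.sin_sq_add_cos_sq (s 5)
  rw [minkowskiForm_apply]
  simp only [boostFrame]
  generalize Real.sqrt (1 + s 3 ^ 2 + s 4 ^ 2) = r at *
  generalize s 3 = u at *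
  generalize s 4 = v at *
  generalize Real.cos (s 5) = C at *
  generalize Real.sin (s 5) = S at *
  have hne : 1 + r ≠ 0 := by positivity
  obtain ⟨x, hx⟩ : ∃ x, x = (1 + r)⁻¹ := ⟨_, rfl⟩
  have hx1 : x * (1 + r) = 1 := by rw [hx]; field_simp
  -- `q1` to `q5` are orthonormality relations of the boost before the rotation, as polynomial
  -- identities modulo `r² = 1 + u² + v²` and `x (1 + r) = 1`; the rotation then combines them with
  -- coefficients in `C` and `S`.
  have q1 : u ^ 2 - (1 + u ^ 2 * x) ^ 2 - (u * v * x) ^ 2 = -1 := by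
    linear_combination (u ^ 2 * x ^ 2) * hr2 - (u ^ 2 * x * (1 + r) + u ^ 2 - 2 * u ^ 2 * x) * hx1
  have q2 : v ^ 2 - (u * v * x) ^ 2 - (1 + v ^ 2 * x) ^ 2 = -1 := by
    linear_combination (v ^ 2 * x ^ 2) * hr2 - (v ^ 2 * x * (1 + r) + v ^ 2 - 2 * v ^ 2 * x) * hx1
  have q3 : u * v - (1 + u ^ 2 * x) * (u * v * x) - (u * v * x) * (1 + v ^ 2 * x) = 0 := by
    linear_combination (u * v * x ^ 2) * hr2 - (u * v * x * (1 + r) + u * v - 2 * u * v * x) * hx1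
  have q4 : r * u - u * (1 + u ^ 2 * x) - v * (u * v * x) = 0 := by
    linear_combination (u * x) * hr2 - (u * r - u) * hx1
  have q5 : r * v - u * (u * v * x) - v * (1 + v ^ 2 * x) = 0 := by
    linear_combination (v * x) * hr2 - (v * r - v) * hx1
  simp only [div_eq_mul_inv, ← hx]
  fin_cases i <;> fin_cases j <;> simp [minkowskiSign]
  · linear_combination hr2
  · linear_combination C * q4 + S * q5
  · linear_combination -S * q4 + C * q5
  · linear_combination C * q4 + S * q5
  · linear_combination C ^ 2 * q1 + S ^ 2 * q2 + 2 * C * S * q3 - hcs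
  · linear_combination -C * S * q1 + C * S * q2 + (C ^ 2 - S ^ 2) * q3
  · linear_combination -S * q4 + C * q5
  · linear_combination -C * S * q1 + C * S * q2 + (C ^ 2 - S ^ 2) * q3
  · linear_combination S ^ 2 * q1 + C ^ 2 * q2 - 2 * C * S * q3 - hcs

theorem boostFrame_det (s : Six) : (Matrix.of fun i j => boostFrame j s i).det = 1 := by
  have hr := boost_radius_pos (s 3) (s 4)
  have hr2 : Real.sqrt (1 + s 3 ^ 2 + s 4 ^ 2) ^ 2 = 1 + s 3 ^ 2 + s 4 ^ 2 :=
    Real.sq_sqrt (by positivity)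
  have hcs := Real.sin_sq_add_cos_sq (s 5)
  rw [Matrix.det_fin_three]
  simp [boostFrame]
  generalize Real.sqrt (1 + s 3 ^ 2 + s 4 ^ 2) = r at *
  generalize s 3 = u at *
  generalize s 4 = v at *
  generalize Real.cos (s 5) = C at *
  generalize Real.sin (s 5) = S at *
  have hne : 1 + r ≠ 0 := by positivity
  obtain ⟨x, hx⟩ : ∃ x, x = (1 + r)⁻¹ := ⟨_, rfl⟩
  have hx1 : x * (1 + r) = 1 := by rw [hx]; field_simp
  simp only [div_eq_mul_inv, ← hx]
  have key : r * ((1 + u ^ 2 * x) * (1 + v ^ 2 * x) - (u * v * x) ^ 2) -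
      u * (u * (1 + v ^ 2 * x) - v * (u * v * x)) +
      v * (u * (u * v * x) - v * (1 + u ^ 2 * x)) = 1 := by
    linear_combination (1 - r * x) * hr2 + r * (r - 1) * hx1
  linear_combination key + (r * ((1 + u ^ 2 * x) * (1 + v ^ 2 * x) - (u * v * x) ^ 2) -
      u * (u * (1 + v ^ 2 * x) - v * (u * v * x)) +
      v * (u * (u * v * x) - v * (1 + u ^ 2 * x))) * hcs

/-- The first frame vector contains the two boost coordinates among its entries. Once these are
stationary, only the angle moves, and the second frame vector changes by a multiple of the third,
which is not zero. -/
theorem boostFrame_immersion (p : Six) {v : Six} (h₀ : fderiv ℝ (boostFrame 0) p v = 0)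
    (h₁ : fderiv ℝ (boostFrame 1) p v = 0) : v 3 = 0 ∧ v 4 = 0 ∧ v 5 = 0 := by
  have hd : ∀ i, DifferentiableAt ℝ (boostFrame i) p := fun i =>
    (contDiff_boostFrame i).differentiable (by simp) p
  have hline : ∀ i j, HasDerivAt (fun t : ℝ => boostFrame i (p + t • v) j)
      (fderiv ℝ (boostFrame i) p v j) 0 := by
    intro i j
    have hl : HasDerivAt (fun t : ℝ => p + t • v) v 0 := by
      simpa using ((hasDerivAt_id (0 : ℝ)).smul_const v).const_add p
    have := (hd i).hasFDerivAt
    rw [show p = p + (0 : ℝ) • v by simp] at this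
    have h := this.comp_hasDerivAt (0 : ℝ) hl
    simp only [zero_smul, add_zero] at h
    exact (hasDerivAt_pi.1 h) j
  have hcoord : ∀ j : Fin 6, HasDerivAt (fun t : ℝ => (p + t • v) j) (v j) 0 := by
    intro j
    simpa using ((hasDerivAt_id (0 : ℝ)).mul_const (v j)).const_add (p j)
  have h3 : v 3 = 0 := by
    have := (hcoord 3).unique (hline 0 1)
    rw [this, h₀]; rfl
  have h4 : v 4 = 0 := by
    have := (hcoord 4).unique (hline 0 2)
    rw [this, h₀]; rfl
  refine ⟨h3, h4, ?_⟩
  have hz : ∀ j, v 5 * boostFrame 2 p j = 0 := by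
    intro j
    have hl := hline 1 j
    rw [h₁] at hl
    have hexp : (fun t : ℝ => boostFrame 1 (p + t • v) j) = fun t : ℝ =>
        boostFrame 1 p j * Real.cos (t * v 5) + boostFrame 2 p j * Real.sin (t * v 5) := by
      ext t
      simp [boostFrame, h3, h4, Real.cos_add, Real.sin_add]
      ring
    rw [hexp] at hl
    have ht : HasDerivAt (fun t : ℝ => t * v 5) (v 5) 0 := by
      simpa using (hasDerivAt_id (0 : ℝ)).mul_const (v 5)
    have := hl.unique ((ht.cos.const_mul _).add (ht.sin.const_mul _))
    simp at this
    exact mul_eq_zero.2 (by tauto)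
  by_contra hne
  have hf : boostFrame 2 p = 0 := by
    ext j
    exact (mul_eq_zero.1 (hz j)).resolve_left hne
  have := boostFrame_orthonormal p 2 2
  rw [hf] at this
  simp [minkowskiSign] at this

/-- A coordinate system on the frame bundle of Minkowski space. -/
def boostFrames : MinkowskiFrames where
  domain := Set.univ
  isOpen_domain := isOpen_univ
  base s := ![s 0, s 1, s 2]
  frame := boostFrame
  smooth_base := by
    refine ContDiff.contDiffOn (contDiff_pi.2 fun j => ?_)
    fin_cases j
    · exact contDiff_six_apply 0
    · exact contDiff_six_apply 1
    · exact contDiff_six_apply 2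
  smooth_frame i := (contDiff_boostFrame i).contDiffOn
  orthonormal p _ := boostFrame_orthonormal p
  det_eq_one p _ := boostFrame_det p
  immersion p _ := by
    intro x y hxy
    rw [← sub_eq_zero]
    simp only [Prod.mk.injEq] at hxy
    set v := x - y
    have hb : fderiv ℝ (fun s : Six => ![s 0, s 1, s 2]) p v = 0 := by
      rw [map_sub, sub_eq_zero]; exact hxy.1
    have hf : ∀ i, fderiv ℝ (boostFrame i) p v = 0 := fun i => by
      rw [map_sub, sub_eq_zero]; exact congrFun hxy.2 i
    obtain ⟨h3, h4, h5⟩ := boostFrame_immersion p (hf 0) (hf 1)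
    have hlin : HasFDerivAt (fun s : Six => ![s 0, s 1, s 2])
        (ContinuousLinearMap.pi fun j : Fin 3 =>
          (EuclideanSpace.proj ((![0, 1, 2] : Fin 3 → Fin 6) j) : Six →L[ℝ] ℝ)) p := by
      rw [hasFDerivAt_pi']
      intro j
      fin_cases j <;> exact (EuclideanSpace.proj _ : Six →L[ℝ] ℝ).hasFDerivAt
    rw [hlin.fderiv] at hb
    have h0 : v 0 = 0 := congrFun hb 0
    have h1 : v 1 = 0 := congrFun hb 1
    have h2 : v 2 = 0 := congrFun hb 2
    ext j
    fin_cases j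
    · exact h0
    · exact h1
    · exact h2
    · exact h3
    · exact h4
    · exact h5

/-! ### Covariant derivatives on the surface and the equations for `q` in terms of `½ log |K|`. -/

namespace LorentzianMetric

variable {M : Type*} [TopologicalSpace M] [ChartedSpace Plane M] [IsManifold (𝓡 2) ∞ M]

namespace LocalCoframe

variable {g : LorentzianMetric M} (F : LocalCoframe g)

theorem smooth_apply {α : Plane → Covector ℝ Plane} (hα : ContDiffOn ℝ ∞ α F.chart.target)
    (v : Plane) : ContDiffOn ℝ ∞ (fun y => α y v) F.chart.target :=
  hα.clm_apply contDiffOn_const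

theorem smooth_areaCoeff {Ω : Plane → Bicovector ℝ Plane}
    (hΩ : ContDiffOn ℝ ∞ (fun y => Ω y (EuclideanSpace.single 0 1) (EuclideanSpace.single 1 1))
      F.chart.target) : ContDiffOn ℝ ∞ (fun y => F.areaCoeff y (Ω y)) F.chart.target := by
  refine hΩ.div ?_ fun y hy => F.area_ne_zero hy
  simp only [wedge_apply]
  exact ((F.smooth_apply (F.smooth 0) _).mul (F.smooth_apply (F.smooth 1) _)).sub
    ((F.smooth_apply (F.smooth 1) _).mul (F.smooth_apply (F.smooth 0) _))

theorem smooth_areaCoeff_wedge {α β : Plane → Covector ℝ Plane}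
    (hα : ContDiffOn ℝ ∞ α F.chart.target) (hβ : ContDiffOn ℝ ∞ β F.chart.target) :
    ContDiffOn ℝ ∞ (fun y => F.areaCoeff y (wedge (α y) (β y))) F.chart.target := by
  refine F.smooth_areaCoeff ?_
  simp only [wedge_apply]
  exact ((F.smooth_apply hα _).mul (F.smooth_apply hβ _)).sub
    ((F.smooth_apply hβ _).mul (F.smooth_apply hα _))

theorem smooth_areaCoeff_extD {α : Plane → Covector ℝ Plane}
    (hα : ContDiffOn ℝ ∞ α F.chart.target) :
    ContDiffOn ℝ ∞ (fun y => F.areaCoeff y (extD α y)) F.chart.target := by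
  refine F.smooth_areaCoeff ?_
  simp only [extD_apply]
  have h := hα.fderiv_of_isOpen (m := ∞) F.chart.open_target (by simp)
  exact ((h.clm_apply contDiffOn_const).clm_apply contDiffOn_const).sub
    ((h.clm_apply contDiffOn_const).clm_apply contDiffOn_const)

theorem smooth_coeff {α : Plane → Covector ℝ Plane} (hα : ContDiffOn ℝ ∞ α F.chart.target)
    (i : Fin 2) : ContDiffOn ℝ ∞ (fun y => F.coeff y (α y) i) F.chart.target := by
  fin_cases i
  · exact F.smooth_areaCoeff_wedge hα (F.smooth 1)
  · exact F.smooth_areaCoeff_wedge (F.smooth 0) hα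

theorem smooth_connection : ContDiffOn ℝ ∞ F.connection F.chart.target :=
  ((F.smooth_areaCoeff_extD (F.smooth 0)).neg.smul (F.smooth 0)).add
    ((F.smooth_areaCoeff_extD (F.smooth 1)).smul (F.smooth 1))

theorem smooth_gaussCurvature : ContDiffOn ℝ ∞ F.gaussCurvature F.chart.target :=
  (F.smooth_areaCoeff_extD F.smooth_connection).neg

theorem smooth_covDeriv {f : Plane → ℝ} (hf : ContDiffOn ℝ ∞ f F.chart.target) (i : Fin 2) :
    ContDiffOn ℝ ∞ (F.covDeriv f i) F.chart.target :=
  F.smooth_coeff (hf.fderiv_of_isOpen F.chart.open_target (by simp)) i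

variable {F}

theorem differentiableAt_of_smooth {X : Type*} [NormedAddCommGroup X] [NormedSpace ℝ X]
    {f : Plane → X} (hf : ContDiffOn ℝ ∞ f F.chart.target) {y : Plane}
    (hy : y ∈ F.chart.target) : DifferentiableAt ℝ f y :=
  (hf.contDiffAt (F.chart.open_target.mem_nhds hy)).differentiableAt (by simp)

theorem coeff_add (y : Plane) (α β : Covector ℝ Plane) (i : Fin 2) :
    F.coeff y (α + β) i = F.coeff y α i + F.coeff y β i := by
  fin_cases i <;> simp [coeff, areaCoeff, wedge_apply] <;> ring

theorem coeff_smul (y : Plane) (c : ℝ) (α : Covector ℝ Plane) (i : Fin 2) :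
    F.coeff y (c • α) i = c * F.coeff y α i := by
  fin_cases i <;> simp [coeff, areaCoeff, wedge_apply] <;> ring

/-- The differential of a function in the coframe. -/
theorem fderiv_eq {y : Plane} (hy : y ∈ F.chart.target) (f : Plane → ℝ) :
    fderiv ℝ f y = F.covDeriv f 0 y • F.η 0 y + F.covDeriv f 1 y • F.η 1 y := by
  conv_lhs => rw [F.eq_sum_coeff hy (fderiv ℝ f y), Fin.sum_univ_two]
  rfl

theorem covDeriv_apply (f : Plane → ℝ) (i : Fin 2) (y : Plane) :
    F.coeff y (fderiv ℝ f y) i = F.covDeriv f i y := rfl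

theorem fderiv_covDeriv_zero {y : Plane} (hy : y ∈ F.chart.target) (f : Plane → ℝ) :
    fderiv ℝ (F.covDeriv f 0) y = F.covDeriv f 1 y • F.connection y +
      (F.covDeriv₂ f 0 0 y • F.η 0 y + F.covDeriv₂ f 0 1 y • F.η 1 y) := by
  have h := F.eq_sum_coeff hy (fderiv ℝ (F.covDeriv f 0) y -
    ∑ l, F.covDeriv f l y • F.connectionMatrix l 0 y)
  rw [Fin.sum_univ_two (f := fun j => F.coeff y _ j • F.η j y)] at h
  change _ = F.covDeriv₂ f 0 0 y • F.η 0 y + F.covDeriv₂ f 0 1 y • F.η 1 y at h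
  rw [← h]
  simp [Fin.sum_univ_two, connectionMatrix]

theorem fderiv_covDeriv_one {y : Plane} (hy : y ∈ F.chart.target) (f : Plane → ℝ) :
    fderiv ℝ (F.covDeriv f 1) y = F.covDeriv f 0 y • F.connection y +
      (F.covDeriv₂ f 1 0 y • F.η 0 y + F.covDeriv₂ f 1 1 y • F.η 1 y) := by
  have h := F.eq_sum_coeff hy (fderiv ℝ (F.covDeriv f 1) y -
    ∑ l, F.covDeriv f l y • F.connectionMatrix l 1 y)
  rw [Fin.sum_univ_two (f := fun j => F.coeff y _ j • F.η j y)] at h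
  change _ = F.covDeriv₂ f 1 0 y • F.η 0 y + F.covDeriv₂ f 1 1 y • F.η 1 y at h
  rw [← h]
  simp [Fin.sum_univ_two, connectionMatrix]

/-- The second covariant derivatives are symmetric. -/
theorem covDeriv₂_symm {f : Plane → ℝ} (hf : ContDiffOn ℝ ∞ f F.chart.target) {y : Plane}
    (hy : y ∈ F.chart.target) : F.covDeriv₂ f 0 1 y = F.covDeriv₂ f 1 0 y := by
  have hu := F.smooth_covDeriv hf
  have hd : ∀ i, HasFDerivAt (F.covDeriv f i) (fderiv ℝ (F.covDeriv f i) y) y := fun i =>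
    (differentiableAt_of_smooth (hu i) hy).hasFDerivAt
  have hη : ∀ i, DifferentiableAt ℝ (F.η i) y := fun i =>
    differentiableAt_of_smooth (F.smooth i) hy
  -- Symmetry follows by expanding `d(df) = 0` with `df = f₀ η⁰ + f₁ η¹`; the connection terms
  -- cancel because the connection is torsion free.
  have h₀ : extD (fderiv ℝ f) y = 0 := by
    ext v w
    rw [extD_apply, ((hf.contDiffAt (F.chart.open_target.mem_nhds hy)).isSymmSndFDerivAt (by
      simp only [minSmoothness_of_isRCLikeNormedField]
      exact WithTop.coe_le_coe.2 (le_top : (2 : ℕ∞) ≤ ⊤))) v w]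
    simp
  have h₁ : fderiv ℝ f =ᶠ[nhds y]
      fun z => F.covDeriv f 0 z • F.η 0 z + F.covDeriv f 1 z • F.η 1 z :=
    Filter.eventually_of_mem (F.chart.open_target.mem_nhds hy) fun z hz => fderiv_eq hz f
  rw [extD_congr h₁, extD_add ((hd 0).differentiableAt.fun_smul (hη 0))
    ((hd 1).differentiableAt.fun_smul (hη 1)), extD_smul (hd 0) (hη 0), extD_smul (hd 1) (hη 1),
    (F.structure_equations hy).1, (F.structure_equations hy).2.1, fderiv_covDeriv_zero hy,
    fderiv_covDeriv_one hy] at h₀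
  have h := congrArg (fun B : Bicovector ℝ Plane =>
    B (EuclideanSpace.single 0 1) (EuclideanSpace.single 1 1)) h₀
  have hne := F.area_ne_zero hy
  simp only [wedge_apply, add_apply, smul_apply, smul_eq_mul, neg_apply,
    zero_apply] at h hne
  refine (mul_left_cancel₀ hne ?_).symm
  linear_combination h

theorem covDeriv_congr {f f' : Plane → ℝ} {y : Plane} (h : f =ᶠ[nhds y] f') (i : Fin 2) :
    F.covDeriv f i =ᶠ[nhds y] F.covDeriv f' i :=
  (h.fderiv (𝕜 := ℝ)).mono fun z hz => by simp only [covDeriv, hz]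

theorem covDeriv₂_congr {f f' : Plane → ℝ} {y : Plane} (h : f =ᶠ[nhds y] f') (i j : Fin 2) :
    F.covDeriv₂ f i j y = F.covDeriv₂ f' i j y := by
  simp only [covDeriv₂, (covDeriv_congr h _).fderiv_eq, (covDeriv_congr h _).self_of_nhds]

theorem hasFDerivAt_exp {u : Plane → ℝ} (hu : ContDiffOn ℝ ∞ u F.chart.target) (c : ℝ)
    {y : Plane} (hy : y ∈ F.chart.target) :
    HasFDerivAt (fun z => Real.exp (c * u z)) ((c * Real.exp (c * u y)) • fderiv ℝ u y) y := by
  refine ((differentiableAt_of_smooth hu hy).hasFDerivAt.const_mul c).exp.congr_fderiv ?_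
  ext v
  simp only [smul_apply, smul_eq_mul]
  ring

theorem covDeriv_exp {u : Plane → ℝ} (hu : ContDiffOn ℝ ∞ u F.chart.target) (c : ℝ)
    {y : Plane} (hy : y ∈ F.chart.target) (i : Fin 2) :
    F.covDeriv (fun z => Real.exp (c * u z)) i y = c * Real.exp (c * u y) * F.covDeriv u i y := by
  rw [covDeriv, (hasFDerivAt_exp hu c hy).fderiv, coeff_smul, covDeriv_apply]

/-- With `c = -3/2` the bracket is `u_ij - (3/2) u_i u_j`, the combination that occurs in the
integrability equations; this is the reason for the power `-3/4` in `q`. -/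
theorem covDeriv₂_exp {u : Plane → ℝ} (hu : ContDiffOn ℝ ∞ u F.chart.target) (c : ℝ)
    {y : Plane} (hy : y ∈ F.chart.target) (i j : Fin 2) :
    F.covDeriv₂ (fun z => Real.exp (c * u z)) i j y =
      c * Real.exp (c * u y) * (F.covDeriv₂ u i j y + c * F.covDeriv u i y * F.covDeriv u j y) := by
  have h : F.covDeriv (fun z => Real.exp (c * u z)) i =ᶠ[nhds y]
      fun z => c * Real.exp (c * u z) * F.covDeriv u i z :=
    Filter.eventually_of_mem (F.chart.open_target.mem_nhds hy) fun z hz => covDeriv_exp hu c hz i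
  have h' := ((hasFDerivAt_exp hu c hy).const_mul c).fun_mul
    (differentiableAt_of_smooth (F.smooth_covDeriv hu i) hy).hasFDerivAt
  have key : fderiv ℝ (F.covDeriv (fun z => Real.exp (c * u z)) i) y -
      ∑ l, F.covDeriv (fun z => Real.exp (c * u z)) l y • F.connectionMatrix l i y =
      (c * Real.exp (c * u y)) • (fderiv ℝ (F.covDeriv u i) y -
        ∑ l, F.covDeriv u l y • F.connectionMatrix l i y) +
      (c * Real.exp (c * u y) * c * F.covDeriv u i y) • fderiv ℝ u y := by
    rw [h.fderiv_eq, h'.fderiv]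
    ext v
    simp only [covDeriv_exp hu c hy, Fin.sum_univ_two, sub_apply, add_apply, smul_apply,
      smul_eq_mul]
    ring
  rw [covDeriv₂, key, coeff_add, coeff_smul, coeff_smul, covDeriv_apply]
  change _ * F.covDeriv₂ u i j y + _ = _
  ring

variable (F) in
/-- The function `½ log |K|`. -/
def logCurvature (y : Plane) : ℝ := 1 / 2 * Real.log |F.gaussCurvature y|

theorem smooth_logCurvature (hK : ∀ y ∈ F.chart.target, F.gaussCurvature y ≠ 0) :
    ContDiffOn ℝ ∞ F.logCurvature F.chart.target := by
  have h := contDiffOn_const (c := (1 / 2 : ℝ)).mul (F.smooth_gaussCurvature.log hK)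
  refine h.congr fun y _ => ?_
  simp [logCurvature, Real.log_abs]

theorem abs_gaussCurvature {y : Plane} (hK : F.gaussCurvature y ≠ 0) :
    |F.gaussCurvature y| = Real.exp (2 * F.logCurvature y) := by
  rw [logCurvature, ← mul_assoc]
  norm_num
  rw [Real.exp_log_eq_abs hK]

theorem q_eq_exp {y : Plane} (hK : F.gaussCurvature y ≠ 0) :
    F.q y = Real.exp (-(3 / 2) * F.logCurvature y) := by
  rw [q, abs_gaussCurvature hK, ← Real.exp_mul]
  ring_nf

/-- The equations for `q` in terms of `u = ½ log |K|`. -/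
theorem q_equations_iff (hK : ∀ y ∈ F.chart.target, F.gaussCurvature y ≠ 0) (s : ℝ) {y : Plane}
    (hy : y ∈ F.chart.target) :
    (F.covDeriv₂ F.q 0 0 y = -(3 * s) * F.q y ^ (-(1 / 3) : ℝ) ∧
      F.covDeriv₂ F.q 1 1 y = 3 * s * F.q y ^ (-(1 / 3) : ℝ) ∧
      F.covDeriv₂ F.q 0 1 y = 0 ∧ F.covDeriv₂ F.q 1 0 y = 0) ↔
    (F.covDeriv₂ F.logCurvature 0 0 y - 3 / 2 * F.covDeriv F.logCurvature 0 y ^ 2 =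
        2 * s * Real.exp (2 * F.logCurvature y) ∧
      F.covDeriv₂ F.logCurvature 1 1 y - 3 / 2 * F.covDeriv F.logCurvature 1 y ^ 2 =
        -(2 * s * Real.exp (2 * F.logCurvature y)) ∧
      F.covDeriv₂ F.logCurvature 0 1 y =
        3 / 2 * F.covDeriv F.logCurvature 0 y * F.covDeriv F.logCurvature 1 y) := by
  have hu := smooth_logCurvature hK
  have hq : F.q =ᶠ[nhds y] fun z => Real.exp (-(3 / 2) * F.logCurvature z) :=
    Filter.eventually_of_mem (F.chart.open_target.mem_nhds hy) fun z hz => q_eq_exp (hK z hz)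
  -- The exponent is `u/2`, written as `-(3/2)u + 2u` so that the common factor `q` can be cancelled
  -- from the equations.
  have hpow : F.q y ^ (-(1 / 3) : ℝ) =
      Real.exp (-(3 / 2) * F.logCurvature y) * Real.exp (2 * F.logCurvature y) := by
    rw [q_eq_exp (hK y hy), ← Real.exp_mul, ← Real.exp_add]
    ring_nf
  rw [hpow]
  simp only [covDeriv₂_congr hq, covDeriv₂_exp hu _ hy, ← covDeriv₂_symm hu hy]
  have hne := Real.exp_ne_zero (-(3 / 2) * F.logCurvature y)
  generalize Real.exp (-(3 / 2) * F.logCurvature y) = Q at *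
  constructor
  · rintro ⟨h₁, h₂, h₃, -⟩
    refine ⟨mul_left_cancel₀ hne ?_, mul_left_cancel₀ hne ?_, mul_left_cancel₀ hne ?_⟩
    · linear_combination -(2 / 3) * h₁
    · linear_combination -(2 / 3) * h₂
    · linear_combination -(2 / 3) * h₃
  · rintro ⟨h₁, h₂, h₃⟩
    refine ⟨?_, ?_, ?_, ?_⟩
    · linear_combination -(3 / 2) * Q * h₁
    · linear_combination -(3 / 2) * Q * h₂
    · linear_combination -(3 / 2) * Q * h₃
    · linear_combination -(3 / 2) * Q * h₃

end LocalCoframe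
end LorentzianMetric

/-! ### Pull-backs, extension of scalars, constant changes of generators, and dual frames. -/

section Pullback

variable {𝕜 : Type*} [RCLike 𝕜] {E E' : Type*} [NormedAddCommGroup E] [NormedSpace ℝ E]
  [NormedAddCommGroup E'] [NormedSpace ℝ E'] {ι κ : Type*} [Fintype ι]

/-- The exterior derivative of the pull-back of a form under a linear map. -/
theorem extD_comp {α : E' → Covector 𝕜 E'} (L : E →L[ℝ] E') {z : E}
    (hα : DifferentiableAt ℝ α (L z)) (v w : E) :
    extD (fun x => (α (L x)).comp L) z v w = extD α (L z) (L v) (L w) := by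
  have h : HasFDerivAt (fun x => (α (L x)).comp L) _ z :=
    (hα.hasFDerivAt.comp z L.hasFDerivAt).clm_comp (hasFDerivAt_const L z)
  rw [extD_apply, extD_apply, h.fderiv]
  simp

theorem extD_ofReal {φ : E → Covector ℝ E} {z : E} (hφ : DifferentiableAt ℝ φ z) (v w : E) :
    extD (fun x => (RCLike.ofRealCLM : ℝ →L[ℝ] 𝕜).comp (φ x)) z v w =
      ((extD φ z v w : ℝ) : 𝕜) := by
  have h : HasFDerivAt (fun x => (RCLike.ofRealCLM : ℝ →L[ℝ] 𝕜).comp (φ x)) _ z :=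
    (hasFDerivAt_const _ z).clm_comp hφ.hasFDerivAt
  rw [extD_apply, extD_apply, h.fderiv]
  simp

/-- The exterior derivative of a linear combination with constant coefficients. -/
theorem extD_const_combination {φ : ι → E → Covector 𝕜 E} {ψ : E → Covector 𝕜 E} (c : ι → 𝕜)
    {z : E} (hψ : ∀ x, ψ x = ∑ j, c j • φ j x) (hφ : ∀ j, DifferentiableAt ℝ (φ j) z) :
    extD ψ z = ∑ j, c j • extD (φ j) z := by
  obtain rfl : ψ = fun x => ∑ j, c j • φ j x := funext hψ
  ext v w
  simp only [extD_apply, fderiv_fun_sum fun j _ => (hφ j).fun_const_smul (c j),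
    fderiv_fun_const_smul (hφ _), sum_apply, smul_apply, Finset.sum_sub_distrib, smul_eq_mul,
    mul_sub]

/-- A family of linear combinations of `φ` with constant coefficients generates a smaller
differential ideal. -/
theorem ideal_le_of_const_combination {φ : ι → E → Covector 𝕜 E} {ψ : κ → E → Covector 𝕜 E}
    (c : κ → ι → 𝕜) {z : E} (hψ : ∀ i x, ψ i x = ∑ j, c i j • φ j x)
    (hφ : ∀ j, DifferentiableAt ℝ (φ j) z) :
    spanForms ψ z ≤ spanForms φ z ∧
    idealTwo (spanForms ψ z) (Set.range fun i => extD (ψ i) z) ≤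
      idealTwo (spanForms φ z) (Set.range fun j => extD (φ j) z) := by
  have h₁ : spanForms ψ z ≤ spanForms φ z := by
    rw [spanForms_le_iff]
    intro i
    rw [hψ i z]
    exact Submodule.sum_mem _ fun j _ => Submodule.smul_mem _ _ (mem_spanForms φ z j)
  refine ⟨h₁, idealTwo_le (fun α hα β => wedge_mem_idealTwo (h₁ hα) β) ?_⟩
  rintro _ ⟨i, rfl⟩
  change extD (ψ i) z ∈ _
  rw [extD_const_combination (c i) (hψ i) hφ]
  exact Submodule.sum_mem _ fun j _ => Submodule.smul_mem _ _ (mem_idealTwo_of_mem ⟨j, rfl⟩)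

/-- The frame dual to a coframe. -/
theorem exists_isMovingFrame [DecidableEq ι] [FiniteDimensional ℝ E] {O : Set E} (hO : IsOpen O)
    {φ : ι → E → Covector ℝ E} (hφ : ∀ i, ContDiffOn ℝ ∞ (φ i) O)
    (hinj : ∀ y ∈ O, ∀ v, (∀ i, φ i y v = 0) → v = 0)
    (hcard : Module.finrank ℝ E = Fintype.card ι) : ∃ e : ι → E → E,
      IsMovingFrame O e (fun i z => (RCLike.ofRealCLM : ℝ →L[ℝ] 𝕜).comp (φ i z)) := by
  have : CompleteSpace E := FiniteDimensional.complete ℝ E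
  let L : E → E →L[ℝ] (ι → ℝ) := fun y => ContinuousLinearMap.pi fun i => φ i y
  have hL : ContDiffOn ℝ ∞ L O := contDiffOn_clm_apply.2 fun v =>
    contDiffOn_pi.2 fun i => (hφ i).clm_apply contDiffOn_const
  have hequiv : ∀ y ∈ O, ∃ T : E ≃L[ℝ] (ι → ℝ), (T : E →L[ℝ] (ι → ℝ)) = L y := by
    intro y hy
    have hi : Function.Injective (L y : E →ₗ[ℝ] (ι → ℝ)) := by
      rw [injective_iff_map_eq_zero]
      exact fun v hv => hinj y hy v fun i => congrFun hv i
    refine ⟨(LinearEquiv.ofInjectiveOfFinrankEq (L y : E →ₗ[ℝ] (ι → ℝ)) hi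
      (by rw [hcard, Module.finrank_fintype_fun_eq_card])).toContinuousLinearEquiv, ?_⟩
    ext v i
    rfl
  -- The dual frame consists of the columns of the inverse of the coframe, regarded as a map to `ι →
  -- ℝ`; it is smooth because inversion of linear isomorphisms is.
  let e : ι → E → E := fun i y => (L y).inverse (Pi.single i 1)
  have he : ∀ y ∈ O, ∀ i j, φ i y (e j y) = if i = j then 1 else 0 := by
    intro y hy i j
    obtain ⟨T, hT⟩ := hequiv y hy
    have h : L y (e j y) = Pi.single j 1 := by
      simp only [e]
      rw [← hT, ContinuousLinearMap.inverse_equiv]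
      exact T.apply_symm_apply _
    have := congrFun h i
    rw [Pi.single_apply] at this
    exact this
  refine ⟨e, hO, ?_, ?_, ?_, ?_, ?_⟩
  · intro i y hy
    obtain ⟨T, hT⟩ := hequiv y hy
    have h₁ : ContDiffAt ℝ ∞ ContinuousLinearMap.inverse (L y) := hT ▸ contDiffAt_map_inverse T
    exact ((h₁.comp_contDiffWithinAt y (hL y hy)).clm_apply contDiffWithinAt_const)
  · exact fun i => contDiffOn_const.clm_comp (hφ i)
  · intro y hy i
    simp [he y hy]
  · intro y hy i j hij
    simp [he y hy, hij]
  · intro y hy ψ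
    ext v
    have hv : v = ∑ i, φ i y v • e i y := by
      rw [← sub_eq_zero]
      refine hinj y hy _ fun i => ?_
      rw [map_sub, map_sum]
      simp [he y hy]
    conv_lhs => rw [hv]
    rw [map_sum, sum_apply]
    refine Finset.sum_congr rfl fun i _ => ?_
    rw [map_smul, smul_apply, smul_eq_mul, mul_comm]
    simp [Algebra.smul_def, RCLike.algebraMap_eq_ofReal]

end Pullback

/-! ### The null coframe on the product and its structure equations. -/

namespace LorentzianMetric

variable {M : Type*} [TopologicalSpace M] [ChartedSpace Plane M] [IsManifold (𝓡 2) ∞ M]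
  {g : LorentzianMetric M}

variable (F : LocalCoframe g) (G : MinkowskiFrames)

/-- The forms `η⁰`, `η¹`, `η⁰₁`, `ω⁰`, `ω¹`, `ω²`, `ω⁰₁`, `ω²₀`, `ω²₁` on the product. -/
def productForms : Fin 9 → Plane × Six → Covector ℝ (Plane × Six) :=
  let fromM (α : Plane → Covector ℝ Plane) (z : Plane × Six) : Covector ℝ (Plane × Six) :=
    (α z.1).comp (ContinuousLinearMap.fst ℝ Plane Six)
  let fromN (β : Six → Covector ℝ Six) (z : Plane × Six) : Covector ℝ (Plane × Six) :=
    (β z.2).comp (ContinuousLinearMap.snd ℝ Plane Six)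
  ![fromM (F.η 0), fromM (F.η 1), fromM F.connection, fromN (G.canonical 0), fromN (G.canonical 1),
    fromN (G.canonical 2), fromN (G.connection 0 1), fromN (G.connection 2 0),
    fromN (G.connection 2 1)]

/-- The coefficients of the null coframe in the forms `productForms`. -/
def nullCoeff : Fin 8 → Fin 9 → ℝ :=
  ![![0, 0, 0, 0, 0, 1, 0, 0, 0], ![-1, -1, 0, 1, 1, 0, 0, 0, 0], ![-1, 1, 0, 1, -1, 0, 0, 0, 0],
    ![0, 0, -1, 0, 0, 0, 1, 0, 0], ![0, 0, 0, 0, 0, 0, 0, 1, 1], ![0, 0, 0, 0, 0, 0, 0, 1, -1],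
    ![1, 1, 0, 0, 0, 0, 0, 0, 0], ![1, -1, 0, 0, 0, 0, 0, 0, 0]]

/-- A null coframe on the product, that begins with generators of the embedding system. -/
def nullCoframe (i : Fin 8) (z : Plane × Six) : Covector ℝ (Plane × Six) :=
  ∑ j, nullCoeff i j • productForms F G j z

/-- The values of `productForms` and of their exterior derivatives. -/
def productValues (z v : Plane × Six) : Fin 9 → ℝ :=
  ![F.η 0 z.1 v.1, F.η 1 z.1 v.1, F.connection z.1 v.1, G.canonical 0 z.2 v.2,
    G.canonical 1 z.2 v.2, G.canonical 2 z.2 v.2, G.connection 0 1 z.2 v.2,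
    G.connection 2 0 z.2 v.2, G.connection 2 1 z.2 v.2]

theorem productForms_apply (z v : Plane × Six) (j : Fin 9) :
    productForms F G j z v = productValues F G z v j := by
  fin_cases j <;> rfl

theorem nullCoframe_apply (i : Fin 8) (z v : Plane × Six) :
    nullCoframe F G i z v = ∑ j, nullCoeff i j * productValues F G z v j := by
  simp only [nullCoframe, sum_apply, smul_apply, smul_eq_mul, productForms_apply]

theorem smooth_productForms (j : Fin 9) :
    ContDiffOn ℝ ∞ (productForms F G j) (F.chart.target ×ˢ G.domain) := by
  have h₁ : ∀ {α : Plane → Covector ℝ Plane}, ContDiffOn ℝ ∞ α F.chart.target →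
      ContDiffOn ℝ ∞ (fun z : Plane × Six =>
        (α z.1).comp (ContinuousLinearMap.fst ℝ Plane Six)) (F.chart.target ×ˢ G.domain) :=
    fun h => (h.comp contDiffOn_fst fun z hz => hz.1).clm_comp contDiffOn_const
  have h₂ : ∀ {β : Six → Covector ℝ Six}, ContDiffOn ℝ ∞ β G.domain →
      ContDiffOn ℝ ∞ (fun z : Plane × Six =>
        (β z.2).comp (ContinuousLinearMap.snd ℝ Plane Six)) (F.chart.target ×ˢ G.domain) :=
    fun h => (h.comp contDiffOn_snd fun z hz => hz.2).clm_comp contDiffOn_const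
  fin_cases j
  · exact h₁ (F.smooth 0)
  · exact h₁ (F.smooth 1)
  · exact h₁ F.smooth_connection
  · exact h₂ (MinkowskiFrames.smooth_component G.smooth_base 0)
  · exact h₂ (MinkowskiFrames.smooth_component G.smooth_base 1)
  · exact h₂ (MinkowskiFrames.smooth_component G.smooth_base 2)
  · exact h₂ (MinkowskiFrames.smooth_component (G.smooth_frame 1) 0)
  · exact h₂ (MinkowskiFrames.smooth_component (G.smooth_frame 0) 2)
  · exact h₂ (MinkowskiFrames.smooth_component (G.smooth_frame 1) 2)

theorem smooth_nullCoframe (i : Fin 8) :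
    ContDiffOn ℝ ∞ (nullCoframe F G i) (F.chart.target ×ˢ G.domain) :=
  ContDiffOn.sum fun j _ => (smooth_productForms F G j).const_smul (nullCoeff i j)

theorem isOpen_product : IsOpen (F.chart.target ×ˢ G.domain) :=
  F.chart.open_target.prod G.isOpen_domain

variable {F G}

theorem differentiableAt_productForms {z : Plane × Six} (hz : z ∈ F.chart.target ×ˢ G.domain)
    (j : Fin 9) : DifferentiableAt ℝ (productForms F G j) z :=
  ((smooth_productForms F G j).contDiffAt ((isOpen_product F G).mem_nhds hz)).differentiableAt
    (by simp)

/-- `χ 6` and `χ 7` determine the surface component of `v`. Once this vanishes, so does the surface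
connection form, and the other six forms become combinations of the coframe of the frame bundle. -/
theorem eq_zero_of_nullCoframe {z : Plane × Six} (hz : z ∈ F.chart.target ×ˢ G.domain)
    (v : Plane × Six) (h : ∀ i, nullCoframe F G i z v = 0) : v = 0 := by
  have h0 := h 0
  have h1 := h 1
  have h2 := h 2
  have h3 := h 3
  have h4 := h 4
  have h5 := h 5
  have h6 := h 6
  have h7 := h 7
  simp [nullCoframe_apply, nullCoeff, productValues, Fin.sum_univ_succ] at h0 h1 h2 h3 h4 h5 h6 h7
  have e0 : F.η 0 z.1 v.1 = 0 := by linarith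
  have e1 : F.η 1 z.1 v.1 = 0 := by linarith
  have hcov : ∀ α : Covector ℝ Plane, α v.1 = 0 := by
    intro α
    rw [F.eq_sum_coeff hz.1 α, Fin.sum_univ_two]
    simp [e0, e1]
  have hv₁ : v.1 = 0 := by
    ext i
    exact hcov (EuclideanSpace.proj i)
  have hΓ := hcov (F.connection z.1)
  have hv₂ : v.2 = 0 := by
    refine MinkowskiFrames.eq_zero_of_forms hz.2 ?_ (by linarith) (by linarith) (by linarith)
    intro i
    fin_cases i
    · change G.canonical 0 z.2 v.2 = 0
      linarith
    · change G.canonical 1 z.2 v.2 = 0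
      linarith
    · exact h0
  exact Prod.ext hv₁ hv₂

/-- The structure equations on the product. -/
theorem extD_productForms {z : Plane × Six} (hz : z ∈ F.chart.target ×ˢ G.domain)
    (j : Fin 9) (v w : Plane × Six) :
    let x := productValues F G z v
    let y := productValues F G z w
    extD (productForms F G j) z v w =
      ![-(x 2 * y 1 - y 2 * x 1), -(x 2 * y 0 - y 2 * x 0),
        -F.gaussCurvature z.1 * (x 0 * y 1 - x 1 * y 0),
        -(x 6 * y 4 - y 6 * x 4) - (x 7 * y 5 - y 7 * x 5),
        -(x 6 * y 3 - y 6 * x 3) + (x 8 * y 5 - y 8 * x 5),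
        -(x 7 * y 3 - y 7 * x 3) - (x 8 * y 4 - y 8 * x 4),
        -(x 7 * y 8 - y 7 * x 8), -(x 8 * y 6 - y 8 * x 6), -(x 7 * y 6 - y 7 * x 6)] j := by
  intro x y
  have hM : ∀ {α : Plane → Covector ℝ Plane}, ContDiffOn ℝ ∞ α F.chart.target →
      extD (fun z : Plane × Six => (α z.1).comp (ContinuousLinearMap.fst ℝ Plane Six)) z v w =
        extD α z.1 v.1 w.1 := fun h =>
    extD_comp (ContinuousLinearMap.fst ℝ Plane Six)
      (LocalCoframe.differentiableAt_of_smooth h hz.1) v w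
  have hN : ∀ {f : Six → Fin 3 → ℝ}, ContDiffOn ℝ ∞ f G.domain → ∀ i,
      extD (fun z : Plane × Six =>
        (G.component f i z.2).comp (ContinuousLinearMap.snd ℝ Plane Six)) z v w =
        extD (G.component f i) z.2 v.2 w.2 := fun h i =>
    extD_comp (ContinuousLinearMap.snd ℝ Plane Six)
      (((MinkowskiFrames.smooth_component h i).contDiffAt
        (G.isOpen_domain.mem_nhds hz.2)).differentiableAt (by simp)) v w
  have hs := fun i j u => MinkowskiFrames.connection_symm hz.2 i j u
  have h00 : ∀ u, G.connection 0 0 z.2 u = 0 := fun u => by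
    have := hs 0 0 u; simp [minkowskiSign] at this; linarith
  have h11 : ∀ u, G.connection 1 1 z.2 u = 0 := fun u => by
    have := hs 1 1 u; simp [minkowskiSign] at this; linarith
  have h22 : ∀ u, G.connection 2 2 z.2 u = 0 := fun u => by
    have := hs 2 2 u; simp [minkowskiSign] at this; linarith
  have h10 : ∀ u, G.connection 1 0 z.2 u = G.connection 0 1 z.2 u := fun u => by
    have := hs 1 0 u; simp [minkowskiSign] at this; linarith
  have h02 : ∀ u, G.connection 0 2 z.2 u = G.connection 2 0 z.2 u := fun u => by
    have := hs 0 2 u; simp [minkowskiSign] at this; linarith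
  have h12 : ∀ u, G.connection 1 2 z.2 u = -G.connection 2 1 z.2 u := fun u => by
    have := hs 1 2 u; simp [minkowskiSign] at this; linarith
  obtain ⟨s0, s1, s2⟩ := F.structure_equations hz.1
  have hb : ∀ i u, G.component G.base i z.2 u = G.canonical i z.2 u := fun _ _ => rfl
  have hf : ∀ i j u, G.component (G.frame j) i z.2 u = G.connection i j z.2 u :=
    fun _ _ _ => rfl
  fin_cases j
  · refine (hM (F.smooth 0)).trans ?_
    simp [s0, wedge_apply, x, y, productValues]
    ring
  · refine (hM (F.smooth 1)).trans ?_
    simp [s1, wedge_apply, x, y, productValues]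
    ring
  · refine (hM F.smooth_connection).trans ?_
    simp [s2, wedge_apply, x, y, productValues]
  · refine (hN G.smooth_base 0).trans ?_
    rw [MinkowskiFrames.extD_component G.smooth_base hz.2, Fin.sum_univ_three]
    simp [hb, h00, h02, x, y, productValues]
    ring
  · refine (hN G.smooth_base 1).trans ?_
    rw [MinkowskiFrames.extD_component G.smooth_base hz.2, Fin.sum_univ_three]
    simp [hb, h11, h10, h12, x, y, productValues]
    ring
  · refine (hN G.smooth_base 2).trans ?_
    rw [MinkowskiFrames.extD_component G.smooth_base hz.2, Fin.sum_univ_three]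
    simp [hb, h22, x, y, productValues]
    ring
  · refine (hN (G.smooth_frame 1) 0).trans ?_
    rw [MinkowskiFrames.extD_component (G.smooth_frame 1) hz.2, Fin.sum_univ_three]
    simp [hf, h00, h11, h02, x, y, productValues]
  · refine (hN (G.smooth_frame 0) 2).trans ?_
    rw [MinkowskiFrames.extD_component (G.smooth_frame 0) hz.2, Fin.sum_univ_three]
    simp [hf, h00, h22, h10, x, y, productValues]
  · refine (hN (G.smooth_frame 1) 2).trans ?_
    rw [MinkowskiFrames.extD_component (G.smooth_frame 1) hz.2, Fin.sum_univ_three]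
    simp [hf, h22, h11, x, y, productValues]

end LorentzianMetric

/-! ### Null components of the derivatives of `½ log |K|`. -/

namespace LorentzianMetric

variable {M : Type*} [TopologicalSpace M] [ChartedSpace Plane M] [IsManifold (𝓡 2) ∞ M]
  {g : LorentzianMetric M}

namespace LocalCoframe

variable (F : LocalCoframe g)

/-- The first of the null components of the differential of `½ log |K|`. -/
def logDerivPlus (y : Plane) : ℝ :=
  1 / 2 * (F.covDeriv F.logCurvature 0 y + F.covDeriv F.logCurvature 1 y)

/-- The second of the null components of the differential of `½ log |K|`. -/
def logDerivMinus (y : Plane) : ℝ :=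
  1 / 2 * (F.covDeriv F.logCurvature 0 y - F.covDeriv F.logCurvature 1 y)

/-- The defects of the three equations for the second derivatives of `u = ½ log |K|`, in null
components. -/
def logDefect (s : ℝ) : Fin 3 → Plane → ℝ :=
  ![fun y => 1 / 4 * (F.covDeriv₂ F.logCurvature 0 0 y + F.covDeriv₂ F.logCurvature 1 0 y +
        F.covDeriv₂ F.logCurvature 0 1 y + F.covDeriv₂ F.logCurvature 1 1 y) -
      1 / 2 * F.logDerivPlus y ^ 2,
    fun y => 1 / 4 * (F.covDeriv₂ F.logCurvature 0 0 y + F.covDeriv₂ F.logCurvature 1 0 y -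
        F.covDeriv₂ F.logCurvature 0 1 y - F.covDeriv₂ F.logCurvature 1 1 y) -
      s * Real.exp (F.logCurvature y) ^ 2 - 1 / 2 * F.logDerivPlus y * F.logDerivMinus y,
    fun y => 1 / 4 * (F.covDeriv₂ F.logCurvature 0 0 y - F.covDeriv₂ F.logCurvature 1 0 y -
        F.covDeriv₂ F.logCurvature 0 1 y + F.covDeriv₂ F.logCurvature 1 1 y) -
      1 / 2 * F.logDerivMinus y ^ 2]

/-- The null components of the connection form. -/
def connectionNull : Fin 2 → Plane → ℝ :=
  ![fun y => 1 / 2 * (F.coeff y (F.connection y) 0 + F.coeff y (F.connection y) 1),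
    fun y => 1 / 2 * (F.coeff y (F.connection y) 0 - F.coeff y (F.connection y) 1)]

variable {F}

theorem smooth_covDeriv₂ {f : Plane → ℝ} (hf : ContDiffOn ℝ ∞ f F.chart.target) (i j : Fin 2) :
    ContDiffOn ℝ ∞ (F.covDeriv₂ f i j) F.chart.target := by
  refine F.smooth_coeff (ContDiffOn.sub
    ((F.smooth_covDeriv hf i).fderiv_of_isOpen F.chart.open_target (by simp))
    (ContDiffOn.sum fun l _ => (F.smooth_covDeriv hf l).smul ?_)) j
  unfold connectionMatrix
  split_ifs
  · exact contDiffOn_const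
  · exact F.smooth_connection

theorem smooth_logDerivPlus (hK : ∀ y ∈ F.chart.target, F.gaussCurvature y ≠ 0) :
    ContDiffOn ℝ ∞ F.logDerivPlus F.chart.target :=
  contDiffOn_const.mul ((F.smooth_covDeriv (smooth_logCurvature hK) 0).add
    (F.smooth_covDeriv (smooth_logCurvature hK) 1))

theorem smooth_logDerivMinus (hK : ∀ y ∈ F.chart.target, F.gaussCurvature y ≠ 0) :
    ContDiffOn ℝ ∞ F.logDerivMinus F.chart.target :=
  contDiffOn_const.mul ((F.smooth_covDeriv (smooth_logCurvature hK) 0).sub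
    (F.smooth_covDeriv (smooth_logCurvature hK) 1))

theorem smooth_logDefect (hK : ∀ y ∈ F.chart.target, F.gaussCurvature y ≠ 0) (s : ℝ)
    (i : Fin 3) : ContDiffOn ℝ ∞ (F.logDefect s i) F.chart.target := by
  have hu := smooth_logCurvature hK
  have h := smooth_covDeriv₂ hu
  have hp := smooth_logDerivPlus hK
  have hm := smooth_logDerivMinus hK
  fin_cases i
  · exact (contDiffOn_const.mul ((((h 0 0).add (h 1 0)).add (h 0 1)).add (h 1 1))).sub
      (contDiffOn_const.mul (hp.pow 2))
  · exact ((contDiffOn_const.mul ((((h 0 0).add (h 1 0)).sub (h 0 1)).sub (h 1 1))).sub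
      (contDiffOn_const.mul (hu.exp.pow 2))).sub ((contDiffOn_const.mul hp).mul hm)
  · exact (contDiffOn_const.mul ((((h 0 0).sub (h 1 0)).sub (h 0 1)).add (h 1 1))).sub
      (contDiffOn_const.mul (hm.pow 2))

/-- In null components the connection acts diagonally, with weight `1` on this component and `-1` on
the other. The `logDefect`s are what remains of the second derivatives after the terms prescribed in
`IsSingularCoframe` are split off. -/
theorem hasFDerivAt_logDerivPlus (hK : ∀ y ∈ F.chart.target, F.gaussCurvature y ≠ 0) (s : ℝ)
    {y : Plane} (hy : y ∈ F.chart.target) : HasFDerivAt F.logDerivPlus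
      ((F.logDerivPlus y * F.connectionNull 0 y + F.logDefect s 0 y + F.logDerivPlus y ^ 2 / 2) •
        (F.η 0 y + F.η 1 y) +
      (F.logDerivPlus y * F.connectionNull 1 y + F.logDefect s 1 y +
        s * Real.exp (F.logCurvature y) ^ 2 + F.logDerivPlus y * F.logDerivMinus y / 2) •
        (F.η 0 y - F.η 1 y)) y := by
  have hu := smooth_logCurvature hK
  have hd := fun i => (differentiableAt_of_smooth (F.smooth_covDeriv hu i) hy).hasFDerivAt
  refine (((hd 0).add (hd 1)).const_mul (1 / 2)).congr_fderiv ?_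
  ext v
  have hΓ := congrArg (fun T : Covector ℝ Plane => T v) (F.eq_sum_coeff hy (F.connection y))
  simp only [Fin.sum_univ_two, add_apply, smul_apply, smul_eq_mul] at hΓ
  simp only [fderiv_covDeriv_zero hy, fderiv_covDeriv_one hy, add_apply, smul_apply, sub_apply,
    smul_eq_mul, logDefect, connectionNull, Matrix.cons_val_zero, Matrix.cons_val_one]
  rw [hΓ]
  simp only [logDerivPlus]
  ring

theorem hasFDerivAt_logDerivMinus (hK : ∀ y ∈ F.chart.target, F.gaussCurvature y ≠ 0) (s : ℝ)
    {y : Plane} (hy : y ∈ F.chart.target) : HasFDerivAt F.logDerivMinus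
      ((-F.logDerivMinus y * F.connectionNull 0 y + F.logDefect s 1 y +
        s * Real.exp (F.logCurvature y) ^ 2 + F.logDerivPlus y * F.logDerivMinus y / 2) •
        (F.η 0 y + F.η 1 y) +
      (-F.logDerivMinus y * F.connectionNull 1 y + F.logDefect s 2 y +
        F.logDerivMinus y ^ 2 / 2) • (F.η 0 y - F.η 1 y)) y := by
  have hu := smooth_logCurvature hK
  have hd := fun i => (differentiableAt_of_smooth (F.smooth_covDeriv hu i) hy).hasFDerivAt
  refine (((hd 0).sub (hd 1)).const_mul (1 / 2)).congr_fderiv ?_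
  ext v
  have hΓ := congrArg (fun T : Covector ℝ Plane => T v) (F.eq_sum_coeff hy (F.connection y))
  simp only [Fin.sum_univ_two, add_apply, smul_apply, smul_eq_mul] at hΓ
  simp only [fderiv_covDeriv_zero hy, fderiv_covDeriv_one hy, add_apply, smul_apply, sub_apply,
    smul_eq_mul, logDefect, connectionNull, Matrix.cons_val_zero, Matrix.cons_val_one,
    Matrix.cons_val]
  rw [hΓ, covDeriv₂_symm hu hy]
  simp only [logDerivMinus]
  ring

theorem hasFDerivAt_exp_logCurvature (hK : ∀ y ∈ F.chart.target, F.gaussCurvature y ≠ 0)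
    {y : Plane} (hy : y ∈ F.chart.target) :
    HasFDerivAt (fun z => Real.exp (F.logCurvature z))
      ((Real.exp (F.logCurvature y) * F.logDerivPlus y) • (F.η 0 y + F.η 1 y) +
        (Real.exp (F.logCurvature y) * F.logDerivMinus y) • (F.η 0 y - F.η 1 y)) y := by
  refine (differentiableAt_of_smooth (smooth_logCurvature hK) hy).hasFDerivAt.exp.congr_fderiv ?_
  rw [fderiv_eq hy]
  ext v
  simp only [add_apply, smul_apply, sub_apply, smul_eq_mul, logDerivPlus, logDerivMinus]
  ring

/-- The differential of a function in the null coframe. -/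
theorem exists_hasFDerivAt_null {f : Plane → ℝ} (hf : ContDiffOn ℝ ∞ f F.chart.target)
    {y : Plane} (hy : y ∈ F.chart.target) : ∃ a b : ℝ,
      HasFDerivAt f (a • (F.η 0 y + F.η 1 y) + b • (F.η 0 y - F.η 1 y)) y := by
  refine ⟨1 / 2 * (F.covDeriv f 0 y + F.covDeriv f 1 y),
    1 / 2 * (F.covDeriv f 0 y - F.covDeriv f 1 y),
    (differentiableAt_of_smooth hf hy).hasFDerivAt.congr_fderiv ?_⟩
  rw [fderiv_eq hy]
  ext v
  simp only [add_apply, smul_apply, sub_apply, smul_eq_mul]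
  ring

/-- The terms `½ p²`, `½ p m`, `½ m²` subtracted in the defects combine with the right sides into
the factor `3/2`. What remains is the linear passage between null and orthonormal components of a
symmetric tensor. -/
theorem logDefect_iff (hK : ∀ y ∈ F.chart.target, F.gaussCurvature y ≠ 0) (s : ℝ) {y : Plane}
    (hy : y ∈ F.chart.target) :
    (F.logDefect s 0 y = F.logDerivPlus y ^ 2 ∧
      F.logDefect s 1 y = F.logDerivPlus y * F.logDerivMinus y ∧
      F.logDefect s 2 y = F.logDerivMinus y ^ 2) ↔
    (F.covDeriv₂ F.q 0 0 y = -(3 * s) * F.q y ^ (-(1 / 3) : ℝ) ∧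
      F.covDeriv₂ F.q 1 1 y = 3 * s * F.q y ^ (-(1 / 3) : ℝ) ∧
      F.covDeriv₂ F.q 0 1 y = 0 ∧ F.covDeriv₂ F.q 1 0 y = 0) := by
  rw [q_equations_iff hK s hy, two_mul (F.logCurvature y), Real.exp_add]
  simp only [logDefect, Matrix.cons_val_zero, Matrix.cons_val_one, Matrix.cons_val, logDerivPlus,
    logDerivMinus, ← covDeriv₂_symm (smooth_logCurvature hK) hy]
  constructor
  · rintro ⟨h₁, h₂, h₃⟩
    exact ⟨by linear_combination h₁ + 2 * h₂ + h₃, by linear_combination h₁ - 2 * h₂ + h₃,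
      by linear_combination h₁ - h₃⟩
  · rintro ⟨h₁, h₂, h₃⟩
    exact ⟨by linear_combination 1 / 4 * h₁ + 1 / 2 * h₃ + 1 / 4 * h₂,
      by linear_combination 1 / 4 * h₁ - 1 / 4 * h₂,
      by linear_combination 1 / 4 * h₁ - 1 / 2 * h₃ + 1 / 4 * h₂⟩

end LocalCoframe
end LorentzianMetric

/-! ### The embedding system as a singular coframe, and the criterion over `𝕜`. -/

namespace LorentzianMetric

variable {M : Type*} [TopologicalSpace M] [ChartedSpace Plane M] [IsManifold (𝓡 2) ∞ M]
  {g : LorentzianMetric M}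

variable (𝕜 : Type*) [RCLike 𝕜] (F : LocalCoframe g) (G : MinkowskiFrames)

/-- The null coframe, with values in `𝕜`. -/
def scalarCoframe (i : Fin 8) (z : Plane × Six) : Covector 𝕜 (Plane × Six) :=
  (RCLike.ofRealCLM : ℝ →L[ℝ] 𝕜).comp (nullCoframe F G i z)

theorem scalarCoframe_apply (i : Fin 8) (z v : Plane × Six) :
    scalarCoframe 𝕜 F G i z v =
      ((∑ j, nullCoeff i j * productValues F G z v j : ℝ) : 𝕜) := by
  rw [← nullCoframe_apply]
  rfl

variable {F G}

theorem extD_scalarCoframe {z : Plane × Six} (hz : z ∈ F.chart.target ×ˢ G.domain) (i : Fin 8)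
    (v w : Plane × Six) : extD (scalarCoframe 𝕜 F G i) z v w =
      ((∑ j, nullCoeff i j * extD (productForms F G j) z v w : ℝ) : 𝕜) := by
  refine (extD_ofReal ((smooth_nullCoframe F G i).contDiffAt
    ((isOpen_product F G).mem_nhds hz) |>.differentiableAt (by simp)) v w).trans ?_
  rw [extD_const_combination (ψ := nullCoframe F G i) (nullCoeff i) (fun _ => rfl)
    (differentiableAt_productForms hz)]
  simp only [sum_apply, smul_apply, smul_eq_mul]

theorem hasNullDeriv_ofReal {f : Plane → ℝ} {z : Plane × Six} {a b : ℝ}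
    (hf : HasFDerivAt f (a • (F.η 0 z.1 + F.η 1 z.1) + b • (F.η 0 z.1 - F.η 1 z.1)) z.1) :
    HasNullDeriv (scalarCoframe 𝕜 F G) z (fun x => ((f x.1 : ℝ) : 𝕜)) a b := by
  have h := (RCLike.ofRealCLM : ℝ →L[ℝ] 𝕜).hasFDerivAt.comp z
    (hf.comp z (ContinuousLinearMap.fst ℝ Plane Six).hasFDerivAt)
  refine HasFDerivAt.congr_fderiv h ?_
  refine ContinuousLinearMap.ext fun v => ?_
  simp only [add_apply, smul_apply, smul_eq_mul, scalarCoframe_apply, nullCoeff, productValues,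
    Fin.sum_univ_succ]
  simp [RCLike.real_smul_eq_coe_mul]
  ring

theorem smooth_ofReal {f : Plane → ℝ} (hf : ContDiffOn ℝ ∞ f F.chart.target) :
    ContDiffOn ℝ ∞ (fun z : Plane × Six => ((f z.1 : ℝ) : 𝕜)) (F.chart.target ×ˢ G.domain) :=
  (RCLike.ofRealCLM : ℝ →L[ℝ] 𝕜).contDiff.comp_contDiffOn
    (hf.comp contDiffOn_fst fun _ hz => hz.1)

/-- The normalized defects of the three equations for the curvature. -/
def scaledDefect (F : LocalCoframe g) (ζ : 𝕜) (s : ℝ) (i : Fin 3) (z : Plane × Six) : 𝕜 :=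
  ζ⁻¹ * ((Real.exp (-F.logCurvature z.1) / 2 * F.logDefect s i z.1 : ℝ) : 𝕜)

variable {𝕜}

/-- With `k = ζ exp u`, the functions `a`, `b`, `c` are the defects divided by `2k`, so the products
`2k a`, `2k b`, `2k c` are real even when `k` is imaginary. -/
theorem two_mul_scaledDefect {ζ : 𝕜} (hζ : ζ ≠ 0) (s : ℝ) (i : Fin 3) (z : Plane × Six) :
    2 * (ζ * ((Real.exp (F.logCurvature z.1) : ℝ) : 𝕜)) * scaledDefect 𝕜 F ζ s i z =
      ((F.logDefect s i z.1 : ℝ) : 𝕜) := by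
  have h : 2 * (Real.exp (F.logCurvature z.1) *
      (Real.exp (-F.logCurvature z.1) / 2 * F.logDefect s i z.1)) = F.logDefect s i z.1 := by
    have := Real.exp_ne_zero (F.logCurvature z.1)
    rw [Real.exp_neg]
    field_simp
  rw [scaledDefect]
  conv_rhs => rw [← h]
  push_cast
  field_simp

/-- The null coframe of the isometric embedding system is a singular coframe. -/
theorem exists_isSingularCoframe (G : MinkowskiFrames)
    (hK : ∀ y ∈ F.chart.target, F.gaussCurvature y ≠ 0)
    {ζ : 𝕜} (hζ : ζ ≠ 0) {s : ℝ} (hs : ζ ^ 2 = (s : 𝕜))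
    (hKs : ∀ y ∈ F.chart.target, F.gaussCurvature y = -s * |F.gaussCurvature y|) :
    ∃ e, IsSingularCoframe (F.chart.target ×ˢ G.domain) e (scalarCoframe 𝕜 F G)
      (fun z => ζ * ((Real.exp (F.logCurvature z.1) : ℝ) : 𝕜))
      (fun z => ((F.logDerivPlus z.1 : ℝ) : 𝕜)) (fun z => ((F.logDerivMinus z.1 : ℝ) : 𝕜))
      (scaledDefect 𝕜 F ζ s 0) (scaledDefect 𝕜 F ζ s 1) (scaledDefect 𝕜 F ζ s 2)
      (fun z => ((F.connectionNull 0 z.1 : ℝ) : 𝕜))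
      (fun z => ((F.connectionNull 1 z.1 : ℝ) : 𝕜)) := by
  obtain ⟨e, he⟩ := exists_isMovingFrame (𝕜 := 𝕜) (isOpen_product F G) (smooth_nullCoframe F G)
    (fun z hz => eq_zero_of_nullCoframe hz) (by simp)
  have hk2 : ∀ z : Plane × Six, (ζ * ((Real.exp (F.logCurvature z.1) : ℝ) : 𝕜)) ^ 2 =
      ((s * Real.exp (F.logCurvature z.1) ^ 2 : ℝ) : 𝕜) := fun z => by
    rw [mul_pow, hs]
    push_cast
    rfl
  have hu := LocalCoframe.smooth_logCurvature hK
  have hdefect : ∀ i, ∀ z ∈ F.chart.target ×ˢ G.domain, ∃ a b : 𝕜,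
      HasFDerivAt (scaledDefect 𝕜 F ζ s i)
        (a • scalarCoframe 𝕜 F G 6 z + b • scalarCoframe 𝕜 F G 7 z) z := by
    intro i z hz
    obtain ⟨a, b, h⟩ := LocalCoframe.exists_hasFDerivAt_null
      ((hu.neg.exp.div_const 2).mul (LocalCoframe.smooth_logDefect hK s i)) hz.1
    exact ⟨_, _, (hasNullDeriv_ofReal 𝕜 (G := G) h).const_mul ζ⁻¹⟩
  have hΓ : ∀ (z v : Plane × Six), z ∈ F.chart.target ×ˢ G.domain → F.connection z.1 v.1 =
      F.connectionNull 0 z.1 * (F.η 0 z.1 v.1 + F.η 1 z.1 v.1) +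
        F.connectionNull 1 z.1 * (F.η 0 z.1 v.1 - F.η 1 z.1 v.1) := by
    intro z v hz
    have h := congrArg (fun T : Covector ℝ Plane => T v.1)
      (F.eq_sum_coeff hz.1 (F.connection z.1))
    simp only [Fin.sum_univ_two, add_apply, smul_apply, smul_eq_mul] at h
    rw [h]
    simp only [LocalCoframe.connectionNull, Matrix.cons_val_zero, Matrix.cons_val_one]
    ring
  have hcurv : ∀ z ∈ F.chart.target ×ˢ G.domain,
      F.gaussCurvature z.1 = -(s * Real.exp (F.logCurvature z.1) ^ 2) := fun z hz => by
    rw [hKs z.1 hz.1, LocalCoframe.abs_gaussCurvature (hK z.1 hz.1), two_mul, Real.exp_add]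
    ring
  refine ⟨e, { he with
    d_zero := ?_, d_one := ?_, d_two := ?_, d_three := ?_, d_four := ?_, d_five := ?_
    d_six := ?_, d_seven := ?_
    k_ne_zero := fun z _ => mul_ne_zero hζ (by
      rw [ne_eq, RCLike.ofReal_eq_zero]; exact Real.exp_ne_zero _)
    smooth_k := contDiffOn_const.mul (smooth_ofReal 𝕜 hu.exp)
    smooth_p := smooth_ofReal 𝕜 (LocalCoframe.smooth_logDerivPlus hK)
    smooth_m := smooth_ofReal 𝕜 (LocalCoframe.smooth_logDerivMinus hK)
    hasFDerivAt_k := ?_, hasFDerivAt_p := ?_, hasFDerivAt_m := ?_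
    hasFDerivAt_a := hdefect 0, hasFDerivAt_b := hdefect 1, hasFDerivAt_c := hdefect 2 }⟩
  -- All eight structure equations are verified alike, by evaluation on two vectors and expansion in
  -- the nine product forms; `hΓ` eliminates the surface connection form and `hcurv` replaces `K` by
  -- `-k²`.
  iterate 8
    intro z hz
    refine ContinuousLinearMap.ext fun v => ContinuousLinearMap.ext fun w => ?_
    have hv := hΓ z v hz
    have hw := hΓ z w hz
    rw [extD_scalarCoframe 𝕜 hz]
    simp only [extD_productForms hz, hcurv z hz, hk2, add_apply, smul_apply, smul_eq_mul,
      wedge_apply, scalarCoframe_apply]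
    simp [Fin.sum_univ_succ, nullCoeff, productValues, hv, hw]
    ring
  · intro z hz
    refine ((hasNullDeriv_ofReal 𝕜 (G := G)
      (LocalCoframe.hasFDerivAt_exp_logCurvature hK hz.1)).const_mul ζ).congr_fderiv ?_
    push_cast
    simp only [mul_assoc]
  · intro z hz
    refine (hasNullDeriv_ofReal 𝕜 (G := G)
      (LocalCoframe.hasFDerivAt_logDerivPlus hK s hz.1)).congr_fderiv ?_
    rw [two_mul_scaledDefect hζ, two_mul_scaledDefect hζ, hk2]
    push_cast
    rfl
  · intro z hz
    refine (hasNullDeriv_ofReal 𝕜 (G := G)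
      (LocalCoframe.hasFDerivAt_logDerivMinus hK s hz.1)).congr_fderiv ?_
    rw [two_mul_scaledDefect hζ, two_mul_scaledDefect hζ, hk2]
    push_cast
    rfl

/-- The embedding system may be replaced by the first four forms of the null coframe. -/
theorem isDarbouxIntegrable_embeddingForms_iff (F : LocalCoframe g) (G : MinkowskiFrames) :
    IsDarbouxIntegrable (F.chart.target ×ˢ G.domain)
      (fun i z => (RCLike.ofRealCLM : ℝ →L[ℝ] 𝕜).comp (embeddingForms F G i z)) ↔
    IsDarbouxIntegrable (F.chart.target ×ˢ G.domain) (firstFour (scalarCoframe 𝕜 F G)) := by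
  -- `A` and `B` express the orthonormal generators through the null generators and conversely. The
  -- coefficients are constant, so both families generate the same differential ideal.
  let A : Fin 4 → Fin 4 → 𝕜 :=
    ![![1, 0, 0, 0], ![0, 1 / 2, 1 / 2, 0], ![0, 1 / 2, -(1 / 2), 0], ![0, 0, 0, 1]]
  let B : Fin 4 → Fin 4 → 𝕜 := ![![1, 0, 0, 0], ![0, 1, 1, 0], ![0, 1, -1, 0], ![0, 0, 0, 1]]
  have hA : ∀ i (z : Plane × Six),
      (RCLike.ofRealCLM : ℝ →L[ℝ] 𝕜).comp (embeddingForms F G i z) =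
        ∑ j, A i j • firstFour (scalarCoframe 𝕜 F G) j z := by
    intro i z
    refine ContinuousLinearMap.ext fun v => ?_
    simp only [add_apply, smul_apply, firstFour, scalarCoframe_apply, Fin.sum_univ_four]
    fin_cases i <;>
      simp [A, embeddingForms, nullCoeff, productValues, Fin.sum_univ_succ] <;> ring
  have hB : ∀ i (z : Plane × Six), firstFour (scalarCoframe 𝕜 F G) i z =
      ∑ j, B i j • (RCLike.ofRealCLM : ℝ →L[ℝ] 𝕜).comp (embeddingForms F G j z) := by
    intro i z
    simp only [hA]
    refine ContinuousLinearMap.ext fun v => ?_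
    simp only [add_apply, smul_apply, Fin.sum_univ_four]
    fin_cases i <;> simp [A, B] <;> ring
  have hd : ∀ z ∈ F.chart.target ×ˢ G.domain, ∀ j,
      DifferentiableAt ℝ (firstFour (scalarCoframe 𝕜 F G) j) z := fun z hz j =>
    (((contDiffOn_const (c := (RCLike.ofRealCLM : ℝ →L[ℝ] 𝕜))).clm_comp
      (smooth_nullCoframe F G _)).contDiffAt
        ((isOpen_product F G).mem_nhds hz)).differentiableAt (by simp)
  have hd' : ∀ z ∈ F.chart.target ×ˢ G.domain, ∀ i, DifferentiableAt ℝ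
      (fun z => (RCLike.ofRealCLM : ℝ →L[ℝ] 𝕜).comp (embeddingForms F G i z)) z := fun z hz i => by
    simp only [hA]
    exact DifferentiableAt.fun_sum fun j _ => (hd z hz j).fun_const_smul _
  have h₁ := fun z hz => ideal_le_of_const_combination (ψ := fun i z =>
    (RCLike.ofRealCLM : ℝ →L[ℝ] 𝕜).comp (embeddingForms F G i z)) A hA (hd z hz)
  have h₂ := fun z hz => ideal_le_of_const_combination (φ := fun i z =>
    (RCLike.ofRealCLM : ℝ →L[ℝ] 𝕜).comp (embeddingForms F G i z)) B hB (hd' z hz)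
  exact ⟨IsDarbouxIntegrable.congr (fun z hz => le_antisymm (h₁ z hz).1 (h₂ z hz).1)
    fun z hz => le_antisymm (h₁ z hz).2 (h₂ z hz).2,
    IsDarbouxIntegrable.congr (fun z hz => le_antisymm (h₂ z hz).1 (h₁ z hz).1)
    fun z hz => le_antisymm (h₂ z hz).2 (h₁ z hz).2⟩

/-- The criterion for Darboux integrability, in given coordinates. -/
theorem isDarbouxIntegrable_iff_q (F : LocalCoframe g) (G : MinkowskiFrames)
    (hK : ∀ y ∈ F.chart.target, F.gaussCurvature y ≠ 0)
    {ζ : 𝕜} (hζ : ζ ≠ 0) {s : ℝ} (hs : ζ ^ 2 = (s : 𝕜))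
    (hKs : ∀ y ∈ F.chart.target, F.gaussCurvature y = -s * |F.gaussCurvature y|) :
    IsDarbouxIntegrable (F.chart.target ×ˢ G.domain)
      (fun i z => (RCLike.ofRealCLM : ℝ →L[ℝ] 𝕜).comp (embeddingForms F G i z)) ↔
    ∀ z ∈ F.chart.target ×ˢ G.domain,
      F.covDeriv₂ F.q 0 0 z.1 = -(3 * s) * F.q z.1 ^ (-(1 / 3) : ℝ) ∧
      F.covDeriv₂ F.q 1 1 z.1 = 3 * s * F.q z.1 ^ (-(1 / 3) : ℝ) ∧
      F.covDeriv₂ F.q 0 1 z.1 = 0 ∧ F.covDeriv₂ F.q 1 0 z.1 = 0 := by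
  obtain ⟨e, he⟩ := exists_isSingularCoframe G hK hζ hs hKs
  rw [isDarbouxIntegrable_embeddingForms_iff, he.isDarbouxIntegrable_iff]
  refine forall₂_congr fun z hz => ?_
  rw [← LocalCoframe.logDefect_iff hK s hz.1, two_mul_scaledDefect hζ, two_mul_scaledDefect hζ,
    two_mul_scaledDefect hζ]
  norm_cast

/-- The criterion for Darboux integrability of the embedding system. -/
theorem embeddingDarbouxIntegrable_iff {ζ : 𝕜} (hζ : ζ ≠ 0) {s : ℝ} (hs : ζ ^ 2 = (s : 𝕜))
    (hK : ∀ F : g.LocalCoframe, ∀ y ∈ F.chart.target, F.gaussCurvature y ≠ 0)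
    (hKs : ∀ F : g.LocalCoframe, ∀ y ∈ F.chart.target,
      F.gaussCurvature y = -s * |F.gaussCurvature y|) :
    g.EmbeddingDarbouxIntegrable 𝕜 ↔ ∀ F : g.LocalCoframe, ∀ y ∈ F.chart.target,
      F.covDeriv₂ F.q 0 0 y = -(3 * s) * F.q y ^ (-(1 / 3) : ℝ) ∧
      F.covDeriv₂ F.q 1 1 y = 3 * s * F.q y ^ (-(1 / 3) : ℝ) ∧
      F.covDeriv₂ F.q 0 1 y = 0 ∧ F.covDeriv₂ F.q 1 0 y = 0 := by
  constructor
  · intro h F y hy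
    -- The equations for `q` do not involve the frame bundle, so one point of one nonempty
    -- coordinate system on it suffices.
    exact (isDarbouxIntegrable_iff_q F boostFrames (hK F) hζ hs (hKs F)).1 (h F boostFrames)
      (y, 0) ⟨hy, Set.mem_univ _⟩
  · intro h F G
    exact (isDarbouxIntegrable_iff_q F G (hK F) hζ hs (hKs F)).2 fun z hz => h F z.1 hz.1

end LorentzianMetric

end

theorem mainTheorem3 {M : Type*} [TopologicalSpace M] [ChartedSpace Plane M]
    [IsManifold (𝓡 2) ∞ M] (g : LorentzianMetric M) :
    ((∀ F : g.LocalCoframe, ∀ y ∈ F.chart.target, F.gaussCurvature y < 0) →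
      (g.EmbeddingDarbouxIntegrable ℝ ↔
        ∀ F : g.LocalCoframe, ∀ y ∈ F.chart.target,
          F.covDeriv₂ F.q 0 0 y = -3 * F.q y ^ (-(1 / 3) : ℝ) ∧
          F.covDeriv₂ F.q 1 1 y = 3 * F.q y ^ (-(1 / 3) : ℝ) ∧
          F.covDeriv₂ F.q 0 1 y = 0 ∧ F.covDeriv₂ F.q 1 0 y = 0)) ∧
    ((∀ F : g.LocalCoframe, ∀ y ∈ F.chart.target, 0 < F.gaussCurvature y) →
      (g.EmbeddingDarbouxIntegrable ℂ ↔
        ∀ F : g.LocalCoframe, ∀ y ∈ F.chart.target,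
          F.covDeriv₂ F.q 0 0 y = 3 * F.q y ^ (-(1 / 3) : ℝ) ∧
          F.covDeriv₂ F.q 1 1 y = -3 * F.q y ^ (-(1 / 3) : ℝ) ∧
          F.covDeriv₂ F.q 0 1 y = 0 ∧ F.covDeriv₂ F.q 1 0 y = 0)) := by
  constructor
  · intro hK
    -- `K < 0`: here `k = exp u` is real, with `ζ = s = 1`, so `s = -ε`.
    have h := LorentzianMetric.embeddingDarbouxIntegrable_iff (g := g) (𝕜 := ℝ) one_ne_zero
      (s := 1) (by simp)
      (fun F y hy => (hK F y hy).ne) (fun F y hy => by rw [abs_of_neg (hK F y hy)]; ring)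
    simpa only [mul_one] using h
  · intro hK
    -- `K > 0`: here `k = i exp u`, with `ζ = i` and `s = ζ² = -1`, again `s = -ε`.
    have h := LorentzianMetric.embeddingDarbouxIntegrable_iff (g := g) Complex.I_ne_zero
      (s := -1) (by simp)
      (fun F y hy => (hK F y hy).ne') (fun F y hy => by rw [abs_of_pos (hK F y hy)]; ring)
    simpa only [mul_neg, mul_one, neg_neg] using h
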